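/- Let $k$ be a finite field and let $Q$ be a finite quiver (finitely many vertices and arrows) without oriented cycles, with path algebra $kQ$. The Hall algebra $\mathcal H(kQ)$ is the $\mathbb Q$-algebra with basis the isomorphism classes $[M]$ of finite dimensional $kQ$-modules and multiplication $$[M][N]:=\sum_{[X]}F_{MN}^X[X],\qquad F_{MN}^X:=\left|\{Y\subset X \text{ a submodule}: X/Y\cong M,\ Y\cong N\}\right|.$$ The composition algebra $\mathcal C(kQ)$ is the subalgebra of $\mathcal H(kQ)$ generated by the classes $[S]$ of the simple modules $S$. Let $\tau=D\,\mathrm{Ext}^1_{kQ}(-,kQ)$, with $D=\mathrm{Hom}_k(-,k)$, be the Auslander--Reiten translation. An indecomposable module is called preprojective (respectively preinjective) if it is isomorphic to $\tau^{-n}P$ with $P$ indecomposable projective (respectively $\tau^{n}I$ with $I$ indecomposable injective) for some $n\geq 0$, and an arbitrary finite dimensional module is called preprojective (respectively preinjective) if it is a finite direct sum of indecomposable preprojective (respectively preinjective) modules. Let $\mathcal P(kQ)$ (respectively $\mathcal I(kQ)$) be the subalgebra of $\mathcal H(kQ)$ generated by the classes of all preprojective (respectively preinjective) modules. Then $$\mathcal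 P(kQ)\subseteq\mathcal C(kQ)\qquad\text{and}\qquad\mathcal I(kQ)\subseteq\mathcal C(kQ).$$ -/

import Mathlib

open MulOpposite

universe u v w

/-! ### Quivers and path algebras -/

/-- A quiver without oriented cycles: the only paths from a vertex to itself are the trivial
ones. -/
class Quiver.NoOrientedCycles (Q : Type v) [Quiver.{w} Q] : Prop where
  eq_nil : ∀ (i : Q) (p : Quiver.Path i i), p = Quiver.Path.nil

/-- The `k`-bilinear extension of the concatenation of paths. -/
noncomputable def Quiver.pathConcat (k : Type u) [Field k] {Q : Type v} [Quiver.{w} Q] (i j l : Q) :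
    (Quiver.Path i j →₀ k) →ₗ[k] (Quiver.Path j l →₀ k) →ₗ[k] (Quiver.Path i l →₀ k) :=
  Finsupp.lsum k fun p => LinearMap.toSpanSingleton k _
    (Finsupp.lmapDomain k k fun q => p.comp q)

/-- The path algebra `kQ` of a quiver `Q` with finitely many vertices: the space with basis the
paths of `Q`, where `x i j` is the component of `x` in the span of the paths from `i` to `j`.
The product `q * p` of two paths is "first `p`, then `q`" if `p` ends where `q` starts, and `0`
otherwise; so a left module is the same as a (covariant) representation of `Q`. -/
def PathAlgebra (k : Type u) [Field k] (Q : Type v) [Quiver.{w} Q] : Type (max u v w) :=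
  ∀ i j : Q, Quiver.Path i j →₀ k

namespace PathAlgebra

variable (k : Type u) [Field k] (Q : Type v) [Quiver.{w} Q]

noncomputable instance : AddCommGroup (PathAlgebra k Q) :=
  inferInstanceAs (AddCommGroup (∀ i j : Q, Quiver.Path i j →₀ k))

noncomputable instance : Module k (PathAlgebra k Q) :=
  inferInstanceAs (Module k (∀ i j : Q, Quiver.Path i j →₀ k))

variable {k Q}

@[ext] theorem ext {x y : PathAlgebra k Q} (h : ∀ i j, x i j = y i j) : x = y :=
  funext fun i => funext fun j => h i j

@[simp] theorem add_apply (x y : PathAlgebra k Q) (i j : Q) : (x + y) i j = x i j + y i j := rfl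
@[simp] theorem zero_apply (i j : Q) : (0 : PathAlgebra k Q) i j = 0 := rfl
@[simp] theorem smul_apply (c : k) (x : PathAlgebra k Q) (i j : Q) : (c • x) i j = c • x i j := rfl

theorem pathConcat_single {i j l : Q} (p : Quiver.Path i j) (q : Quiver.Path j l) (a b : k) :
    Quiver.pathConcat k i j l (Finsupp.single p a) (Finsupp.single q b) =
      Finsupp.single (p.comp q) (a * b) := by
  simp [Quiver.pathConcat]

theorem pathConcat_assoc {i j l m : Q} (x : Quiver.Path i j →₀ k) (y : Quiver.Path j l →₀ k)
    (z : Quiver.Path l m →₀ k) :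
    Quiver.pathConcat k i l m (Quiver.pathConcat k i j l x y) z =
      Quiver.pathConcat k i j m x (Quiver.pathConcat k j l m y z) := by
  induction x using Finsupp.induction_linear with
  | zero => simp
  | add f g hf hg => simp [hf, hg]
  | single p a =>
    induction y using Finsupp.induction_linear with
    | zero => simp
    | add f g hf hg => simp [hf, hg]
    | single q b =>
      induction z using Finsupp.induction_linear with
      | zero => simp
      | add f g hf hg => simp [hf, hg]
      | single r c => simp only [pathConcat_single, mul_assoc, Quiver.Path.comp_assoc]

theorem nil_pathConcat {i j : Q} (x : Quiver.Path i j →₀ k) :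
    Quiver.pathConcat k i i j (Finsupp.single Quiver.Path.nil 1) x = x := by
  induction x using Finsupp.induction_linear with
  | zero => simp
  | add f g hf hg => simp [hf, hg]
  | single p a => simp [pathConcat_single]

theorem pathConcat_nil {i j : Q} (x : Quiver.Path i j →₀ k) :
    Quiver.pathConcat k i j j x (Finsupp.single Quiver.Path.nil 1) = x := by
  induction x using Finsupp.induction_linear with
  | zero => simp
  | add f g hf hg => simp [hf, hg]
  | single p a => simp [pathConcat_single]

/-- The unit is the sum of the trivial paths. -/
noncomputable instance : One (PathAlgebra k Q) :=
  ⟨fun i => by classical exact Pi.single i (Finsupp.single Quiver.Path.nil 1)⟩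

theorem one_apply_self (i : Q) :
    (1 : PathAlgebra k Q) i i = Finsupp.single Quiver.Path.nil 1 := by
  classical
  exact Pi.single_eq_same (M := fun j => Quiver.Path i j →₀ k) i _

theorem one_apply_ne {i j : Q} (h : i ≠ j) : (1 : PathAlgebra k Q) i j = 0 := by
  classical
  exact Pi.single_eq_of_ne (M := fun j => Quiver.Path i j →₀ k) h.symm _

variable [Fintype Q]

noncomputable instance : Mul (PathAlgebra k Q) :=
  ⟨fun x y i l => ∑ j, Quiver.pathConcat k i j l (y i j) (x j l)⟩

theorem mul_apply (x y : PathAlgebra k Q) (i l : Q) :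
    (x * y) i l = ∑ j, Quiver.pathConcat k i j l (y i j) (x j l) := rfl

noncomputable instance : Ring (PathAlgebra k Q) :=
  { (inferInstance : AddCommGroup (PathAlgebra k Q)) with
    mul := (· * ·)
    one := 1
    left_distrib := fun x y z => by
      ext1 i l; simp [mul_apply, Finset.sum_add_distrib]
    right_distrib := fun x y z => by
      ext1 i l; simp [mul_apply, Finset.sum_add_distrib]
    zero_mul := fun x => by ext1 i l; simp [mul_apply]
    mul_zero := fun x => by ext1 i l; simp [mul_apply]
    mul_assoc := fun x y z => by
      ext1 i l
      simp only [mul_apply, map_sum, LinearMap.sum_apply]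
      rw [Finset.sum_comm]
      simp only [pathConcat_assoc]
    one_mul := fun x => by
      ext1 i l
      rw [mul_apply, Finset.sum_eq_single l]
      · rw [one_apply_self, pathConcat_nil]
      · intro j _ hj
        rw [one_apply_ne hj, map_zero]
      · simp
    mul_one := fun x => by
      ext1 i l
      rw [mul_apply, Finset.sum_eq_single i]
      · rw [one_apply_self, nil_pathConcat]
      · intro j _ hj
        rw [one_apply_ne hj.symm, map_zero, LinearMap.zero_apply]
      · simp }

noncomputable instance : Algebra k (PathAlgebra k Q) :=
  Algebra.ofModule
    (fun c x y => by ext1 i l; simp [mul_apply, Finset.smul_sum])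
    (fun c x y => by ext1 i l; simp [mul_apply, Finset.smul_sum])

end PathAlgebra

theorem Quiver.finite_path (Q : Type v) [Quiver.{w} Q] [Finite Q] [∀ i j : Q, Finite (i ⟶ j)]
    [Quiver.NoOrientedCycles Q] (i j : Q) : Finite (Quiver.Path i j) := by
  let r : Q → Q → Prop := fun a b => ∃ p : Quiver.Path a b, p.length ≠ 0
  have : IsTrans Q r := ⟨by
    rintro a b c ⟨p, hp⟩ ⟨q, hq⟩
    exact ⟨p.comp q, by rw [Quiver.Path.length_comp]; omega⟩⟩
  have : Std.Irrefl r := ⟨by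
    rintro a ⟨p, hp⟩
    rw [Quiver.NoOrientedCycles.eq_nil a p] at hp
    exact hp rfl⟩
  have hwf : WellFounded r := Finite.wellFounded_of_trans_of_irrefl r
  induction j using hwf.induction with
  | _ j ih =>
    let g : Quiver.Path i j →
        Option (Σ b : {b : Q // Nonempty (b ⟶ j)}, Quiver.Path i b.1 × (b.1 ⟶ j)) :=
      fun p => match p with
        | .nil => none
        | .cons q e => some ⟨⟨_, ⟨e⟩⟩, q, e⟩
    have : ∀ b : {b : Q // Nonempty (b ⟶ j)}, Finite (Quiver.Path i b.1) := fun b =>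
      ih b.1 ⟨b.2.some.toPath, by simp [Quiver.Hom.toPath]⟩
    refine Finite.of_injective g ?_
    intro p q h
    cases p with
    | nil =>
      cases q with
      | nil => rfl
      | cons q e => simp [g] at h
    | cons p e =>
      cases q with
      | nil => simp [g] at h
      | cons q e' =>
        simp only [g, Option.some.injEq, Sigma.mk.injEq, Subtype.mk.injEq] at h
        obtain ⟨h1, h2⟩ := h
        subst h1
        simp only [heq_eq_eq, Prod.mk.injEq] at h2
        rw [h2.1, h2.2]

instance PathAlgebra.finite (k : Type u) [Field k] (Q : Type v) [Quiver.{w} Q] [Fintype Q]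
    [∀ i j : Q, Finite (i ⟶ j)] [Quiver.NoOrientedCycles Q] :
    Module.Finite k (PathAlgebra k Q) := by
  have : ∀ i j : Q, Finite (Quiver.Path i j) := Quiver.finite_path Q
  exact inferInstanceAs (Module.Finite k (∀ i j : Q, Quiver.Path i j →₀ k))

/-! ### Finite-dimensional modules over an algebra -/

/-- Finite-dimensional left modules over a `k`-algebra `A`. The `k`-space structure is the one
that comes from `A`, by `IsScalarTower`. -/
structure FDMod (k : Type v) [Field k] (A : Type u) [Ring A] [Algebra k A] where
  carrier : Type u
  [addCommGroup : AddCommGroup carrier]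
  [module : Module A carrier]
  [vectorSpace : Module k carrier]
  [isScalarTower : IsScalarTower k A carrier]
  [finiteDimensional : Module.Finite k carrier]

namespace FDMod

variable {k : Type v} [Field k] {A : Type u} [Ring A] [Algebra k A]

instance : CoeSort (FDMod k A) (Type u) := ⟨FDMod.carrier⟩

attribute [instance] addCommGroup module vectorSpace isScalarTower finiteDimensional

instance isoSetoid : Setoid (FDMod k A) where
  r M N := Nonempty (M ≃ₗ[A] N)
  iseqv := ⟨fun M => ⟨LinearEquiv.refl A M⟩, fun ⟨e⟩ => ⟨e.symm⟩, fun ⟨e⟩ ⟨f⟩ => ⟨e.trans f⟩⟩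

/-- An indecomposable module: nonzero, and not the direct sum of two nonzero submodules. -/
def IsIndecomposable (M : FDMod k A) : Prop :=
  Nontrivial M ∧ ∀ U W : Submodule A M, IsCompl U W → U = ⊥ ∨ W = ⊥

/-- `Hom_A(f, A) : Hom_A(P₀, A) → Hom_A(P₁, A)` for `f : P₁ → P₀`, a map of right `A`-modules. -/
def homDual {P₁ P₀ : FDMod k A} (f : P₁ →ₗ[A] P₀) : (P₀ →ₗ[A] A) →ₗ[Aᵐᵒᵖ] (P₁ →ₗ[A] A) where
  toFun g := g ∘ₗ f
  map_add' _ _ := rfl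
  map_smul' _ _ := rfl

/-- The cokernel of `Hom_A(f, A)`, a right `A`-module. If `0 → P₁ → P₀ → M → 0` is a projective
resolution with first map `f`, this is `Ext¹_A(M, A)`. -/
abbrev ExtOne {P₁ P₀ : FDMod k A} (f : P₁ →ₗ[A] P₀) : Type u :=
  (P₁ →ₗ[A] A) ⧸ LinearMap.range (homDual f)

/-- `L ≅ τ M` where `τ M = D Ext¹_A(M, A)` is the Auslander-Reiten translate of a module `M` over
a hereditary algebra `A`, with `D = Hom_k(-, k)` and `Ext¹` computed from a projective resolution
`0 → P₁ → P₀ → M → 0`. The map `e` is an isomorphism of left `A`-modules from `L` to `τ M`. -/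
def IsARTranslate (L M : FDMod k A) : Prop :=
  ∃ (P₁ P₀ : FDMod k A) (f : P₁ →ₗ[A] P₀) (p : P₀ →ₗ[A] M),
    Module.Projective A P₁ ∧ Module.Projective A P₀ ∧
    Function.Injective f ∧ Function.Exact f p ∧ Function.Surjective p ∧
    ∃ e : L ≃ₗ[k] (ExtOne f →ₗ[k] k),
      ∀ (a : A) (l : L) (x : ExtOne f), e (a • l) x = e l (op a • x)

/-- The indecomposable preprojective modules over a hereditary algebra, that is, the indecomposable
modules `τ⁻ⁿ P` with `P` indecomposable projective and `n ≥ 0`. -/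
inductive IsIndecPreprojective : FDMod k A → Prop
  | projective (P : FDMod k A) (hP : P.IsIndecomposable) (hproj : Module.Projective A P) :
      IsIndecPreprojective P
  | translate (L M : FDMod k A) (hL : IsIndecPreprojective L) (hM : M.IsIndecomposable)
      (h : IsARTranslate L M) : IsIndecPreprojective M

/-- The indecomposable preinjective modules over a hereditary algebra, that is, the indecomposable
modules `τⁿ I` with `I` indecomposable injective and `n ≥ 0`. -/
inductive IsIndecPreinjective : FDMod k A → Prop
  | injective (I : FDMod k A) (hI : I.IsIndecomposable) (hinj : Module.Injective A I) :
      IsIndecPreinjective I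
  | translate (L M : FDMod k A) (hM : IsIndecPreinjective M) (hL : L.IsIndecomposable)
      (h : IsARTranslate L M) : IsIndecPreinjective L

/-- A module is preprojective if it is a finite direct sum of indecomposable preprojectives. -/
def IsPreprojective (M : FDMod k A) : Prop :=
  ∃ (n : ℕ) (N : Fin n → FDMod k A), (∀ i, IsIndecPreprojective (N i)) ∧
    Nonempty (M ≃ₗ[A] ∀ i, N i)

/-- A module is preinjective if it is a finite direct sum of indecomposable preinjectives. -/
def IsPreinjective (M : FDMod k A) : Prop :=
  ∃ (n : ℕ) (N : Fin n → FDMod k A), (∀ i, IsIndecPreinjective (N i)) ∧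
    Nonempty (M ≃ₗ[A] ∀ i, N i)

/-- The zero module. -/
def zero (k : Type v) [Field k] (A : Type u) [Ring A] [Algebra k A] : FDMod k A where
  carrier := PUnit

/-- A submodule, as a module. -/
def ofSub {X : FDMod k A} (Y : Submodule A X) : FDMod k A where
  carrier := Y
  finiteDimensional := inferInstanceAs (Module.Finite k (Y.restrictScalars k))

/-- A quotient module. -/
def quot {X : FDMod k A} (Y : Submodule A X) : FDMod k A where
  carrier := X ⧸ Y
  finiteDimensional := Module.Finite.of_surjective
    (Y.mkQ.restrictScalars k) Y.mkQ_surjective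

/-- The Hall number `F_{MN}^X`, the number of submodules `Y` of `X` with `X/Y ≅ M` and `Y ≅ N`. -/
noncomputable def hallNumber (M N X : FDMod k A) : ℕ :=
  Nat.card {Y : Submodule A X // Nonempty ((X ⧸ Y) ≃ₗ[A] M) ∧ Nonempty (Y ≃ₗ[A] N)}

theorem hallNumber_congr {M M' N N' X X' : FDMod k A} (hM : Nonempty (M ≃ₗ[A] M'))
    (hN : Nonempty (N ≃ₗ[A] N')) (hX : Nonempty (X ≃ₗ[A] X')) :
    hallNumber M N X = hallNumber M' N' X' := by
  obtain ⟨f⟩ := hM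
  obtain ⟨g⟩ := hN
  obtain ⟨e⟩ := hX
  refine Nat.card_congr (Equiv.subtypeEquiv (Submodule.orderIsoMapComap e).toEquiv fun Y => ?_)
  have e₁ : (X ⧸ Y) ≃ₗ[A] (X' ⧸ Y.map (e : X →ₗ[A] X')) :=
    Submodule.Quotient.equiv Y _ e rfl
  have e₂ : Y ≃ₗ[A] Y.map (e : X →ₗ[A] X') := e.submoduleMap Y
  exact and_congr
    ⟨fun ⟨h⟩ => ⟨(e₁.symm.trans h).trans f⟩, fun ⟨h⟩ => ⟨(e₁.trans h).trans f.symm⟩⟩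
    ⟨fun ⟨h⟩ => ⟨(e₂.symm.trans h).trans g⟩, fun ⟨h⟩ => ⟨(e₂.trans h).trans g.symm⟩⟩

end FDMod

theorem Submodule.nonempty_quot_equiv_map {R : Type*} [Ring R] {Z : Type*} [AddCommGroup Z] [Module R Z]
    {Y Y' : Submodule R Z} :
    Nonempty ((Y' ⧸ Y.submoduleOf Y') ≃ₗ[R] Y'.map Y.mkQ) := by
  let f : Y' →ₗ[R] (Z ⧸ Y) := Y.mkQ ∘ₗ Y'.subtype
  have hk : LinearMap.ker f = Y.submoduleOf Y' := by
    simp [f, LinearMap.ker_comp, Submodule.submoduleOf]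
  have hr : LinearMap.range f = Y'.map Y.mkQ := by
    simp [f, LinearMap.range_comp]
  exact ⟨(Submodule.quotEquivOfEq _ _ hk.symm).trans
    (f.quotKerEquivRange.trans (LinearEquiv.ofEq _ _ hr))⟩

set_option maxHeartbeats 1600000 in
/-- Two ways of writing a two-step filtration of `Z` with prescribed subquotients. -/
theorem Submodule.nonempty_flag_equiv {R : Type*} [Ring R] (Z M N L : Type*) [AddCommGroup Z]
    [Module R Z] [AddCommGroup M] [Module R M] [AddCommGroup N] [Module R N] [AddCommGroup L]
    [Module R L] :
    Nonempty ((Σ Y : {Y : Submodule R Z // Nonempty (Y ≃ₗ[R] L)},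
      {W : Submodule R (Z ⧸ Y.1) // Nonempty (((Z ⧸ Y.1) ⧸ W) ≃ₗ[R] M) ∧
        Nonempty (W ≃ₗ[R] N)}) ≃
      (Σ Y : {Y : Submodule R Z // Nonempty ((Z ⧸ Y) ≃ₗ[R] M)},
      {U : Submodule R Y.1 // Nonempty ((Y.1 ⧸ U) ≃ₗ[R] N) ∧ Nonempty (U ≃ₗ[R] L)})) := by
  let T := {p : Submodule R Z × Submodule R Z // p.1 ≤ p.2 ∧ Nonempty ((Z ⧸ p.2) ≃ₗ[R] M) ∧
    Nonempty ((p.2 ⧸ p.1.submoduleOf p.2) ≃ₗ[R] N) ∧ Nonempty (p.1 ≃ₗ[R] L)}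
  let a : (Σ Y : {Y : Submodule R Z // Nonempty (Y ≃ₗ[R] L)},
      {W : Submodule R (Z ⧸ Y.1) // Nonempty (((Z ⧸ Y.1) ⧸ W) ≃ₗ[R] M) ∧
        Nonempty (W ≃ₗ[R] N)}) ≃ T :=
    { toFun := fun q => ⟨(q.1.1, q.2.1.comap q.1.1.mkQ), by
        have hle : q.1.1 ≤ q.2.1.comap q.1.1.mkQ := Submodule.le_comap_mkQ _ _
        have hmap : (q.2.1.comap q.1.1.mkQ).map q.1.1.mkQ = q.2.1 :=
          Submodule.map_comap_eq_of_surjective (Submodule.mkQ_surjective _) _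
        obtain ⟨e₁⟩ := q.2.2.1
        obtain ⟨e₂⟩ := q.2.2.2
        refine ⟨hle, ⟨?_⟩, ?_, q.1.2⟩
        · exact (Submodule.quotientQuotientEquivQuotient _ _ hle).symm.trans
            ((Submodule.quotEquivOfEq _ _ hmap).trans e₁)
        · obtain ⟨e⟩ := Submodule.nonempty_quot_equiv_map (Y := q.1.1) (Y' := q.2.1.comap q.1.1.mkQ)
          exact ⟨e.trans ((LinearEquiv.ofEq _ _ hmap).trans e₂)⟩⟩
      invFun := fun p => ⟨⟨p.1.1, p.2.2.2.2⟩, ⟨p.1.2.map p.1.1.mkQ, by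
        obtain ⟨e₁⟩ := p.2.2.1
        obtain ⟨e₂⟩ := p.2.2.2.1
        obtain ⟨e⟩ := Submodule.nonempty_quot_equiv_map (Y := p.1.1) (Y' := p.1.2)
        exact ⟨⟨(Submodule.quotientQuotientEquivQuotient _ _ p.2.1).trans e₁⟩,
          ⟨e.symm.trans e₂⟩⟩⟩⟩
      left_inv := fun q => by
        refine Sigma.ext rfl (heq_of_eq (Subtype.ext ?_))
        exact Submodule.map_comap_eq_of_surjective (Submodule.mkQ_surjective _) _
      right_inv := fun p => by
        refine Subtype.ext (Prod.ext rfl ?_)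
        change (p.1.2.map p.1.1.mkQ).comap p.1.1.mkQ = p.1.2
        rw [Submodule.comap_map_mkQ]
        exact sup_eq_right.mpr p.2.1 }
  have key : ∀ (Y : Submodule R Z) (U : Submodule R Y), Nonempty ((Y ⧸ U) ≃ₗ[R] N) →
      Nonempty ((Y ⧸ (U.map Y.subtype).submoduleOf Y) ≃ₗ[R] N) := fun Y U ⟨e⟩ => by
    have hc : (U.map Y.subtype).submoduleOf Y = U :=
      Submodule.comap_map_eq_of_injective Y.subtype_injective U
    rw [hc]
    exact ⟨e⟩
  have key' : ∀ (Y : Submodule R Z) (U : Submodule R Y), Nonempty (U ≃ₗ[R] L) →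
      Nonempty (U.map Y.subtype ≃ₗ[R] L) := fun Y U ⟨e⟩ =>
    ⟨(Submodule.equivMapOfInjective Y.subtype Y.subtype_injective U).symm.trans e⟩
  let b : (Σ Y : {Y : Submodule R Z // Nonempty ((Z ⧸ Y) ≃ₗ[R] M)},
      {U : Submodule R Y.1 // Nonempty ((Y.1 ⧸ U) ≃ₗ[R] N) ∧ Nonempty (U ≃ₗ[R] L)}) ≃ T :=
    { toFun := fun q => ⟨(q.2.1.map q.1.1.subtype, q.1.1),
        Submodule.map_subtype_le _ _, q.1.2, key q.1.1 q.2.1 q.2.2.1, key' q.1.1 q.2.1 q.2.2.2⟩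
      invFun := fun p => ⟨⟨p.1.2, p.2.2.1⟩, ⟨p.1.1.submoduleOf p.1.2, by
        obtain ⟨e₂⟩ := p.2.2.2.2
        exact ⟨p.2.2.2.1, ⟨(Submodule.submoduleOfEquivOfLe p.2.1).trans e₂⟩⟩⟩⟩
      left_inv := fun q => by
        refine Sigma.ext rfl (heq_of_eq (Subtype.ext ?_))
        exact Submodule.comap_map_eq_of_injective q.1.1.subtype_injective q.2.1
      right_inv := fun p => by
        refine Subtype.ext (Prod.ext ?_ rfl)
        change (p.1.1.submoduleOf p.1.2).map p.1.2.subtype = p.1.1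
        rw [Submodule.submoduleOf, Submodule.map_comap_subtype]
        exact inf_eq_right.mpr p.2.1 }
  exact ⟨a.trans b.symm⟩

/-- Isomorphism classes of finite-dimensional `A`-modules. -/
def IsoClass (k : Type v) [Field k] (A : Type u) [Ring A] [Algebra k A] : Type (max v (u + 1)) :=
  Quotient (FDMod.isoSetoid (k := k) (A := A))

namespace IsoClass

variable {k : Type v} [Field k] {A : Type u} [Ring A] [Algebra k A]

/-- The isomorphism class of a module. -/
def mk (M : FDMod k A) : IsoClass k A := Quotient.mk _ M

theorem mk_eq_mk {M N : FDMod k A} : mk M = mk N ↔ Nonempty (M ≃ₗ[A] N) :=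
  Quotient.eq (r := FDMod.isoSetoid)

/-- The Hall number, as a function of isomorphism classes. -/
noncomputable def hallNumber (m n x : IsoClass k A) : ℕ :=
  FDMod.hallNumber (Quotient.out m) (Quotient.out n) (Quotient.out x)

theorem nonempty_out_mk (M : FDMod k A) :
    Nonempty ((Quotient.out (mk M) : FDMod k A) ≃ₗ[A] M) :=
  Quotient.exact (Quotient.out_eq (mk M))

theorem hallNumber_mk (M N X : FDMod k A) :
    hallNumber (mk M) (mk N) (mk X) = FDMod.hallNumber M N X :=
  FDMod.hallNumber_congr (nonempty_out_mk M) (nonempty_out_mk N) (nonempty_out_mk X)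

variable [Finite k] [Module.Finite k A]

theorem finite_card_eq (c : ℕ) :
    {x : IsoClass k A | Nat.card (Quotient.out x : FDMod k A) = c}.Finite := by
  have : Finite A := Module.finite_of_finite k
  have hfin : ∀ X : FDMod k A, Finite X := fun X => Module.finite_of_finite k
  have hne : ∀ x : {x : IsoClass k A | Nat.card (Quotient.out x : FDMod k A) = c},
      Nonempty ((Quotient.out x.1 : FDMod k A) ≃ Fin c) := fun x =>
    ⟨Finite.equivFinOfCardEq x.2⟩
  let e := fun x => (hne x).some
  let t : {x : IsoClass k A | Nat.card (Quotient.out x : FDMod k A) = c} →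
      (Fin c → Fin c → Fin c) × (A → Fin c → Fin c) := fun x =>
    (fun a b => e x ((e x).symm a + (e x).symm b), fun r a => e x (r • (e x).symm a))
  have ht : Function.Injective t := by
    intro x y h
    have h1 := congrArg Prod.fst h
    have h2 := congrArg Prod.snd h
    refine Subtype.ext ?_
    rw [← Quotient.out_eq x.1, ← Quotient.out_eq y.1]
    refine Quotient.sound ⟨?_⟩
    exact
      { (e x).trans (e y).symm with
        map_add' := fun a b => by
          have := congrFun (congrFun h1 (e x a)) (e x b)
          simp only [t, Equiv.symm_apply_apply] at this
          simp [this]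
        map_smul' := fun r a => by
          have := congrFun (congrFun h2 r) (e x a)
          simp only [t, Equiv.symm_apply_apply] at this
          simp [this] }
  have := Finite.of_injective t ht
  exact Set.toFinite _

theorem finite_support (m n : IsoClass k A) :
    (Function.support fun x => (hallNumber m n x : ℚ)).Finite := by
  refine (finite_card_eq (k := k) (A := A)
    (Nat.card (Quotient.out m : FDMod k A) * Nat.card (Quotient.out n : FDMod k A))).subset ?_
  intro x hx
  have hx' : hallNumber m n x ≠ 0 := by simpa using hx
  have : Nonempty _ := (Nat.card_ne_zero.mp hx').1
  obtain ⟨Y, ⟨e⟩, ⟨f⟩⟩ := this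
  have h := Submodule.card_eq_card_quotient_mul_card Y
  rw [Set.mem_ofPred_eq, h, Nat.card_congr e.toEquiv, Nat.card_congr f.toEquiv, mul_comm]

end IsoClass

/-- The Hall algebra of a finite-dimensional algebra `A` over a finite field `k`: the `ℚ`-algebra
with basis the isomorphism classes `[M]` of finite-dimensional `A`-modules and multiplication
`[M][N] = ∑ F_{MN}^X [X]`, the sum over all isomorphism classes `[X]`. -/
def HallAlgebra (k : Type v) [Field k] (A : Type u) [Ring A] [Algebra k A] : Type (max v (u + 1)) :=
  IsoClass k A →₀ ℚ

namespace HallAlgebra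

variable {k : Type v} [Field k] {A : Type u} [Ring A] [Algebra k A]

noncomputable instance : AddCommGroup (HallAlgebra k A) :=
  inferInstanceAs (AddCommGroup (IsoClass k A →₀ ℚ))

noncomputable instance : Module ℚ (HallAlgebra k A) :=
  inferInstanceAs (Module ℚ (IsoClass k A →₀ ℚ))

/-- The elements of the Hall algebra as finitely supported functions on isomorphism classes. -/
noncomputable def repr : HallAlgebra k A ≃ₗ[ℚ] (IsoClass k A →₀ ℚ) := LinearEquiv.refl ℚ _

/-- The class `[M]` of a module in the Hall algebra. -/
noncomputable def cls (M : FDMod k A) : HallAlgebra k A :=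
  repr.symm (Finsupp.single (IsoClass.mk M) 1)

/-- The coefficient of `[X]`. -/
noncomputable def coeff (X : FDMod k A) : HallAlgebra k A →ₗ[ℚ] ℚ :=
  Finsupp.lapply (IsoClass.mk X) ∘ₗ repr.toLinearMap

theorem coeff_cls (X M : FDMod k A) [Decidable (Nonempty (X ≃ₗ[A] M))] :
    coeff X (cls M) = if Nonempty (X ≃ₗ[A] M) then 1 else 0 := by
  classical
  simp only [coeff, cls, LinearMap.comp_apply, LinearEquiv.coe_coe, LinearEquiv.apply_symm_apply,
    Finsupp.lapply_apply, Finsupp.single_apply, ← IsoClass.mk_eq_mk, eq_comm]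

theorem ext_coeff {x y : HallAlgebra k A} (h : ∀ X, coeff X x = coeff X y) : x = y :=
  repr.injective <| Finsupp.ext fun m => by
    induction m using Quotient.inductionOn with
    | _ M => exact h M

theorem induction_cls {p : HallAlgebra k A → Prop} (x : HallAlgebra k A) (zero : p 0)
    (add : ∀ x y, p x → p y → p (x + y)) (smul : ∀ (c : ℚ) M, p (c • cls M)) : p x := by
  obtain ⟨x, rfl⟩ := repr.symm.surjective x
  induction x using Finsupp.induction_linear with
  | zero => simpa using zero
  | add f g hf hg => simpa using add _ _ hf hg
  | single m c =>
    induction m using Quotient.inductionOn with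
    | _ M =>
      have := smul c M
      rw [cls, ← map_smul, Finsupp.smul_single, smul_eq_mul, mul_one] at this
      exact this

theorem finite_submodule [Finite k] (Z : FDMod k A) : Finite (Submodule A Z) := by
  have : Finite Z := Module.finite_of_finite k
  exact Finite.of_injective (fun Y : Submodule A Z => (Y : Set Z)) SetLike.coe_injective

variable [Finite k] [Module.Finite k A]

/-- The product `[M][N] = ∑ F_{MN}^X [X]` of two basis elements. -/
noncomputable def hallProd (m n : IsoClass k A) : HallAlgebra k A :=
  repr.symm (Finsupp.ofSupportFinite (fun x => (IsoClass.hallNumber m n x : ℚ))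
    (IsoClass.finite_support m n))

/-- The bilinear extension of the product of basis elements. -/
noncomputable def mulHom : HallAlgebra k A →ₗ[ℚ] HallAlgebra k A →ₗ[ℚ] HallAlgebra k A :=
  (Finsupp.lsum ℚ fun m => LinearMap.toSpanSingleton ℚ (HallAlgebra k A →ₗ[ℚ] HallAlgebra k A)
    (Finsupp.linearCombination ℚ (hallProd m) ∘ₗ repr.toLinearMap)) ∘ₗ repr.toLinearMap

noncomputable instance : Mul (HallAlgebra k A) := ⟨fun x y => mulHom x y⟩

noncomputable instance : One (HallAlgebra k A) := ⟨cls (FDMod.zero k A)⟩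

theorem mul_def (x y : HallAlgebra k A) : x * y = mulHom x y := rfl

theorem coeff_cls_mul_cls (M N X : FDMod k A) :
    coeff X (cls M * cls N) = (FDMod.hallNumber M N X : ℚ) := by
  have : cls M * cls N = hallProd (IsoClass.mk M) (IsoClass.mk N) := by
    simp [mul_def, mulHom, cls]
  rw [this, ← IsoClass.hallNumber_mk]
  simp only [coeff, hallProd, LinearMap.comp_apply, LinearEquiv.coe_coe,
    LinearEquiv.apply_symm_apply]
  rfl

theorem coeff_mul_cls (Z L : FDMod k A) (y : HallAlgebra k A) :
    coeff Z (y * cls L) =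
      ∑ᶠ Y : {Y : Submodule A Z // Nonempty (Y ≃ₗ[A] L)}, coeff (FDMod.quot Y.1) y := by
  classical
  have := finite_submodule Z
  have := Fintype.ofFinite {Y : Submodule A Z // Nonempty (Y ≃ₗ[A] L)}
  rw [finsum_eq_sum_of_fintype]
  induction y using induction_cls with
  | zero => simp [mul_def]
  | add x y hx hy =>
    simp only [mul_def, map_add, LinearMap.add_apply, Finset.sum_add_distrib] at hx hy ⊢
    rw [hx, hy]
  | smul c M =>
    have : coeff Z (cls M * cls L) = ∑ Y : {Y : Submodule A Z // Nonempty (Y ≃ₗ[A] L)},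
        coeff (FDMod.quot Y.1) (cls M) := by
      simp only [coeff_cls_mul_cls, coeff_cls, Finset.sum_boole]
      rw [FDMod.hallNumber, ← Fintype.card_subtype, ← Nat.card_eq_fintype_card]
      refine congrArg Nat.cast (Nat.card_congr ?_)
      exact ((Equiv.subtypeSubtypeEquivSubtypeInter
        (fun Y : Submodule A Z => Nonempty (Y ≃ₗ[A] L))
        (fun Y : Submodule A Z => Nonempty ((Z ⧸ Y) ≃ₗ[A] M))).trans
        (Equiv.subtypeEquivRight fun Y => and_comm)).symm
    simp only [mul_def, map_smul, LinearMap.smul_apply, ← Finset.smul_sum] at this ⊢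
    rw [this]

theorem coeff_cls_mul (Z M : FDMod k A) (y : HallAlgebra k A) :
    coeff Z (cls M * y) =
      ∑ᶠ Y : {Y : Submodule A Z // Nonempty ((Z ⧸ Y) ≃ₗ[A] M)}, coeff (FDMod.ofSub Y.1) y := by
  classical
  have := finite_submodule Z
  have := Fintype.ofFinite {Y : Submodule A Z // Nonempty ((Z ⧸ Y) ≃ₗ[A] M)}
  rw [finsum_eq_sum_of_fintype]
  induction y using induction_cls with
  | zero => simp [mul_def]
  | add x y hx hy =>
    simp only [mul_def, map_add, Finset.sum_add_distrib] at hx hy ⊢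
    rw [hx, hy]
  | smul c L =>
    have : coeff Z (cls M * cls L) = ∑ Y : {Y : Submodule A Z // Nonempty ((Z ⧸ Y) ≃ₗ[A] M)},
        coeff (FDMod.ofSub Y.1) (cls L) := by
      simp only [coeff_cls_mul_cls, coeff_cls, Finset.sum_boole]
      rw [FDMod.hallNumber, ← Fintype.card_subtype, ← Nat.card_eq_fintype_card]
      refine congrArg Nat.cast (Nat.card_congr ?_)
      exact (Equiv.subtypeSubtypeEquivSubtypeInter
        (fun Y : Submodule A Z => Nonempty ((Z ⧸ Y) ≃ₗ[A] M))
        (fun Y : Submodule A Z => Nonempty (Y ≃ₗ[A] L))).symm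
    simp only [mul_def, map_smul, ← Finset.smul_sum] at this ⊢
    rw [this]

theorem cls_mul_assoc (M N L : FDMod k A) :
    cls M * cls N * cls L = cls M * (cls N * cls L) := by
  refine ext_coeff fun Z => ?_
  have := finite_submodule Z
  have := Fintype.ofFinite {Y : Submodule A Z // Nonempty (Y ≃ₗ[A] L)}
  have := Fintype.ofFinite {Y : Submodule A Z // Nonempty ((Z ⧸ Y) ≃ₗ[A] M)}
  rw [coeff_mul_cls, coeff_cls_mul, finsum_eq_sum_of_fintype, finsum_eq_sum_of_fintype]
  simp only [coeff_cls_mul_cls, FDMod.hallNumber]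
  have h1 : ∀ Y : Submodule A Z, Finite (Submodule A (FDMod.quot Y)) := fun Y =>
    finite_submodule _
  have h2 : ∀ Y : Submodule A Z, Finite (Submodule A (FDMod.ofSub Y)) := fun Y =>
    finite_submodule _
  rw [← Nat.cast_sum, ← Nat.cast_sum, ← Nat.card_sigma, ← Nat.card_sigma]
  refine congrArg Nat.cast (Nat.card_congr ?_)
  exact (Submodule.nonempty_flag_equiv Z M N L).some

theorem hall_mul_assoc (x y z : HallAlgebra k A) : x * y * z = x * (y * z) := by
  have smul_l : ∀ (c : ℚ) (x y : HallAlgebra k A), (c • x) * y = c • (x * y) := by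
    simp [mul_def]
  have smul_r : ∀ (c : ℚ) (x y : HallAlgebra k A), x * (c • y) = c • (x * y) := by
    simp [mul_def]
  induction x using induction_cls with
  | zero => simp [mul_def]
  | add f g hf hg => simp only [mul_def, map_add, LinearMap.add_apply] at hf hg ⊢; rw [hf, hg]
  | smul a M =>
    induction y using induction_cls with
    | zero => simp [mul_def]
    | add f g hf hg => simp only [mul_def, map_add, LinearMap.add_apply] at hf hg ⊢; rw [hf, hg]
    | smul b N =>
      induction z using induction_cls with
      | zero => simp [mul_def]
      | add f g hf hg => simp only [mul_def, map_add] at hf hg ⊢; rw [hf, hg]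
      | smul c L => simp only [smul_l, smul_r, cls_mul_assoc]

theorem hall_one_mul (x : HallAlgebra k A) : 1 * x = x := by
  classical
  refine ext_coeff fun Z => ?_
  have hs : ∀ Y : Submodule A Z,
      Nonempty ((Z ⧸ Y) ≃ₗ[A] (FDMod.zero k A)) ↔ Y = ⊤ := fun Y => by
    rw [← Submodule.Quotient.subsingleton_iff]
    refine ⟨fun ⟨e⟩ => ?_, fun h => ⟨?_⟩⟩
    · exact e.toEquiv.subsingleton_congr.mpr (inferInstanceAs (Subsingleton PUnit))
    · have : Subsingleton (FDMod.zero k A) := inferInstanceAs (Subsingleton PUnit)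
      exact 0
  let t : {Y : Submodule A Z // Nonempty ((Z ⧸ Y) ≃ₗ[A] (FDMod.zero k A))} := ⟨⊤, (hs ⊤).mpr rfl⟩
  change coeff Z (cls (FDMod.zero k A) * x) = _
  rw [coeff_cls_mul, finsum_eq_single _ t fun Y hY =>
    absurd (Subtype.ext ((hs Y.1).mp Y.2)) hY]
  have h : IsoClass.mk (FDMod.ofSub t.1) = IsoClass.mk Z :=
    IsoClass.mk_eq_mk.mpr ⟨Submodule.topEquiv⟩
  simp only [coeff, h]

theorem hall_mul_one (x : HallAlgebra k A) : x * 1 = x := by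
  classical
  refine ext_coeff fun Z => ?_
  have hs : ∀ Y : Submodule A Z, Nonempty (Y ≃ₗ[A] (FDMod.zero k A)) ↔ Y = ⊥ := fun Y => by
    rw [← Submodule.subsingleton_iff_eq_bot]
    refine ⟨fun ⟨e⟩ => ?_, fun h => ⟨?_⟩⟩
    · exact e.toEquiv.subsingleton_congr.mpr (inferInstanceAs (Subsingleton PUnit))
    · have : Subsingleton (FDMod.zero k A) := inferInstanceAs (Subsingleton PUnit)
      exact 0
  let t : {Y : Submodule A Z // Nonempty (Y ≃ₗ[A] (FDMod.zero k A))} := ⟨⊥, (hs ⊥).mpr rfl⟩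
  change coeff Z (x * cls (FDMod.zero k A)) = _
  rw [coeff_mul_cls, finsum_eq_single _ t fun Y hY =>
    absurd (Subtype.ext ((hs Y.1).mp Y.2)) hY]
  have h : IsoClass.mk (FDMod.quot t.1) = IsoClass.mk Z :=
    IsoClass.mk_eq_mk.mpr ⟨Submodule.quotEquivOfEqBot _ rfl⟩
  simp only [coeff, h]

noncomputable instance : Ring (HallAlgebra k A) :=
  { (inferInstance : AddCommGroup (HallAlgebra k A)) with
    mul := (· * ·)
    one := 1
    left_distrib := fun x y z => by simp [mul_def]
    right_distrib := fun x y z => by simp [mul_def]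
    zero_mul := fun x => by simp [mul_def]
    mul_zero := fun x => by simp [mul_def]
    mul_assoc := hall_mul_assoc
    one_mul := hall_one_mul
    mul_one := hall_mul_one }

noncomputable instance : Algebra ℚ (HallAlgebra k A) :=
  Algebra.ofModule (fun c x y => by simp [mul_def]) (fun c x y => by simp [mul_def])

end HallAlgebra

/-! ### The composition algebra and the subalgebras of preprojectives and preinjectives -/

section Subalgebras

variable (k : Type v) [Field k] [Finite k] (A : Type u) [Ring A] [Algebra k A] [Module.Finite k A]

/-- The composition algebra: the subalgebra of the Hall algebra generated by the classes of the
simple modules. -/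
noncomputable def compositionAlgebra : Subalgebra ℚ (HallAlgebra k A) :=
  Algebra.adjoin ℚ {x | ∃ S : FDMod k A, IsSimpleModule A S ∧ x = HallAlgebra.cls S}

/-- The subalgebra of the Hall algebra generated by the classes of all preprojective modules. -/
noncomputable def preprojectiveSubalgebra : Subalgebra ℚ (HallAlgebra k A) :=
  Algebra.adjoin ℚ {x | ∃ P : FDMod k A, P.IsPreprojective ∧ x = HallAlgebra.cls P}

/-- The subalgebra of the Hall algebra generated by the classes of all preinjective modules. -/
noncomputable def preinjectiveSubalgebra : Subalgebra ℚ (HallAlgebra k A) :=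
  Algebra.adjoin ℚ {x | ∃ I : FDMod k A, I.IsPreinjective ∧ x = HallAlgebra.cls I}

end Subalgebras

set_option linter.unusedSectionVars false

/-- A representation of `A` on a finite-dimensional space `W` comes from a module. -/
theorem FDMod.exists_of_algHom {k : Type v} [Field k] {A : Type u} [Ring A] [Algebra k A]
    {W : Type*} [AddCommGroup W] [Module k W] [Module.Finite k W] (F : A →ₐ[k] Module.End k W)
    {U : Type u} [AddCommGroup U] [Module k U] (c : U ≃ₗ[k] W) :
    ∃ (X : FDMod k A) (c : X ≃ₗ[k] W), ∀ a y, c (a • y) = F a (c y) := by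
  let FU : A →ₐ[k] Module.End k U := (c.symm.conjAlgEquiv k).toAlgHom.comp F
  let X : FDMod k A :=
    { carrier := U
      module := Module.compHom U FU.toRingHom
      isScalarTower := @IsScalarTower.mk _ _ _ _ (_) _ fun r a y => by
        change FU (r • a) y = r • FU a y
        rw [map_smul, LinearMap.smul_apply]
      finiteDimensional := Module.Finite.equiv c.symm }
  refine ⟨X, c, fun a y => ?_⟩
  change c (FU a y) = F a (c y)
  simp [FU]

/-! ### Algebras presented by a quiver -/

/-- Elements `e i`, `x a` of a ring satisfying the relations between the trivial paths and the
arrows in the path algebra of the quiver with vertices `V`, arrows `E`, sources `s` and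
targets `t`. -/
structure QuiverRelations {V E B : Type*} [Fintype V] [Ring B] (s t : E → V) (e : V → B)
    (x : E → B) : Prop where
  idem : ∀ i, e i * e i = e i
  orth : ∀ i j, i ≠ j → e i * e j = 0
  sum_eq_one : ∑ i, e i = 1
  tgt_mul : ∀ a, e (t a) * x a = x a
  mul_src : ∀ a, x a * e (s a) = x a

/-- A presentation of an algebra as the path algebra of a finite quiver without oriented cycles,
by its universal property. The notion is stable under passage to the opposite algebra. -/
structure QuiverPresentation (k : Type v) [Field k] (A : Type u) [Ring A] [Algebra k A]
    (V E : Type*) [Fintype V] where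
  s : E → V
  t : E → V
  e : V → A
  x : E → A
  rel : QuiverRelations s t e x
  adjoin_eq_top : Algebra.adjoin k (Set.range e ∪ Set.range x) = ⊤
  exists_lift : ∀ (B : Type u) [Ring B] [Algebra k B] (ε : V → B) (b : E → B),
    QuiverRelations s t ε b → ∃ F : A →ₐ[k] B, (∀ i, F (e i) = ε i) ∧ ∀ a, F (x a) = b a
  rank : V → ℕ
  rank_lt : ∀ a, rank (s a) < rank (t a)

namespace QuiverPresentation

variable {k : Type v} [Field k] {A : Type u} [Ring A] [Algebra k A] {V E : Type*} [Fintype V]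
  (q : QuiverPresentation k A V E)

section Modules

variable (M N : Type*) [AddCommGroup M] [Module A M] [Module k M] [IsScalarTower k A M]
  [AddCommGroup N] [Module A N] [Module k N] [IsScalarTower k A N]

/-- The dimension vector of a module. -/
noncomputable def dimVec (i : V) : ℕ :=
  Module.finrank k (LinearMap.range (Algebra.lsmul k k M (q.e i)))

/-- The `k`-linear maps `M → N` concentrated in the component from `e i • M` to `e j • N`. -/
def block (i j : V) : Submodule k (M →ₗ[k] N) where
  carrier := {h | ∀ m, q.e j • h (q.e i • m) = h m}
  add_mem' := fun {f g} hf hg m => by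
    rw [LinearMap.add_apply, LinearMap.add_apply, smul_add, hf m, hg m]
  zero_mem' := fun m => by simp
  smul_mem' := fun c f hf m => by
    rw [LinearMap.smul_apply, LinearMap.smul_apply, smul_comm, hf m]

variable {M N}

theorem e_smul_self (i : V) (m : M) : q.e i • q.e i • m = q.e i • m := by
  rw [smul_smul, q.rel.idem]

theorem e_smul_of_ne {i j : V} (h : i ≠ j) (m : M) : q.e i • q.e j • m = 0 := by
  rw [smul_smul, q.rel.orth i j h, zero_smul]

theorem e_tgt_smul (a : E) (m : M) : q.e (q.t a) • q.x a • m = q.x a • m := by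
  rw [smul_smul, q.rel.tgt_mul]

theorem x_smul_src (a : E) (m : M) : q.x a • q.e (q.s a) • m = q.x a • m := by
  rw [smul_smul, q.rel.mul_src]

theorem sum_e_smul (m : M) : ∑ i, q.e i • m = m := by
  rw [← Finset.sum_smul, q.rel.sum_eq_one, one_smul]

theorem map_smul_of_generators (f : M →ₗ[k] N) (he : ∀ i m, f (q.e i • m) = q.e i • f m)
    (hx : ∀ a m, f (q.x a • m) = q.x a • f m) (a : A) (m : M) : f (a • m) = a • f m := by
  have ha : a ∈ Algebra.adjoin k (Set.range q.e ∪ Set.range q.x) := by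
    rw [q.adjoin_eq_top]; trivial
  induction ha using Algebra.adjoin_induction generalizing m with
  | mem y hy =>
    rcases hy with ⟨i, rfl⟩ | ⟨a, rfl⟩
    · exact he i m
    · exact hx a m
  | algebraMap r => simp only [algebraMap_smul, map_smul]
  | add y z _ _ hy hz => simp only [add_smul, map_add, hy, hz]
  | mul y z _ _ hy hz => simp only [mul_smul, hy, hz]

/-- A `k`-linear map that commutes with the generators, as an `A`-linear map. -/
def toLinearMap (f : M →ₗ[k] N) (he : ∀ i m, f (q.e i • m) = q.e i • f m)
    (hx : ∀ a m, f (q.x a • m) = q.x a • f m) : M →ₗ[A] N where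
  toFun := f
  map_add' := f.map_add
  map_smul' := q.map_smul_of_generators f he hx

theorem block_src {i j : V} (h : q.block M N i j) (m : M) : h.1 (q.e i • m) = h.1 m := by
  rw [← h.2 (q.e i • m), q.e_smul_self, h.2 m]

theorem block_tgt {i j : V} (h : q.block M N i j) (m : M) : q.e j • h.1 m = h.1 m := by
  conv_lhs => rw [← h.2 m, q.e_smul_self, h.2 m]

theorem block_src_of_ne {i j l : V} (h : q.block M N i j) (hl : l ≠ i) (m : M) :
    h.1 (q.e l • m) = 0 := by
  rw [← q.block_src, q.e_smul_of_ne hl.symm, map_zero]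

theorem block_tgt_of_ne {i j l : V} (h : q.block M N i j) (hl : l ≠ j) (m : M) :
    q.e l • h.1 m = 0 := by
  rw [← q.block_tgt, q.e_smul_of_ne hl]

/-- The component of a `k`-linear map in `block M N i j`. -/
def toBlock (i j : V) (f : M →ₗ[k] N) : q.block M N i j :=
  ⟨Algebra.lsmul k k N (q.e j) ∘ₗ f ∘ₗ Algebra.lsmul k k M (q.e i), fun m => by
    simp [q.e_smul_self]⟩

@[simp] theorem toBlock_apply (i j : V) (f : M →ₗ[k] N) (m : M) :
    (q.toBlock i j f).1 m = q.e j • f (q.e i • m) := rfl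

/-- The `k`-linear map with given diagonal components. -/
def glue (h : ∀ i, q.block M N i i) : M →ₗ[k] N := ∑ i, (h i).1

theorem glue_e_smul (h : ∀ i, q.block M N i i) (i : V) (m : M) :
    q.glue h (q.e i • m) = (h i).1 m := by
  rw [glue, LinearMap.sum_apply, Finset.sum_eq_single i, q.block_src]
  · exact fun j _ hj => q.block_src_of_ne (h j) hj.symm m
  · simp

theorem e_smul_glue (h : ∀ i, q.block M N i i) (i : V) (m : M) :
    q.e i • q.glue h m = (h i).1 m := by
  rw [glue, LinearMap.sum_apply, Finset.smul_sum, Finset.sum_eq_single i, q.block_tgt]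
  · exact fun j _ hj => q.block_tgt_of_ne (h j) hj.symm m
  · simp

theorem x_smul_glue (h : ∀ i, q.block M N i i) (a : E) (m : M) :
    q.x a • q.glue h m = q.x a • (h (q.s a)).1 m := by
  rw [← q.x_smul_src, q.e_smul_glue]

theorem glue_x_smul (h : ∀ i, q.block M N i i) (a : E) (m : M) :
    q.glue h (q.x a • m) = (h (q.t a)).1 (q.x a • m) := by
  rw [← q.e_tgt_smul, q.glue_e_smul, q.e_tgt_smul]

variable (M N) in
/-- The differential whose kernel is `Hom_A(M, N)` and whose cokernel is `Ext¹_A(M, N)`. -/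
def differential :
    (∀ i, q.block M N i i) →ₗ[k] ∀ a, q.block M N (q.s a) (q.t a) where
  toFun h a := ⟨Algebra.lsmul k k N (q.x a) ∘ₗ (h (q.s a)).1 -
      (h (q.t a)).1 ∘ₗ Algebra.lsmul k k M (q.x a), fun m => by
    simp [smul_sub, q.block_src, q.e_tgt_smul, q.x_smul_src, q.block_tgt]⟩
  map_add' h h' := by
    ext a m
    simp only [Pi.add_apply, Submodule.coe_add, LinearMap.add_apply, LinearMap.sub_apply,
      LinearMap.comp_apply, Algebra.lsmul_coe, smul_add]
    abel
  map_smul' c h := by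
    ext a m
    simp only [Pi.smul_apply, Submodule.coe_smul, LinearMap.smul_apply, LinearMap.sub_apply,
      LinearMap.comp_apply, Algebra.lsmul_coe, smul_sub, RingHom.id_apply]
    rw [smul_comm]

theorem differential_apply (h : ∀ i, q.block M N i i) (a : E) (m : M) :
    (q.differential M N h a).1 m =
      q.x a • (h (q.s a)).1 m - (h (q.t a)).1 (q.x a • m) := rfl

theorem x_smul_glue_sub (h : ∀ i, q.block M N i i) (a : E) (m : M) :
    q.x a • q.glue h m - q.glue h (q.x a • m) = (q.differential M N h a).1 m := by
  rw [differential_apply, x_smul_glue, glue_x_smul]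

variable (M N) in
/-- The vanishing of `Ext¹_A(M, N)`. -/
def ExtVanish : Prop := Function.Surjective (q.differential M N)

theorem block_eq_zero_of_glue_eq_zero {h : ∀ i, q.block M N i i} (hg : q.glue h = 0) : h = 0 := by
  funext i
  refine Subtype.ext (LinearMap.ext fun m => ?_)
  rw [← q.e_smul_glue, hg]
  simp

theorem differential_injective (h0 : ∀ f : M →ₗ[A] N, f = 0) :
    Function.Injective (q.differential M N) := by
  rw [injective_iff_map_eq_zero]
  intro h hh
  refine q.block_eq_zero_of_glue_eq_zero (LinearMap.ext fun m => ?_)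
  have := h0 (q.toLinearMap (q.glue h) (fun i m => by rw [q.glue_e_smul, q.e_smul_glue])
    fun a m => by
      have := q.x_smul_glue_sub h a m
      rw [hh] at this
      exact (sub_eq_zero.mp this).symm)
  exact LinearMap.congr_fun this m

/-- A `k`-linear map that vanishes under `π` factors through the kernel `ι` of `π`. -/
theorem exists_factor {X : Type*} [AddCommGroup X] [Module k X] {M N Z : Type*} [AddCommGroup M]
    [Module k M] [AddCommGroup N] [Module k N] [AddCommGroup Z] [Module k Z]
    {ι : N →ₗ[k] X} {π : X →ₗ[k] M} (hι : Function.Injective ι)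
    (hex : Function.Exact ι π) (g : Z →ₗ[k] X) (hg : ∀ z, π (g z) = 0) :
    ∃ g' : Z →ₗ[k] N, ∀ z, ι (g' z) = g z := by
  refine ⟨(LinearEquiv.ofInjective ι hι).symm.toLinearMap ∘ₗ
    g.codRestrict (LinearMap.range ι) fun z => (hex (g z)).mp (hg z), fun z => ?_⟩
  have := (LinearEquiv.ofInjective ι hι).apply_symm_apply
    (g.codRestrict (LinearMap.range ι) (fun z => (hex (g z)).mp (hg z)) z)
  exact congrArg Subtype.val this

theorem ExtVanish.exists_section {q : QuiverPresentation k A V E} (hq : q.ExtVanish M N)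
    {X : Type*} [AddCommGroup X] [Module A X] [Module k X]
    [IsScalarTower k A X] {ι : N →ₗ[A] X} {π : X →ₗ[A] M} (hι : Function.Injective ι)
    (hex : Function.Exact ι π) (hπ : Function.Surjective π) :
    ∃ σ : M →ₗ[A] X, π ∘ₗ σ = LinearMap.id := by
  obtain ⟨σ₀, hσ₀⟩ := (π.restrictScalars k).exists_rightInverse_of_surjective
    (LinearMap.range_eq_top.mpr hπ)
  have hσ₀' : ∀ m, π (σ₀ m) = m := fun m => LinearMap.congr_fun hσ₀ m
  let σ₁ := q.glue fun i => q.toBlock i i σ₀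
  have hσ₁ : ∀ m, π (σ₁ m) = m := fun m => by
    simp only [σ₁, glue, LinearMap.sum_apply, toBlock_apply, map_sum, map_smul, hσ₀',
      q.e_smul_self, q.sum_e_smul]
  have he : ∀ i m, σ₁ (q.e i • m) = q.e i • σ₁ m := fun i m => by
    simp only [σ₁]
    rw [q.glue_e_smul, q.e_smul_glue]
  have hfac : ∀ a, ∃ φ : M →ₗ[k] N, ∀ m, ι (φ m) = q.x a • σ₁ m - σ₁ (q.x a • m) := fun a =>
    exists_factor (ι := ι.restrictScalars k) (π := π.restrictScalars k) hι hex
      (Algebra.lsmul k k X (q.x a) ∘ₗ σ₁ - σ₁ ∘ₗ Algebra.lsmul k k M (q.x a))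
      fun m => by simp [hσ₁]
  choose φ hφ using hfac
  have hmem : ∀ a, φ a ∈ q.block M N (q.s a) (q.t a) := fun a m => hι (by
    rw [map_smul, hφ, hφ, he, q.x_smul_src, smul_sub, q.e_tgt_smul, q.x_smul_src, ← he,
      q.e_tgt_smul])
  obtain ⟨h, hh⟩ := hq fun a => ⟨φ a, hmem a⟩
  have hh' : ∀ a m, q.x a • q.glue h m - q.glue h (q.x a • m) = φ a m := fun a m => by
    rw [q.x_smul_glue_sub, hh]
  refine ⟨q.toLinearMap (σ₁ - ι.restrictScalars k ∘ₗ q.glue h) (fun i m => ?_) fun a m => ?_, ?_⟩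
  · simp only [LinearMap.sub_apply, LinearMap.comp_apply, LinearMap.restrictScalars_apply,
      smul_sub, he, ← map_smul, q.glue_e_smul, q.e_smul_glue]
  · have h1 := hφ a m
    rw [← hh', map_sub, map_smul] at h1
    simp only [LinearMap.sub_apply, LinearMap.comp_apply, LinearMap.restrictScalars_apply,
      smul_sub]
    rw [sub_eq_sub_iff_add_eq_add] at h1 ⊢
    rw [add_comm, h1, add_comm]
  · refine LinearMap.ext fun m => ?_
    change π (σ₁ m - ι (q.glue h m)) = m
    rw [map_sub, hσ₁, (hex _).mpr ⟨_, rfl⟩, sub_zero]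

theorem ExtVanish.of_injective {q : QuiverPresentation k A V E} (hq : q.ExtVanish M N)
    {X : Type*} [AddCommGroup X] [Module A X] [Module k X] [IsScalarTower k A X]
    (f : X →ₗ[A] M) (hf : Function.Injective f) : q.ExtVanish X N := by
  intro φ
  obtain ⟨r, hr⟩ := (f.restrictScalars k).exists_leftInverse_of_injective
    (LinearMap.ker_eq_bot.mpr hf)
  have hr' : ∀ y, r (f y) = y := fun y => LinearMap.congr_fun hr y
  obtain ⟨h, hh⟩ := hq fun a => q.toBlock _ _ ((φ a).1 ∘ₗ r)
  refine ⟨fun i => ⟨(h i).1 ∘ₗ f.restrictScalars k, fun m => ?_⟩, ?_⟩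
  · simp [q.block_src, q.block_tgt]
  · funext a
    refine Subtype.ext (LinearMap.ext fun m => ?_)
    have := LinearMap.congr_fun (congrArg Subtype.val (congrFun hh a)) (f m)
    rw [differential_apply] at this ⊢
    simp only [LinearMap.comp_apply, LinearMap.restrictScalars_apply, map_smul] at this ⊢
    rw [this, toBlock_apply, LinearMap.comp_apply, ← map_smul f, hr', q.block_src, q.block_tgt]

theorem dimVec_congr (f : M ≃ₗ[A] N) : q.dimVec M = q.dimVec N := by
  funext i
  let f' : M ≃ₗ[k] N := f.restrictScalars k
  have : (LinearMap.range (Algebra.lsmul k k M (q.e i))).map f'.toLinearMap =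
      LinearMap.range (Algebra.lsmul k k N (q.e i)) := by
    ext n
    simp only [Submodule.mem_map, LinearMap.mem_range, Algebra.lsmul_coe]
    constructor
    · rintro ⟨_, ⟨m, rfl⟩, rfl⟩
      exact ⟨f m, (f.map_smul _ _).symm⟩
    · rintro ⟨n, rfl⟩
      exact ⟨_, ⟨f.symm n, rfl⟩, by simp [f']⟩
  rw [dimVec, dimVec, ← this]
  exact (f'.finrank_map_eq _).symm

theorem dimVec_eq_add {X : Type*} [AddCommGroup X] [Module A X] [Module k X]
    [IsScalarTower k A X] [Module.Finite k X] {ι : N →ₗ[A] X} {π : X →ₗ[A] M}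
    (hι : Function.Injective ι) (hex : Function.Exact ι π) (hπ : Function.Surjective π) :
    q.dimVec X = q.dimVec M + q.dimVec N := by
  funext i
  let R := LinearMap.range (Algebra.lsmul k k X (q.e i))
  let g : R →ₗ[k] M := π.restrictScalars k ∘ₗ R.subtype
  have hR : ∀ y : R, q.e i • (y : X) = y := by
    rintro ⟨_, y, rfl⟩
    simp [q.e_smul_self]
  have h1 : LinearMap.range g = LinearMap.range (Algebra.lsmul k k M (q.e i)) := by
    ext m
    constructor
    · rintro ⟨y, rfl⟩
      refine ⟨π y, ?_⟩
      change q.e i • π y = π y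
      rw [← map_smul, hR]
    · rintro ⟨m, rfl⟩
      obtain ⟨y, rfl⟩ := hπ m
      exact ⟨⟨_, y, rfl⟩, π.map_smul _ _⟩
  have h2 : (LinearMap.ker g).map R.subtype =
      (LinearMap.range (Algebra.lsmul k k N (q.e i))).map (ι.restrictScalars k) := by
    ext y
    constructor
    · rintro ⟨y, hy, rfl⟩
      obtain ⟨n, hn⟩ := (hex y).mp hy
      refine ⟨_, ⟨n, rfl⟩, ?_⟩
      change ι (q.e i • n) = y
      rw [map_smul, hn, hR]
    · rintro ⟨_, ⟨n, rfl⟩, rfl⟩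
      refine ⟨⟨q.e i • ι n, ι n, rfl⟩, ?_, by simp⟩
      change π (q.e i • ι n) = 0
      rw [map_smul, (hex _).mpr ⟨n, rfl⟩, smul_zero]
  have h3 := LinearMap.finrank_range_add_finrank_ker g
  rw [h1, ← Submodule.finrank_map_subtype_eq R (LinearMap.ker g), h2,
    ← LinearEquiv.finrank_eq
      (Submodule.equivMapOfInjective (ι.restrictScalars k) hι _)] at h3
  exact h3.symm

theorem iSupIndep_range_e : iSupIndep fun i => LinearMap.range (Algebra.lsmul k k M (q.e i)) := by
  classical
  refine iSupIndep_of_dfinsupp_lsum_injective _ ?_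
  rw [← LinearMap.ker_eq_bot, LinearMap.ker_eq_bot']
  intro f hf
  ext i
  have h : q.e i • (DFinsupp.lsum ℕ fun i =>
      (LinearMap.range (Algebra.lsmul k k M (q.e i))).subtype) f = (f i : M) := by
    rw [DFinsupp.lsum_apply_apply, DFinsupp.sumAddHom_apply, DFinsupp.sum_eq_sum_fintype _ (by simp),
      Finset.smul_sum, Finset.sum_eq_single i]
    · obtain ⟨m, hm⟩ := (f i).2
      rw [Algebra.lsmul_coe] at hm
      simp [← hm, q.e_smul_self]
    · intro j _ hj
      obtain ⟨m, hm⟩ := (f j).2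
      rw [Algebra.lsmul_coe] at hm
      simp [← hm, q.e_smul_of_ne hj.symm]
    · simp
  rw [← h]
  simpa using congrArg (q.e i • ·) hf

theorem sum_dimVec [Module.Finite k M] : ∑ i, q.dimVec M i = Module.finrank k M := by
  classical
  have hint : DirectSum.IsInternal fun i => LinearMap.range (Algebra.lsmul k k M (q.e i)) := by
    rw [DirectSum.isInternal_submodule_iff_iSupIndep_and_iSup_eq_top]
    refine ⟨q.iSupIndep_range_e, eq_top_iff.mpr fun m _ => ?_⟩
    rw [← q.sum_e_smul m]
    exact Submodule.sum_mem _ fun i _ => Submodule.mem_iSup_of_mem i ⟨m, rfl⟩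
  have := hint.collectedBasis fun i => Module.finBasis k _
  rw [Module.finrank_eq_card_basis this, Fintype.card_sigma]
  simp [dimVec]

theorem finrank_block [Module.Finite k M] [Module.Finite k N] (i j : V) :
    Module.finrank k (q.block M N i j) = q.dimVec M i * q.dimVec N j := by
  let R := LinearMap.range (Algebra.lsmul k k M (q.e i))
  let R' := LinearMap.range (Algebra.lsmul k k N (q.e j))
  have hR : ∀ y : R, q.e i • (y : M) = y := by
    rintro ⟨_, y, rfl⟩
    simp [q.e_smul_self]
  have hR' : ∀ y : R', q.e j • (y : N) = y := by
    rintro ⟨_, y, rfl⟩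
    simp [q.e_smul_self]
  let F : q.block M N i j ≃ₗ[k] (R →ₗ[k] R') :=
    { toFun := fun h => (h.1 ∘ₗ R.subtype).codRestrict R' fun m =>
        ⟨h.1 m, q.block_tgt h m⟩
      map_add' := fun _ _ => rfl
      map_smul' := fun _ _ => rfl
      invFun := fun g => ⟨R'.subtype ∘ₗ g ∘ₗ (Algebra.lsmul k k M (q.e i)).rangeRestrict,
        fun m => by
          simp only [LinearMap.comp_apply, Submodule.subtype_apply, hR']
          congr 2
          exact Subtype.ext (q.e_smul_self i m)⟩
      left_inv := fun h => Subtype.ext (LinearMap.ext fun m => q.block_src h m)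
      right_inv := fun g => LinearMap.ext fun m => Subtype.ext (by
        change ((g ⟨q.e i • (m : M), _⟩ : R') : N) = g m
        congr 2
        exact Subtype.ext (hR m)) }
  rw [F.finrank_eq, Module.finrank_linearMap]
  rfl

/-- The Euler form of two modules, in terms of their dimension vectors. -/
def euler [Fintype E] (d d' : V → ℕ) : ℤ :=
  ∑ i, (d i * d' i : ℤ) - ∑ a, (d (q.s a) * d' (q.t a) : ℤ)

theorem euler_eq_finrank_sub [Fintype E] [Module.Finite k M] [Module.Finite k N] :
    q.euler (q.dimVec M) (q.dimVec N) = (Module.finrank k (∀ i, q.block M N i i) : ℤ) -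
      Module.finrank k (∀ a, q.block M N (q.s a) (q.t a)) := by
  simp only [euler, Module.finrank_pi_fintype, finrank_block, Nat.cast_sum, Nat.cast_mul]

theorem euler_nonpos [Fintype E] [Module.Finite k M] [Module.Finite k N]
    (h0 : ∀ f : M →ₗ[A] N, f = 0) : q.euler (q.dimVec M) (q.dimVec N) ≤ 0 := by
  have := LinearMap.finrank_le_finrank_of_injective (q.differential_injective h0)
  rw [euler_eq_finrank_sub]
  omega

theorem euler_pos [Fintype E] [Module.Finite k M] [Nontrivial M] (hq : q.ExtVanish M M) :
    0 < q.euler (q.dimVec M) (q.dimVec M) := by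
  have h1 := LinearMap.finrank_range_add_finrank_ker (q.differential M M)
  rw [LinearMap.range_eq_top.mpr hq, finrank_top] at h1
  have h2 : 0 < Module.finrank k (LinearMap.ker (q.differential M M)) := by
    refine (Module.finrank_pos_iff (R := k) (M := LinearMap.ker (q.differential M M))).mpr ?_
    rw [Submodule.nontrivial_iff_ne_bot, Submodule.ne_bot_iff]
    refine ⟨fun i => q.toBlock i i LinearMap.id, ?_, fun h => ?_⟩
    · rw [LinearMap.mem_ker]
      funext a
      refine Subtype.ext (LinearMap.ext fun m => ?_)
      simp [differential_apply, q.e_smul_self, q.e_tgt_smul, q.x_smul_src]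
    · obtain ⟨m, hm⟩ := exists_ne (0 : M)
      refine hm ?_
      rw [← q.sum_e_smul m]
      refine Finset.sum_eq_zero fun i _ => ?_
      have := LinearMap.congr_fun (congrArg Subtype.val (congrFun h i)) m
      simpa [q.e_smul_self] using this
  rw [euler_eq_finrank_sub]
  omega

end Modules

/-- If all extensions of `M` by `N` split, then `Ext¹(M, N)` vanishes. -/
theorem extVanish_of_split {M N : FDMod k A}
    (hs : ∀ (X : FDMod k A) (ι : N →ₗ[A] X) (π : X →ₗ[A] M), Function.Injective ι →
      Function.Exact ι π → Function.Surjective π → ∃ σ : M →ₗ[A] X, π ∘ₗ σ = LinearMap.id) :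
    q.ExtVanish M N := by
  intro φ
  let ε : V → Module.End k (N × M) := fun i => Algebra.lsmul k k (N × M) (q.e i)
  let b : E → Module.End k (N × M) := fun a => Algebra.lsmul k k (N × M) (q.x a) +
    LinearMap.inl k N M ∘ₗ (φ a).1 ∘ₗ LinearMap.snd k N M
  have hrel : QuiverRelations q.s q.t ε b :=
    { idem := fun i => by rw [← map_mul, q.rel.idem]
      orth := fun i j h => by rw [← map_mul, q.rel.orth i j h, map_zero]
      sum_eq_one := by rw [← map_sum, q.rel.sum_eq_one, map_one]
      tgt_mul := fun a => by
        refine LinearMap.ext fun y => ?_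
        refine Prod.ext ?_ ?_ <;>
          simp [ε, b, smul_add, q.e_tgt_smul, q.block_tgt]
      mul_src := fun a => by
        refine LinearMap.ext fun y => ?_
        refine Prod.ext ?_ ?_ <;>
          simp [ε, b, q.x_smul_src, q.block_src] }
  obtain ⟨F, hFe, hFx⟩ := q.exists_lift (Module.End k (N × M)) ε b hrel
  obtain ⟨X, c, hc⟩ := FDMod.exists_of_algHom F (LinearEquiv.refl k (N × M))
  have hXe : ∀ i (y : X), c (q.e i • y) = (q.e i • (c y).1, q.e i • (c y).2) := fun i y => by
    rw [hc, hFe]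
    rfl
  have hXx : ∀ a (y : X), c (q.x a • y) =
      (q.x a • (c y).1 + (φ a).1 (c y).2, q.x a • (c y).2) := fun a y => by
    rw [hc, hFx]
    refine Prod.ext ?_ ?_ <;> simp [b]
  let ι : N →ₗ[A] X := q.toLinearMap (c.symm.toLinearMap ∘ₗ LinearMap.inl k N M)
    (fun i m => c.injective (by rw [hXe]; simp))
    (fun a m => c.injective (by rw [hXx]; simp))
  let π : X →ₗ[A] M := q.toLinearMap (LinearMap.snd k N M ∘ₗ c.toLinearMap)
    (fun i m => by simp [hXe])
    (fun a m => by simp [hXx])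
  obtain ⟨σ, hσ⟩ := hs X ι π (c.symm.injective.comp (LinearMap.inl_injective (R := k)))
    (fun y => ⟨fun h => ⟨(c y).1, c.symm_apply_eq.mpr (Prod.ext rfl (Eq.symm h))⟩, by
      rintro ⟨n, rfl⟩
      change (c (c.symm (n, 0))).2 = 0
      simp⟩)
    (fun m => ⟨c.symm (0, m), by
      change (c (c.symm (0, m))).2 = m
      simp⟩)
  have hσ2 : ∀ m, (c (σ m)).2 = m := fun m => LinearMap.congr_fun hσ m
  let g : M →ₗ[k] N := LinearMap.fst k N M ∘ₗ c.toLinearMap ∘ₗ σ.restrictScalars k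
  have hge : ∀ i m, g (q.e i • m) = q.e i • g m := fun i m => by
    simp [g, hXe]
  have hgx : ∀ a m, g (q.x a • m) = q.x a • g m + (φ a).1 m := fun a m => by
    simp [g, hXx, hσ2]
  refine ⟨fun i => q.toBlock i i (-g), ?_⟩
  funext a
  refine Subtype.ext (LinearMap.ext fun m => ?_)
  simp only [differential_apply, toBlock_apply, LinearMap.neg_apply, hge, hgx, smul_neg,
    q.e_smul_self, q.e_tgt_smul, q.x_smul_src, smul_add, q.block_tgt]
  abel

theorem extVanish_of_projective (M N : FDMod k A) [Module.Projective A M] : q.ExtVanish M N :=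
  q.extVanish_of_split fun _ _ π _ _ hπ =>
    Module.projective_lifting_property π LinearMap.id hπ

theorem projective_of_extVanish [Module.Finite k A] (M : FDMod k A)
    (h : ∀ N : FDMod k A, q.ExtVanish M N) : Module.Projective A M := by
  have := Module.Finite.of_restrictScalars_finite k A M
  obtain ⟨n, f, hf⟩ := Module.Finite.exists_fin' A M
  let X : FDMod k A := { carrier := Fin n → A }
  obtain ⟨σ, hσ⟩ := (h (FDMod.ofSub (X := X) (LinearMap.ker f))).exists_section (X := X)
    (ι := (LinearMap.ker f).subtype) (π := f) Subtype.val_injective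
    (LinearMap.exact_subtype_ker_map f) hf
  exact Module.Projective.of_split σ f hσ

/-- Submodules of finite-dimensional projective modules are projective. -/
theorem projective_of_injective (q : QuiverPresentation k A V E) [Module.Finite k A] {M P : FDMod k A} [Module.Projective A P]
    (f : M →ₗ[A] P) (hf : Function.Injective f) : Module.Projective A M :=
  q.projective_of_extVanish M fun N => (q.extVanish_of_projective P N).of_injective f hf

end QuiverPresentation

/-! ### Duality between left and right modules -/

/-- A perfect pairing between a module over `A` and a module over `B` for which the action of `a`
is adjoint to that of `σ a`. For `B = Aᵐᵒᵖ` this identifies each of the two modules with the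
`k`-dual of the other one. -/
structure DualPair (k : Type*) [Field k] {A B : Type*} [Ring A] [Ring B] (σ : A ≃ B)
    (M N : Type*) [AddCommGroup M] [Module A M] [Module k M] [AddCommGroup N] [Module B N]
    [Module k N] where
  pair : M →ₗ[k] N →ₗ[k] k
  perf : pair.IsPerfPair
  smul : ∀ a m n, pair (a • m) n = pair m (σ a • n)

namespace DualPair

variable {k : Type*} [Field k] {A B : Type*} [Ring A] [Ring B] {σ : A ≃ B}
  {M' N' : Type*} [AddCommGroup M'] [Module A M'] [Module k M'] [AddCommGroup N'] [Module B N']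
  [Module k N']
  {M N : Type*} [AddCommGroup M] [Module A M] [Module k M] [AddCommGroup N] [Module B N]
  [Module k N]

/-- The pairing with the two sides interchanged. -/
def symm (D : DualPair k σ M N) : DualPair k σ.symm N M where
  pair := D.pair.flip
  perf := D.perf.flip
  smul b n m := by
    rw [LinearMap.flip_apply, LinearMap.flip_apply, D.smul, Equiv.apply_symm_apply]

theorem ext_left (D : DualPair k σ M N) {m m' : M} (h : ∀ n, D.pair m n = D.pair m' n) :
    m = m' :=
  D.perf.bijective_left.1 (LinearMap.ext h)

theorem ext_right (D : DualPair k σ M N) {n n' : N} (h : ∀ m, D.pair m n = D.pair m n') :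
    n = n' :=
  D.perf.bijective_right.1 (LinearMap.ext h)

theorem exists_right (D : DualPair k σ M N) (g : M →ₗ[k] k) : ∃ n, ∀ m, D.pair m n = g m := by
  obtain ⟨n, hn⟩ := D.perf.bijective_right.2 g
  exact ⟨n, fun m => LinearMap.congr_fun hn m⟩

theorem exists_left (D : DualPair k σ M N) (g : N →ₗ[k] k) : ∃ m, ∀ n, D.pair m n = g n :=
  D.symm.exists_right g

theorem exists_transpose (D : DualPair k σ M N) (D' : DualPair k σ M' N')
    (f : M →ₗ[A] M') (hf : ∀ (c : k) m, f (c • m) = c • f m) :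
    ∃ g : N' →ₗ[B] N, ∀ m n, D.pair m (g n) = D'.pair (f m) n := by
  have h : ∀ n, ∃ n₀, ∀ m, D.pair m n₀ = D'.pair (f m) n := fun n =>
    D.exists_right
      { toFun := fun m => D'.pair (f m) n
        map_add' := fun x y => by simp
        map_smul' := fun c x => by simp [hf] }
  choose g hg using h
  refine ⟨{ toFun := g, map_add' := fun x y => ?_, map_smul' := fun b x => ?_ }, fun m n => hg n m⟩
  · exact D.ext_right fun m => by simp [hg]
  · refine D.ext_right fun m => ?_
    obtain ⟨a, rfl⟩ := σ.surjective b
    rw [hg, RingHom.id_apply, ← D'.smul, ← D.smul, hg, map_smul f]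

end DualPair

theorem LinearMap.map_algebra_smul {k A M N : Type*} [Field k] [Ring A] [Algebra k A]
    [AddCommGroup M] [Module A M] [Module k M] [IsScalarTower k A M]
    [AddCommGroup N] [Module A N] [Module k N] [IsScalarTower k A N] (f : M →ₗ[A] N) (c : k)
    (m : M) : f (c • m) = c • f m := by
  rw [← algebraMap_smul A c m, map_smul, algebraMap_smul]

namespace DualPair

variable {k : Type*} [Field k] {A B : Type*} [Ring A] [Algebra k A] [Ring B] [Algebra k B]
  {σ : A ≃ B}
  {M' N' : Type*} [AddCommGroup M'] [Module A M'] [Module k M'] [IsScalarTower k A M']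
  [AddCommGroup N'] [Module B N'] [Module k N'] [IsScalarTower k B N']
  {M N : Type*} [AddCommGroup M] [Module A M] [Module k M] [IsScalarTower k A M]
  [AddCommGroup N] [Module B N] [Module k N] [IsScalarTower k B N]

/-- The transpose of a linear map. -/
noncomputable def transpose (D : DualPair k σ M N) (D' : DualPair k σ M' N') (f : M →ₗ[A] M') :
    N' →ₗ[B] N :=
  (D.exists_transpose D' f f.map_algebra_smul).choose

theorem pair_transpose (D : DualPair k σ M N) (D' : DualPair k σ M' N') (f : M →ₗ[A] M')
    (m : M) (n : N') : D.pair m (D.transpose D' f n) = D'.pair (f m) n :=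
  (D.exists_transpose D' f f.map_algebra_smul).choose_spec m n

theorem transpose_symm_transpose (D : DualPair k σ M N) (D' : DualPair k σ M' N')
    (f : M →ₗ[A] M') : D'.symm.transpose D.symm (D.transpose D' f) = f :=
  LinearMap.ext fun m => D'.ext_left fun n =>
    (D'.symm.pair_transpose D.symm (D.transpose D' f) n m).trans (D.pair_transpose D' f m n)

theorem transpose_id (D : DualPair k σ M N) : D.transpose D LinearMap.id = LinearMap.id :=
  LinearMap.ext fun n => D.ext_right fun m => by simp [pair_transpose]

theorem transpose_zero (D : DualPair k σ M N) (D' : DualPair k σ M' N') :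
    D.transpose D' 0 = 0 :=
  LinearMap.ext fun n => D.ext_right fun m => by simp [pair_transpose]

theorem transpose_comp {M'' N'' : Type*} [AddCommGroup M''] [Module A M''] [Module k M'']
    [IsScalarTower k A M''] [AddCommGroup N''] [Module B N''] [Module k N'']
    [IsScalarTower k B N''] (D : DualPair k σ M N) (D' : DualPair k σ M' N')
    (D'' : DualPair k σ M'' N'') (g : M' →ₗ[A] M'') (f : M →ₗ[A] M') :
    D.transpose D'' (g ∘ₗ f) = D.transpose D' f ∘ₗ D'.transpose D'' g :=
  LinearMap.ext fun n => D.ext_right fun m => by simp [pair_transpose]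

theorem transpose_injective (D : DualPair k σ M N) (D' : DualPair k σ M' N') :
    Function.Injective (D.transpose D') := fun f g h => by
  rw [← D.transpose_symm_transpose D' f, h, D.transpose_symm_transpose]

theorem subsingleton_right (D : DualPair k σ M N) [Subsingleton M] : Subsingleton N :=
  ⟨fun n n' => D.ext_right fun m => by rw [Subsingleton.elim m 0]; simp⟩

theorem nontrivial_right (D : DualPair k σ M N) [Nontrivial M] : Nontrivial N := by
  by_contra h
  have := not_nontrivial_iff_subsingleton.mp h
  have := D.symm.subsingleton_right
  exact false_of_nontrivial_of_subsingleton M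

end DualPair

/-- Every finite-dimensional right module is the dual of a left module. -/
theorem FDMod.exists_dualPair {k : Type v} [Field k] {A : Type u} [Ring A] [Algebra k A]
    (N : Type u) [AddCommGroup N] [Module Aᵐᵒᵖ N] [Module k N] [IsScalarTower k Aᵐᵒᵖ N]
    [Module.Finite k N] : ∃ M : FDMod k A, Nonempty (DualPair k (opEquiv (α := A)) M N) := by
  let F : A →ₐ[k] Module.End k (Module.Dual k N) :=
    { toFun := fun a => (Algebra.lsmul k k N (op a)).dualMap
      map_one' := by ext; simp
      map_mul' := fun a b => by ext; simp
      map_zero' := by ext; simp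
      map_add' := fun a b => by ext; simp
      commutes' := fun c => by
        ext g n
        simp [Algebra.algebraMap_eq_smul_one] }
  obtain ⟨M, c, hc⟩ := FDMod.exists_of_algHom F
    (LinearEquiv.ofFinrankEq N (Module.Dual k N) (Subspace.dual_finrank_eq).symm)
  refine ⟨M, ⟨c.toLinearMap, inferInstance, fun a m n => ?_⟩⟩
  rw [LinearEquiv.coe_coe, hc]
  rfl

/-! ### Indecomposable modules -/

namespace FDMod

variable {k : Type v} [Field k] {A : Type u} [Ring A] [Algebra k A]

theorem IsIndecomposable.idempotent {M : FDMod k A} (hM : M.IsIndecomposable)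
    {f : M →ₗ[A] M} (hf : f ∘ₗ f = f) : f = 0 ∨ f = LinearMap.id := by
  have hid : IsIdempotentElem f := hf
  rcases hM.2 _ _ (LinearMap.IsIdempotentElem.isCompl hid) with h | h
  · exact Or.inl (LinearMap.range_eq_bot.mp h)
  · refine Or.inr (LinearMap.ext fun m => LinearMap.ker_eq_bot.mp h ?_)
    exact LinearMap.congr_fun hf m

theorem isIndecomposable_of_idempotent {M : FDMod k A} [Nontrivial M]
    (h : ∀ f : M →ₗ[A] M, f ∘ₗ f = f → f = 0 ∨ f = LinearMap.id) : M.IsIndecomposable := by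
  refine ⟨inferInstance, fun U W hUW => ?_⟩
  rcases h (U.projection W hUW) (LinearMap.ext fun m =>
    Submodule.projection_apply_of_mem_left hUW (Submodule.projection_apply_mem hUW m)) with h | h
  · left
    rw [← Submodule.range_projection hUW, h, LinearMap.range_zero]
  · right
    rw [eq_bot_iff]
    intro m hm
    have h1 : U.projection W hUW m = 0 := by
      rw [← LinearMap.mem_ker, Submodule.ker_projection]
      exact hm
    rw [h] at h1
    exact h1

theorem IsIndecomposable.congr {M N : FDMod k A} (hM : M.IsIndecomposable) (e : M ≃ₗ[A] N) :
    N.IsIndecomposable := by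
  have := hM.1
  have : Nontrivial N := e.symm.toEquiv.nontrivial
  refine isIndecomposable_of_idempotent fun f hf => ?_
  have hf' : ∀ n, f (f n) = f n := fun n => LinearMap.congr_fun hf n
  rcases hM.idempotent (f := e.symm.toLinearMap ∘ₗ f ∘ₗ e.toLinearMap)
    (LinearMap.ext fun m => by simp [hf']) with h | h
  · refine Or.inl (LinearMap.ext fun n => ?_)
    simpa using LinearMap.congr_fun h (e.symm n)
  · refine Or.inr (LinearMap.ext fun n => ?_)
    have := LinearMap.congr_fun h (e.symm n)
    simpa using this

/-- A split epimorphism from an indecomposable module to a nonzero module is injective. -/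
theorem IsIndecomposable.injective_of_section {M : FDMod k A} (hM : M.IsIndecomposable)
    {N : Type*} [AddCommGroup N] [Module A N] [Nontrivial N] {π : M →ₗ[A] N} {σ : N →ₗ[A] M}
    (h : π ∘ₗ σ = LinearMap.id) : Function.Injective π := by
  have h' : ∀ n, π (σ n) = n := fun n => LinearMap.congr_fun h n
  rcases hM.idempotent (f := σ ∘ₗ π) (LinearMap.ext fun m => by simp [h']) with h0 | h0
  · obtain ⟨n, hn⟩ := exists_ne (0 : N)
    refine absurd ?_ hn
    have := LinearMap.congr_fun h0 (σ n)
    simp only [LinearMap.comp_apply, h', LinearMap.zero_apply] at this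
    rw [← h' n, this, map_zero]
  · exact Function.LeftInverse.injective (g := σ) fun m => LinearMap.congr_fun h0 m

/-- A nonzero map from an indecomposable module to a projective module over a hereditary algebra
is injective, and its source is projective. -/
theorem IsIndecomposable.injective_of_projective [Module.Finite k A] {V E : Type*} [Fintype V]
    (q : QuiverPresentation k A V E) {M P : FDMod k A} (hM : M.IsIndecomposable)
    [Module.Projective A P] {f : M →ₗ[A] P} (hf : f ≠ 0) :
    Function.Injective f ∧ Module.Projective A M := by
  have h1 : Module.Projective A (LinearMap.range f) :=
    q.projective_of_injective (M := FDMod.ofSub (LinearMap.range f)) (P := P)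
      (LinearMap.range f).subtype Subtype.val_injective
  obtain ⟨σ, hσ⟩ := Module.projective_lifting_property f.rangeRestrict LinearMap.id
    f.surjective_rangeRestrict
  have : Nontrivial (LinearMap.range f) := by
    rw [Submodule.nontrivial_iff_ne_bot]
    exact fun h => hf (LinearMap.range_eq_bot.mp h)
  have h2 : Function.Injective f := fun x y h =>
    hM.injective_of_section hσ (Subtype.ext h)
  exact ⟨h2, q.projective_of_injective f h2⟩

theorem _root_.Module.Projective.exists_dualBasis (A P : Type*) [Ring A] [AddCommGroup P]
    [Module A P] [Module.Finite A P] [Module.Projective A P] :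
    ∃ (n : ℕ) (r : Fin n → P) (g : Fin n → P →ₗ[A] A), ∀ p, ∑ i, g i p • r i = p := by
  obtain ⟨n, f, hf⟩ := Module.Finite.exists_fin' A P
  obtain ⟨σ, hσ⟩ := Module.projective_lifting_property f LinearMap.id hf
  refine ⟨n, fun i => f (Pi.single i 1), fun i => LinearMap.proj i ∘ₗ σ, fun p => ?_⟩
  have h : f (σ p) = p := LinearMap.congr_fun hσ p
  conv_rhs => rw [← h, pi_eq_sum_univ' (σ p), map_sum]
  refine Finset.sum_congr rfl fun i _ => ?_
  rw [map_smul]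
  rfl

instance finite_hom (P : FDMod k A) [Module.Finite k A] : Module.Finite k (P →ₗ[A] A) :=
  Module.Finite.of_injective (LinearMap.restrictScalarsₗ k A P A k)
    (LinearMap.restrictScalars_injective k)

/-! ### Projective resolutions and the Auslander-Reiten translate -/

/-- A projective resolution `0 → P₁ → P₀ → M → 0` by finite-dimensional modules. -/
structure Resolution (M : FDMod k A) where
  P₁ : FDMod k A
  P₀ : FDMod k A
  f : P₁ →ₗ[A] P₀
  p : P₀ →ₗ[A] M
  proj₁ : Module.Projective A P₁
  proj₀ : Module.Projective A P₀
  inj : Function.Injective f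
  exact : Function.Exact f p
  surj : Function.Surjective p

attribute [instance] Resolution.proj₁ Resolution.proj₀

theorem nonempty_resolution [Module.Finite k A] {V E : Type*} [Fintype V]
    (q : QuiverPresentation k A V E) (M : FDMod k A) : Nonempty M.Resolution := by
  have := Module.Finite.of_restrictScalars_finite k A M
  obtain ⟨n, f, hf⟩ := Module.Finite.exists_fin' A M
  let X : FDMod k A := { carrier := Fin n → A }
  have : Module.Projective A X := inferInstanceAs (Module.Projective A (Fin n → A))
  exact ⟨{ P₁ := FDMod.ofSub (X := X) (LinearMap.ker f), P₀ := X
           f := (LinearMap.ker f).subtype, p := f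
           proj₁ := q.projective_of_injective (M := FDMod.ofSub (X := X) (LinearMap.ker f))
            (P := X) (LinearMap.ker f).subtype Subtype.val_injective
           proj₀ := this
           inj := Subtype.val_injective
           exact := LinearMap.exact_subtype_ker_map f
           surj := hf }⟩

theorem isARTranslate_iff [Module.Finite k A] {L M : FDMod k A} :
    IsARTranslate L M ↔ ∃ R : M.Resolution, Nonempty (DualPair k (opEquiv (α := A)) L (ExtOne R.f)) := by
  constructor
  · rintro ⟨P₁, P₀, f, p, h1, h0, hf, hex, hp, e, he⟩
    exact ⟨⟨P₁, P₀, f, p, h1, h0, hf, hex, hp⟩, ⟨e.toLinearMap, inferInstance, he⟩⟩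
  · rintro ⟨R, ⟨D⟩⟩
    have := D.perf
    exact ⟨R.P₁, R.P₀, R.f, R.p, R.proj₁, R.proj₀, R.inj, R.exact, R.surj,
      D.pair.toPerfPair, D.smul⟩

namespace Resolution

variable {X M Z : FDMod k A} (R : X.Resolution) (R' : M.Resolution) (R'' : Z.Resolution)

/-- The class in `Ext¹(X, A)` of a map `P₁ → A`. -/
def extMk : (R.P₁ →ₗ[A] A) →ₗ[Aᵐᵒᵖ] ExtOne R.f := (LinearMap.range (homDual R.f)).mkQ

theorem extMk_surjective : Function.Surjective R.extMk := Submodule.mkQ_surjective _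

theorem extMk_eq_zero {g : R.P₁ →ₗ[A] A} : R.extMk g = 0 ↔ ∃ h : R.P₀ →ₗ[A] A, h ∘ₗ R.f = g :=
  Submodule.Quotient.mk_eq_zero _

/-- `φ` is the map `Ext¹(β, A)`. -/
def Induces (β : X →ₗ[A] M) (φ : ExtOne R'.f →ₗ[Aᵐᵒᵖ] ExtOne R.f) : Prop :=
  ∃ (α₁ : R.P₁ →ₗ[A] R'.P₁) (α₀ : R.P₀ →ₗ[A] R'.P₀), (∀ x, α₀ (R.f x) = R'.f (α₁ x)) ∧
    (∀ x, R'.p (α₀ x) = β (R.p x)) ∧ ∀ g, φ (R'.extMk g) = R.extMk (g ∘ₗ α₁)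

theorem p_f (x : R.P₁) : R.p (R.f x) = 0 := (R.exact _).mpr ⟨x, rfl⟩

/-- A linear map into `P₀` with image in the kernel of `p` lifts to `P₁`. -/
theorem exists_lift {W : Type*} [AddCommGroup W] [Module A W] (h : W →ₗ[A] R.P₀)
    (hh : ∀ x, R.p (h x) = 0) : ∃ l : W →ₗ[A] R.P₁, ∀ x, R.f (l x) = h x := by
  refine ⟨(LinearEquiv.ofInjective R.f R.inj).symm.toLinearMap ∘ₗ
    h.codRestrict (LinearMap.range R.f) fun z => (R.exact (h z)).mp (hh z), fun z => ?_⟩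
  have := (LinearEquiv.ofInjective R.f R.inj).apply_symm_apply
    (h.codRestrict (LinearMap.range R.f) (fun z => (R.exact (h z)).mp (hh z)) z)
  exact congrArg Subtype.val this

/-- A linear map out of `P₀` that kills the image of `P₁` descends to the resolved module. -/
theorem exists_desc {W : Type*} [AddCommGroup W] [Module A W] (h : R.P₀ →ₗ[A] W)
    (hh : ∀ x, h (R.f x) = 0) : ∃ l : X →ₗ[A] W, ∀ x, l (R.p x) = h x := by
  have hk : LinearMap.ker R.p ≤ LinearMap.ker h := fun y hy => by
    obtain ⟨x, rfl⟩ := (R.exact y).mp hy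
    exact hh x
  refine ⟨(LinearMap.ker R.p).liftQ h hk ∘ₗ
    (R.p.quotKerEquivOfSurjective R.surj).symm.toLinearMap, fun x => ?_⟩
  have : (R.p.quotKerEquivOfSurjective R.surj).symm (R.p x) = Submodule.Quotient.mk x := by
    rw [LinearEquiv.symm_apply_eq]
    rfl
  simp [this]

theorem exists_induces (β : X →ₗ[A] M) : ∃ φ, R.Induces R' β φ := by
  obtain ⟨α₀, hα₀⟩ := Module.projective_lifting_property R'.p (β ∘ₗ R.p) R'.surj
  have hα₀' : ∀ x, R'.p (α₀ x) = β (R.p x) := fun x => LinearMap.congr_fun hα₀ x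
  obtain ⟨α₁, hα₁⟩ := R'.exists_lift (α₀ ∘ₗ R.f) fun x => by simp [hα₀', R.p_f]
  refine ⟨Submodule.mapQ _ _ (homDual α₁) ?_, α₁, α₀, fun x => (hα₁ x).symm, hα₀', fun g => rfl⟩
  rintro _ ⟨g, rfl⟩
  exact ⟨g ∘ₗ α₀, LinearMap.ext fun x => congrArg g (hα₁ x).symm⟩

variable [Module.Finite k A]

theorem exists_induces_of_ext (φ : ExtOne R'.f →ₗ[Aᵐᵒᵖ] ExtOne R.f) :
    ∃ β, R.Induces R' β φ := by
  have := Module.Finite.of_restrictScalars_finite k A R'.P₁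
  have := Module.Finite.of_restrictScalars_finite k A R'.P₀
  obtain ⟨n, r, g, hg⟩ := Module.Projective.exists_dualBasis A R'.P₁
  obtain ⟨n', r', g', hg'⟩ := Module.Projective.exists_dualBasis A R'.P₀
  choose v hv using fun i => R.extMk_surjective (φ (R'.extMk (g i)))
  let α₁ : R.P₁ →ₗ[A] R'.P₁ := ∑ i, (v i).smulRight (r i)
  have hα₁ : ∀ x, α₁ x = ∑ i, v i x • r i := fun x => by simp [α₁]
  have hφ : ∀ h, φ (R'.extMk h) = R.extMk (h ∘ₗ α₁) := fun h => by
    have h1 : h = ∑ i, op (h (r i)) • g i := LinearMap.ext fun x => by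
      conv_lhs => rw [← hg x]
      simp
    have h2 : h ∘ₗ α₁ = ∑ i, op (h (r i)) • v i := LinearMap.ext fun x => by
      simp [hα₁]
    rw [h2]
    conv_lhs => rw [h1]
    simp [hv]
  have hw : ∀ i, ∃ w : R.P₀ →ₗ[A] A, w ∘ₗ R.f = g' i ∘ₗ R'.f ∘ₗ α₁ := fun i => by
    rw [← R.extMk_eq_zero]
    have := hφ (g' i ∘ₗ R'.f)
    rw [R'.extMk_eq_zero.mpr ⟨g' i, rfl⟩, map_zero] at this
    exact this.symm
  choose w hw using hw
  let α₀ : R.P₀ →ₗ[A] R'.P₀ := ∑ i, (w i).smulRight (r' i)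
  have hα₀ : ∀ x, α₀ (R.f x) = R'.f (α₁ x) := fun x => by
    rw [← hg' (R'.f (α₁ x))]
    simp only [α₀, LinearMap.sum_apply, LinearMap.smulRight_apply]
    exact Finset.sum_congr rfl fun i _ => congrArg (· • r' i) (LinearMap.congr_fun (hw i) x)
  obtain ⟨β, hβ⟩ := R.exists_desc (R'.p ∘ₗ α₀) fun x => by simp [hα₀, R'.p_f]
  exact ⟨β, α₁, α₀, hα₀, fun x => (hβ x).symm, hφ⟩

variable {R R' R''}

theorem Induces.eq_zero {β : X →ₗ[A] M} (h : R.Induces R' β 0)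
    (hX : ∀ f : X →ₗ[A] R'.P₀, f = 0) : β = 0 := by
  have := Module.Finite.of_restrictScalars_finite k A R'.P₁
  obtain ⟨α₁, α₀, h1, h2, h3⟩ := h
  obtain ⟨n, r, g, hg⟩ := Module.Projective.exists_dualBasis A R'.P₁
  have hw : ∀ i, ∃ w : R.P₀ →ₗ[A] A, w ∘ₗ R.f = g i ∘ₗ α₁ := fun i => by
    rw [← R.extMk_eq_zero]
    exact (h3 (g i)).symm
  choose w hw using hw
  let s : R.P₀ →ₗ[A] R'.P₁ := ∑ i, (w i).smulRight (r i)
  have hs : ∀ x, s (R.f x) = α₁ x := fun x => by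
    rw [← hg (α₁ x)]
    simp only [s, LinearMap.sum_apply, LinearMap.smulRight_apply]
    exact Finset.sum_congr rfl fun i _ => congrArg (· • r i) (LinearMap.congr_fun (hw i) x)
  obtain ⟨γ, hγ⟩ := R.exists_desc (α₀ - R'.f ∘ₗ s) fun x => by simp [h1, hs]
  refine LinearMap.ext fun y => ?_
  obtain ⟨x, rfl⟩ := R.surj y
  have h4 := hγ x
  rw [hX γ, LinearMap.zero_apply, LinearMap.sub_apply, LinearMap.comp_apply] at h4
  rw [← h2, ← sub_add_cancel (α₀ x) (R'.f (s x)), ← h4, zero_add, R'.p_f, LinearMap.zero_apply]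

theorem Induces.ext_eq_zero {φ : ExtOne R'.f →ₗ[Aᵐᵒᵖ] ExtOne R.f} (h : R.Induces R' 0 φ) :
    φ = 0 := by
  obtain ⟨α₁, α₀, h1, h2, h3⟩ := h
  obtain ⟨l, hl⟩ := R'.exists_lift α₀ fun x => by simp [h2]
  refine LinearMap.ext fun z => ?_
  obtain ⟨g, rfl⟩ := R'.extMk_surjective z
  rw [h3, LinearMap.zero_apply, R.extMk_eq_zero]
  refine ⟨g ∘ₗ l, LinearMap.ext fun x => congrArg g (R'.inj ?_)⟩
  rw [hl, h1]

theorem Induces.comp {β : X →ₗ[A] M} {φ : ExtOne R'.f →ₗ[Aᵐᵒᵖ] ExtOne R.f}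
    {γ : M →ₗ[A] Z} {ψ : ExtOne R''.f →ₗ[Aᵐᵒᵖ] ExtOne R'.f}
    (h : R.Induces R' β φ) (h' : R'.Induces R'' γ ψ) : R.Induces R'' (γ ∘ₗ β) (φ ∘ₗ ψ) := by
  obtain ⟨α₁, α₀, h1, h2, h3⟩ := h
  obtain ⟨α₁', α₀', h1', h2', h3'⟩ := h'
  exact ⟨α₁' ∘ₗ α₁, α₀' ∘ₗ α₀, fun x => by simp [h1, h1'], fun x => by simp [h2, h2'],
    fun g => by simp [h3, h3', LinearMap.comp_assoc]⟩

theorem Induces.sub {β β' : X →ₗ[A] M} {φ φ' : ExtOne R'.f →ₗ[Aᵐᵒᵖ] ExtOne R.f}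
    (h : R.Induces R' β φ) (h' : R.Induces R' β' φ') : R.Induces R' (β - β') (φ - φ') := by
  obtain ⟨α₁, α₀, h1, h2, h3⟩ := h
  obtain ⟨α₁', α₀', h1', h2', h3'⟩ := h'
  exact ⟨α₁ - α₁', α₀ - α₀', fun x => by simp [h1, h1'], fun x => by simp [h2, h2'],
    fun g => by simp [h3, h3', LinearMap.comp_sub]⟩

theorem induces_id : R.Induces R LinearMap.id LinearMap.id :=
  ⟨LinearMap.id, LinearMap.id, fun _ => rfl, fun _ => rfl, fun _ => rfl⟩

end Resolution

section ARTranslate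

variable [Module.Finite k A] {V E : Type*} [Fintype V] (q : QuiverPresentation k A V E)

theorem IsIndecomposable.hom_projective_eq_zero (q : QuiverPresentation k A V E) {X P : FDMod k A}
    (hX : X.IsIndecomposable)
    (hn : ¬ Module.Projective A X) [Module.Projective A P] (f : X →ₗ[A] P) : f = 0 :=
  by_contra fun hf => hn (hX.injective_of_projective q hf).2

theorem exists_isARTranslate (q : QuiverPresentation k A V E) (X : FDMod k A) :
    ∃ (R : X.Resolution) (T : FDMod k A), Nonempty (DualPair k (opEquiv (α := A)) T (ExtOne R.f)) := by
  obtain ⟨R⟩ := X.nonempty_resolution q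
  obtain ⟨T, hT⟩ := FDMod.exists_dualPair (k := k) (A := A) (ExtOne R.f)
  exact ⟨R, T, hT⟩

/-- The translate of a projective module is zero. -/
theorem not_projective_of_translate {L M : FDMod k A} [Nontrivial L] (R : M.Resolution)
    (D : DualPair k (opEquiv (α := A)) L (ExtOne R.f)) : ¬ Module.Projective A M := by
  intro hM
  obtain ⟨σ, hσ⟩ := Module.projective_lifting_property R.p LinearMap.id R.surj
  have hσ' : ∀ m, R.p (σ m) = m := fun m => LinearMap.congr_fun hσ m
  obtain ⟨l, hl⟩ := R.exists_lift (LinearMap.id - σ ∘ₗ R.p) fun x => by simp [hσ']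
  have : Subsingleton (ExtOne R.f) := by
    refine subsingleton_of_forall_eq 0 fun z => ?_
    obtain ⟨g, rfl⟩ := R.extMk_surjective z
    rw [R.extMk_eq_zero]
    refine ⟨g ∘ₗ l, LinearMap.ext fun x => congrArg g (R.inj ?_)⟩
    simp [hl, R.p_f]
  have := D.symm.subsingleton_right
  exact false_of_nontrivial_of_subsingleton L

/-- The translate of a nonprojective indecomposable module is indecomposable. -/
theorem IsIndecomposable.translate {X T : FDMod k A} (hX : X.IsIndecomposable)
    (R : X.Resolution) (h0 : ∀ f : X →ₗ[A] R.P₀, f = 0) (D : DualPair k (opEquiv (α := A)) T (ExtOne R.f)) :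
    T.IsIndecomposable := by
  have hne := hX.1
  have : Nontrivial T := by
    by_contra h
    have := not_nontrivial_iff_subsingleton.mp h
    have := D.subsingleton_right
    have h1 : R.Induces R LinearMap.id 0 := by
      convert R.induces_id
      exact Subsingleton.elim _ _
    obtain ⟨x, hx⟩ := exists_ne (0 : X)
    exact hx (LinearMap.congr_fun (h1.eq_zero h0) x)
  refine isIndecomposable_of_idempotent fun f hf => ?_
  let φ := D.transpose D f
  have hφ : φ ∘ₗ φ = φ := by
    rw [← DualPair.transpose_comp, hf]
  obtain ⟨β, hβ⟩ := R.exists_induces_of_ext R φ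
  have hββ : β ∘ₗ β = β := by
    have := (hβ.comp hβ).sub hβ
    rw [hφ, sub_self] at this
    exact sub_eq_zero.mp (this.eq_zero h0)
  rcases hX.idempotent hββ with h | h
  · subst h
    refine Or.inl (D.transpose_injective D ?_)
    rw [D.transpose_zero]
    exact hβ.ext_eq_zero
  · subst h
    refine Or.inr (D.transpose_injective D ?_)
    rw [D.transpose_id]
    have := hβ.sub R.induces_id
    rw [sub_self] at this
    exact sub_eq_zero.mp this.ext_eq_zero

/-- If `Hom(Y, τ M) = 0` then `Ext¹(M, Y) = 0`. -/
theorem extVanish_of_hom_translate {L M Y : FDMod k A} (R : M.Resolution)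
    (D : DualPair k (opEquiv (α := A)) L (ExtOne R.f)) (h0 : ∀ f : Y →ₗ[A] L, f = 0) : q.ExtVanish M Y := by
  have := Module.Finite.of_restrictScalars_finite k A R.P₁
  have hext : ∀ h : R.P₁ →ₗ[A] Y, ∃ h' : R.P₀ →ₗ[A] Y, h' ∘ₗ R.f = h := by
    let res : (R.P₀ →ₗ[A] Y) →ₗ[k] (R.P₁ →ₗ[A] Y) :=
      { toFun := fun h => h ∘ₗ R.f
        map_add' := fun _ _ => rfl
        map_smul' := fun _ _ => rfl }
    suffices LinearMap.range res = ⊤ from fun h => LinearMap.range_eq_top.mp this h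
    by_contra hne
    obtain ⟨l, hl, hle⟩ := Submodule.exists_le_ker_of_lt_top _ (lt_top_iff_ne_top.mpr hne)
    let B : Y → (R.P₁ →ₗ[A] A) →ₗ[k] k := fun y => l ∘ₗ
      { toFun := fun g => g.smulRight y
        map_add' := fun g g' => LinearMap.ext fun x => by simp [add_smul]
        map_smul' := fun c g => LinearMap.ext fun x => by simp }
    have hB : ∀ y g, B y g = l (g.smulRight y) := fun _ _ => rfl
    have hB0 : ∀ y, (LinearMap.range (homDual R.f)).restrictScalars k ≤ LinearMap.ker (B y) := by
      rintro y _ ⟨g, rfl⟩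
      exact hle ⟨g.smulRight y, rfl⟩
    have hT : ∀ y, ∃ t : L, ∀ g, D.pair t (R.extMk g) = l (g.smulRight y) := fun y => by
      obtain ⟨t, ht⟩ := D.exists_left
        (((LinearMap.range (homDual R.f)).restrictScalars k).liftQ (B y) (hB0 y))
      exact ⟨t, fun g => ht (R.extMk g)⟩
    choose t ht using hT
    let φ : Y →ₗ[A] L :=
      { toFun := t
        map_add' := fun y y' => D.ext_left fun z => by
          obtain ⟨g, rfl⟩ := R.extMk_surjective z
          rw [map_add, LinearMap.add_apply, ht, ht, ht, ← map_add]
          congr 1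
          exact LinearMap.ext fun x => by simp
        map_smul' := fun a y => D.ext_left fun z => by
          obtain ⟨g, rfl⟩ := R.extMk_surjective z
          rw [RingHom.id_apply, D.smul, ht, opEquiv_apply, ← map_smul, ht]
          congr 1
          exact LinearMap.ext fun x => by simp [mul_smul] }
    obtain ⟨n, r, g, hg⟩ := Module.Projective.exists_dualBasis A R.P₁
    refine hl (LinearMap.ext fun h => ?_)
    have : h = ∑ i, (g i).smulRight (h (r i)) := LinearMap.ext fun x => by
      conv_lhs => rw [← hg x]
      simp
    rw [this, map_sum, LinearMap.zero_apply]
    refine Finset.sum_eq_zero fun i _ => ?_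
    rw [← ht]
    have := LinearMap.congr_fun (h0 φ) (h (r i))
    change t (h (r i)) = 0 at this
    rw [this, map_zero, LinearMap.zero_apply]
  refine q.extVanish_of_split fun X ι π hι hex hπ => ?_
  obtain ⟨s, hs⟩ := Module.projective_lifting_property π R.p hπ
  have hs' : ∀ x, π (s x) = R.p x := fun x => LinearMap.congr_fun hs x
  have hl : ∃ h : R.P₁ →ₗ[A] Y, ∀ x, ι (h x) = s (R.f x) := by
    have hm : ∀ x, s (R.f x) ∈ LinearMap.range ι := fun x =>
      (hex _).mp (by rw [hs', R.p_f])
    refine ⟨(LinearEquiv.ofInjective ι hι).symm.toLinearMap ∘ₗ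
      (s ∘ₗ R.f).codRestrict (LinearMap.range ι) hm, fun x => ?_⟩
    have := (LinearEquiv.ofInjective ι hι).apply_symm_apply ⟨_, hm x⟩
    exact congrArg Subtype.val this
  obtain ⟨h, hh⟩ := hl
  obtain ⟨h', hh'⟩ := hext h
  obtain ⟨σ, hσ⟩ := R.exists_desc (s - ι ∘ₗ h') fun x => by
    have : h' (R.f x) = h x := LinearMap.congr_fun hh' x
    simp [this, hh]
  refine ⟨σ, LinearMap.ext fun y => ?_⟩
  obtain ⟨x, rfl⟩ := R.surj y
  have : π (ι (h' x)) = 0 := (hex _).mpr ⟨_, rfl⟩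
  simp [hσ, hs', this]

end ARTranslate

end FDMod

/-! ### Direct sums -/

namespace FDMod

variable {k : Type v} [Field k] {A : Type u} [Ring A] [Algebra k A]

/-- The direct sum of two modules. -/
def prod (M N : FDMod k A) : FDMod k A where
  carrier := M × N

/-- The direct sum of finitely many modules. -/
def pi {n : ℕ} (N : Fin n → FDMod k A) : FDMod k A where
  carrier := ∀ i, N i

/-- The finite direct sums of modules with property `p`. -/
inductive SumOf (p : FDMod k A → Prop) : FDMod k A → Prop
  | zero (M : FDMod k A) (h : Subsingleton M) : SumOf p M
  | cons (P M X : FDMod k A) (hP : p P) (hM : SumOf p M) (e : X ≃ₗ[A] P × M) : SumOf p X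

theorem SumOf.congr {p : FDMod k A → Prop} {M N : FDMod k A} (hM : SumOf p M)
    (e : N ≃ₗ[A] M) : SumOf p N := by
  cases hM with
  | zero M h => exact .zero N e.toEquiv.subsingleton
  | cons P M' X hP hM' e₁ => exact .cons P M' N hP hM' (e.trans e₁)

/-- A direct sum with a zero module. -/
def prodSubsingleton (M N : Type*) [AddCommGroup M] [AddCommGroup N] [Module A M] [Module A N]
    [Subsingleton M] : (M × N) ≃ₗ[A] N where
  toFun := Prod.snd
  map_add' _ _ := rfl
  map_smul' _ _ := rfl
  invFun n := (0, n)
  left_inv _ := Prod.ext (Subsingleton.elim _ _) rfl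
  right_inv _ := rfl

theorem SumOf.prod {p : FDMod k A → Prop} {M N : FDMod k A} (hM : SumOf p M) (hN : SumOf p N) :
    SumOf p (M.prod N) := by
  induction hM with
  | zero M h => exact hN.congr (prodSubsingleton M N)
  | cons P M X hP hM e ih =>
    exact .cons P (M.prod N) _ hP ih
      ((e.prodCongr (LinearEquiv.refl A N)).trans (LinearEquiv.prodAssoc A P M N))

theorem sumOf_of_equiv_pi {p : FDMod k A → Prop} {n : ℕ} {N : Fin n → FDMod k A}
    (hN : ∀ i, p (N i)) {M : FDMod k A} (e : M ≃ₗ[A] ∀ i, N i) : SumOf p M := by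
  induction n generalizing M with
  | zero => exact .zero M e.toEquiv.subsingleton
  | succ n ih =>
    have h := ih (N := fun i => N i.succ) (fun i => hN i.succ) (M := pi fun i => N i.succ)
      (LinearEquiv.refl A _)
    exact .cons (N 0) _ M (hN 0) h (e.trans
      (Fin.consLinearEquiv A fun i => (N i : Type u)).symm)

/-- Every finite-dimensional module is a direct sum of indecomposable modules: an induction
principle. -/
theorem induction_indecomposable {p : FDMod k A → Prop}
    (congr : ∀ M N : FDMod k A, (M ≃ₗ[A] N) → p M → p N)
    (zero : ∀ M : FDMod k A, Subsingleton M → p M)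
    (indec : ∀ M : FDMod k A, M.IsIndecomposable → p M)
    (prod : ∀ M N : FDMod k A, p M → p N → p (M.prod N)) (M : FDMod k A) : p M := by
  induction hd : Module.finrank k M using Nat.strong_induction_on generalizing M with
  | _ d ih =>
    subst hd
    by_cases h : M.IsIndecomposable
    · exact indec M h
    rcases subsingleton_or_nontrivial M with hs | hs
    · exact zero M hs
    rw [IsIndecomposable] at h
    push Not at h
    obtain ⟨U, W, hUW, hU, hW⟩ := h hs
    let e := Submodule.prodEquivOfIsCompl U W hUW
    have hd : Module.finrank k (ofSub U) + Module.finrank k (ofSub W) = Module.finrank k M := by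
      rw [← Module.finrank_prod, ← (e.restrictScalars k).finrank_eq]
      rfl
    have hU' : 0 < Module.finrank k (ofSub U) := by
      have : Nontrivial (ofSub U) := (Submodule.nontrivial_iff_ne_bot).mpr hU
      exact Module.finrank_pos
    have hW' : 0 < Module.finrank k (ofSub W) := by
      have : Nontrivial (ofSub W) := (Submodule.nontrivial_iff_ne_bot).mpr hW
      exact Module.finrank_pos
    exact congr ((ofSub U).prod (ofSub W)) M e
      (prod _ _ (ih _ (by omega) _ rfl) (ih _ (by omega) _ rfl))

/-! ### The order on the indecomposable preprojective modules -/

/-- `HasKey (n, d) M` if `M` is indecomposable and `τⁿ M` is projective of dimension `d`. -/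
inductive HasKey : ℕ ×ₗ ℕ → FDMod k A → Prop
  | projective (P : FDMod k A) (hP : P.IsIndecomposable) (hproj : Module.Projective A P) :
      HasKey (toLex (0, Module.finrank k P)) P
  | translate (n d : ℕ) (L M : FDMod k A) (hL : HasKey (toLex (n, d)) L)
      (hM : M.IsIndecomposable) (h : IsARTranslate L M) : HasKey (toLex (n + 1, d)) M

theorem HasKey.isIndecomposable {κ : ℕ ×ₗ ℕ} {M : FDMod k A} (h : HasKey κ M) :
    M.IsIndecomposable := by
  cases h <;> assumption

theorem IsIndecPreprojective.exists_hasKey {M : FDMod k A} (h : IsIndecPreprojective M) :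
    ∃ κ, HasKey κ M := by
  induction h with
  | projective P hP hproj => exact ⟨_, .projective P hP hproj⟩
  | translate L M hL hM h ih =>
    obtain ⟨κ, hκ⟩ := ih
    exact ⟨_, .translate (ofLex κ).1 (ofLex κ).2 L M hκ hM h⟩

theorem HasKey.congr {κ : ℕ ×ₗ ℕ} {M N : FDMod k A} (h : HasKey κ M) (e : M ≃ₗ[A] N) :
    HasKey κ N := by
  cases h with
  | projective _ hP hproj =>
    rw [(e.restrictScalars k).finrank_eq]
    exact .projective N (hP.congr e) (Module.Projective.of_equiv e)
  | translate n d L _ hL hM h =>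
    refine .translate n d L N hL (hM.congr e) ?_
    obtain ⟨P₁, P₀, f, p, h1, h0, hf, hex, hp, hD⟩ := h
    refine ⟨P₁, P₀, f, e.toLinearMap ∘ₗ p, h1, h0, hf, fun x => ?_, e.surjective.comp hp, hD⟩
    rw [← hex x]
    simp

/-- There is no nonzero map from `X` to a module of key less than `κ`. -/
def KeyFree (κ : ℕ ×ₗ ℕ) (X : FDMod k A) : Prop :=
  ∀ κ' < κ, ∀ L : FDMod k A, HasKey κ' L → ∀ f : X →ₗ[A] L, f = 0

theorem KeyFree.mono {κ κ' : ℕ ×ₗ ℕ} (h : κ' ≤ κ) {X : FDMod k A} (hX : KeyFree κ X) :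
    KeyFree κ' X := fun κ'' h' => hX κ'' (h'.trans_le h)

theorem KeyFree.of_subsingleton (κ : ℕ ×ₗ ℕ) (X : FDMod k A) [Subsingleton X] : KeyFree κ X :=
  fun _ _ _ _ f => LinearMap.ext fun x => by rw [Subsingleton.elim x 0, map_zero, map_zero]

theorem KeyFree.congr {κ : ℕ ×ₗ ℕ} {X Y : FDMod k A} (hX : KeyFree κ X) (e : X ≃ₗ[A] Y) :
    KeyFree κ Y := fun κ' h L hL f => LinearMap.ext fun y => by
  have := LinearMap.congr_fun (hX κ' h L hL (f ∘ₗ e.toLinearMap)) (e.symm y)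
  simpa using this

theorem KeyFree.prod {κ : ℕ ×ₗ ℕ} {X Y : FDMod k A} (hX : KeyFree κ X) (hY : KeyFree κ Y) :
    KeyFree κ (X.prod Y) := fun κ' h L hL f => by
  let f' : X × Y →ₗ[A] L := f
  have h1 := hX κ' h L hL (f' ∘ₗ LinearMap.inl A X Y)
  have h2 := hY κ' h L hL (f' ∘ₗ LinearMap.inr A X Y)
  exact LinearMap.prod_ext (f := f') (g := 0) (by rw [h1]; rfl) (by rw [h2]; rfl)

variable [Module.Finite k A] {V E : Type*} [Fintype V] (q : QuiverPresentation k A V E)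

/-- Predecessors of an indecomposable preprojective module have smaller keys. -/
theorem HasKey.of_hom_ne_zero (q : QuiverPresentation k A V E) {κ : ℕ ×ₗ ℕ} {M X : FDMod k A}
    (hM : HasKey κ M) (hX : X.IsIndecomposable) {f : X →ₗ[A] M} (hf : f ≠ 0) :
    (∃ κ' < κ, HasKey κ' X) ∨ Function.Bijective f := by
  induction hM generalizing X with
  | projective P hP hproj =>
    obtain ⟨hinj, hXp⟩ := hX.injective_of_projective q hf
    rcases (LinearMap.finrank_le_finrank_of_injective (f := f.restrictScalars k) hinj).lt_or_eq
      with h | h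
    · exact Or.inl ⟨_, Prod.Lex.right _ h, .projective X hX hXp⟩
    · refine Or.inr ⟨hinj, ?_⟩
      exact (LinearMap.injective_iff_surjective_of_finrank_eq_finrank
        (f := f.restrictScalars k) h).mp hinj
  | translate n d L M hL hM hLM ih =>
    by_cases hXp : Module.Projective A X
    · exact Or.inl ⟨_, Prod.Lex.left _ _ n.succ_pos, .projective X hX hXp⟩
    obtain ⟨R', ⟨D'⟩⟩ := isARTranslate_iff.mp hLM
    obtain ⟨R, T, ⟨D⟩⟩ := exists_isARTranslate q X
    have := hL.isIndecomposable.1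
    have hMp := not_projective_of_translate R' D'
    have hX0 : ∀ (P : FDMod k A) [Module.Projective A P] (f : X →ₗ[A] P), f = 0 :=
      fun P _ f => hX.hom_projective_eq_zero q hXp f
    have hM0 : ∀ (P : FDMod k A) [Module.Projective A P] (f : M →ₗ[A] P), f = 0 :=
      fun P _ f => hM.hom_projective_eq_zero q hMp f
    have hT : T.IsIndecomposable := hX.translate R (hX0 _) D
    obtain ⟨φ, hφ⟩ := R.exists_induces R' f
    let g : T →ₗ[A] L := D'.symm.transpose D.symm φ
    have hg : D.transpose D' g = φ := D'.symm.transpose_symm_transpose D.symm φ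
    have hg0 : g ≠ 0 := fun h => by
      rw [h, D.transpose_zero] at hg
      subst hg
      exact hf (hφ.eq_zero (hX0 _))
    rcases ih hT hg0 with ⟨κ', hκ', hTκ⟩ | hb
    · refine Or.inl ⟨toLex ((ofLex κ').1 + 1, (ofLex κ').2), ?_,
        .translate _ _ T X hTκ hX (isARTranslate_iff.mpr ⟨R, ⟨D⟩⟩)⟩
      rcases Prod.Lex.lt_iff.mp hκ' with h | ⟨h, h'⟩
      · exact Prod.Lex.left _ _ (Nat.succ_lt_succ h)
      · exact Prod.Lex.lt_iff.mpr (Or.inr ⟨congrArg Nat.succ h, h'⟩)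
    · let g' := LinearEquiv.ofBijective g hb
      let ψ := D'.transpose D g'.symm.toLinearMap
      have h1 : φ ∘ₗ ψ = LinearMap.id := by
        rw [← hg, ← DualPair.transpose_comp, ← D.transpose_id]
        exact congrArg _ (LinearMap.ext fun x => g'.symm_apply_apply x)
      have h2 : ψ ∘ₗ φ = LinearMap.id := by
        rw [← hg, ← DualPair.transpose_comp, ← D'.transpose_id]
        exact congrArg _ (LinearMap.ext fun x => g'.apply_symm_apply x)
      obtain ⟨β, hβ⟩ := R'.exists_induces_of_ext R ψ
      have h3 : β ∘ₗ f = LinearMap.id := by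
        have := (hφ.comp hβ).sub R.induces_id
        rw [h1, sub_self] at this
        exact sub_eq_zero.mp (this.eq_zero (hX0 _))
      have h4 : f ∘ₗ β = LinearMap.id := by
        have := (hβ.comp hφ).sub R'.induces_id
        rw [h2, sub_self] at this
        exact sub_eq_zero.mp (this.eq_zero (hM0 _))
      exact Or.inr (Function.bijective_iff_has_inverse.mpr
        ⟨β, fun x => LinearMap.congr_fun h3 x, fun x => LinearMap.congr_fun h4 x⟩)

theorem IsIndecomposable.keyFree (q : QuiverPresentation k A V E) {κ : ℕ ×ₗ ℕ} {X : FDMod k A}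
    (hX : X.IsIndecomposable) (h : ∀ κ' < κ, ¬ HasKey κ' X) : KeyFree κ X := by
  intro κ' hκ' L hL f
  by_contra hf
  rcases hL.of_hom_ne_zero q hX hf with ⟨κ'', h1, h2⟩ | hb
  · exact h κ'' (h1.trans hκ') h2
  · exact h κ' hκ' (hL.congr (LinearEquiv.ofBijective f hb).symm)

theorem HasKey.extVanish {κ : ℕ ×ₗ ℕ} {M Y : FDMod k A} (hM : HasKey κ M) (hY : KeyFree κ Y) :
    q.ExtVanish M Y := by
  cases hM with
  | projective _ hP hproj => exact q.extVanish_of_projective M Y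
  | translate n d L _ hL hM hLM =>
    obtain ⟨R, ⟨D⟩⟩ := isARTranslate_iff.mp hLM
    exact extVanish_of_hom_translate q R D fun f =>
      hY _ (Prod.Lex.left _ _ n.lt_succ_self) L hL f

/-- `κ` is the smallest key of `P`. -/
def IsMinKey (κ : ℕ ×ₗ ℕ) (P : FDMod k A) : Prop := HasKey κ P ∧ KeyFree κ P

theorem HasKey.exists_isMinKey (q : QuiverPresentation k A V E) {κ : ℕ ×ₗ ℕ} {P : FDMod k A}
    (h : HasKey κ P) : ∃ κ' ≤ κ, IsMinKey κ' P := by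
  obtain ⟨κ', h1, h2⟩ := WellFounded.has_min (wellFounded_lt (α := ℕ ×ₗ ℕ))
    {κ | HasKey κ P} ⟨κ, h⟩
  exact ⟨κ', not_lt.mp (h2 κ h), h1, h.isIndecomposable.keyFree q fun κ₁ h3 h4 => h2 κ₁ h4 h3⟩

/-- In a sum of indecomposable preprojective modules, split off one of minimal key. -/
theorem SumOf.exists_min {p : FDMod k A → Prop} (hp : ∀ P, p P → ∃ κ, IsMinKey κ P)
    {F : FDMod k A} (hF : SumOf p F) (hFn : Nontrivial F) :
    ∃ (P F' : FDMod k A) (κ : ℕ ×ₗ ℕ), p P ∧ IsMinKey κ P ∧ SumOf p F' ∧ KeyFree κ F' ∧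
      Nonempty (F ≃ₗ[A] P × F') := by
  induction hF with
  | zero M h => exact absurd h (not_subsingleton M)
  | cons P M X hP hM e ih =>
    obtain ⟨κ, hκ⟩ := hp P hP
    rcases subsingleton_or_nontrivial M with hs | hs
    · exact ⟨P, M, κ, hP, hκ, hM, KeyFree.of_subsingleton κ M, ⟨e⟩⟩
    obtain ⟨P₁, M', κ₁, hP₁, hκ₁, hM', hf, ⟨e'⟩⟩ := ih hs
    rcases le_total κ κ₁ with h | h
    · exact ⟨P, M, κ, hP, hκ, hM,
        KeyFree.congr (X := P₁.prod M') ((hκ₁.2.prod hf).mono h) e'.symm, ⟨e⟩⟩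
    · refine ⟨P₁, P.prod M', κ₁, hP₁, hκ₁, .cons P M' _ hP hM' (LinearEquiv.refl A _),
        (hκ.2.mono h).prod hf, ⟨?_⟩⟩
      exact (e.trans ((LinearEquiv.refl A P).prodCongr e')).trans
        ((LinearEquiv.prodAssoc A P P₁ M').symm.trans
          (((LinearEquiv.prodComm A P P₁).prodCongr (LinearEquiv.refl A M')).trans
            (LinearEquiv.prodAssoc A P₁ P _)))

/-- The torsion pair given by the modules of key less than `κ`. -/
theorem exists_sumOf_prod_keyFree (q : QuiverPresentation k A V E) (κ : ℕ ×ₗ ℕ) (X : FDMod k A) :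
    ∃ F T : FDMod k A, SumOf (fun P => ∃ κ' < κ, IsMinKey κ' P) F ∧ KeyFree κ T ∧
      Nonempty (X ≃ₗ[A] F × T) := by
  induction X using induction_indecomposable with
  | congr M N e h =>
    obtain ⟨F, T, hF, hT, ⟨e'⟩⟩ := h
    exact ⟨F, T, hF, hT, ⟨e.symm.trans e'⟩⟩
  | zero M h => exact ⟨M, M, .zero M h, KeyFree.of_subsingleton κ M, ⟨(prodSubsingleton M M).symm⟩⟩
  | indec M hM =>
    let O := FDMod.zero k A
    have : Subsingleton O := inferInstanceAs (Subsingleton PUnit)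
    by_cases h : ∃ κ' < κ, HasKey κ' M
    · obtain ⟨κ', hκ', h⟩ := h
      obtain ⟨κ'', hκ'', h⟩ := h.exists_isMinKey q
      have e : M ≃ₗ[A] M × O :=
        (prodSubsingleton (A := A) O M).symm.trans (LinearEquiv.prodComm A O M)
      exact ⟨M, O, .cons M O M ⟨κ'', hκ''.trans_lt hκ', h⟩ (.zero O this) e,
        KeyFree.of_subsingleton κ O, ⟨e⟩⟩
    · push Not at h
      exact ⟨O, M, .zero O this, hM.keyFree q h, ⟨(prodSubsingleton O M).symm⟩⟩
  | prod M N hM hN =>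
    obtain ⟨F, T, hF, hT, ⟨e⟩⟩ := hM
    obtain ⟨F', T', hF', hT', ⟨e'⟩⟩ := hN
    exact ⟨F.prod F', T.prod T', hF.prod hF', hT.prod hT',
      ⟨(e.prodCongr e').trans (LinearEquiv.prodProdProdComm A F T _ _)⟩⟩

/-- A nonzero map to `P` is nonzero on some indecomposable direct summand. -/
theorem exists_summand_of_hom_ne_zero {P X : FDMod k A} (h : ∃ f : X →ₗ[A] P, f ≠ 0) :
    ∃ Y Z : FDMod k A, Y.IsIndecomposable ∧ (∃ f : Y →ₗ[A] P, f ≠ 0) ∧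
      Nonempty (X ≃ₗ[A] Y × Z) := by
  induction X using induction_indecomposable with
  | congr M N e ih =>
    obtain ⟨f, hf⟩ := h
    obtain ⟨Y, Z, hY, hY', ⟨e'⟩⟩ := ih ⟨f ∘ₗ e.toLinearMap, fun h0 => hf (LinearMap.ext fun x => by
      simpa using LinearMap.congr_fun h0 (e.symm x))⟩
    exact ⟨Y, Z, hY, hY', ⟨e.symm.trans e'⟩⟩
  | zero M hM =>
    obtain ⟨f, hf⟩ := h
    exact absurd (LinearMap.ext fun x => by rw [Subsingleton.elim x 0, map_zero, map_zero]) hf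
  | indec M hM =>
    let O := FDMod.zero k A
    have : Subsingleton O := inferInstanceAs (Subsingleton PUnit)
    exact ⟨M, O, hM, h,
      ⟨(prodSubsingleton (A := A) O M).symm.trans (LinearEquiv.prodComm A O M)⟩⟩
  | prod M N hM hN =>
    obtain ⟨f, hf⟩ := h
    let f' : M × N →ₗ[A] P := f
    by_cases h1 : f' ∘ₗ LinearMap.inl A M N = 0
    · have h2 : f' ∘ₗ LinearMap.inr A M N ≠ 0 := fun h2 => hf
        (LinearMap.prod_ext (f := f') (g := 0) (by rw [h1]; rfl) (by rw [h2]; rfl))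
      obtain ⟨Y, Z, hY, hY', ⟨e⟩⟩ := hN ⟨_, h2⟩
      exact ⟨Y, Z.prod M, hY, hY', ⟨(LinearEquiv.prodComm A M N).trans
        ((e.prodCongr (LinearEquiv.refl A M)).trans (LinearEquiv.prodAssoc A Y Z M))⟩⟩
    · obtain ⟨Y, Z, hY, hY', ⟨e⟩⟩ := hM ⟨_, h1⟩
      exact ⟨Y, Z.prod N, hY, hY',
        ⟨(e.prodCongr (LinearEquiv.refl A N)).trans (LinearEquiv.prodAssoc A Y Z N)⟩⟩

end FDMod

/-! ### Sums of classes in the Hall algebra -/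

namespace QuiverPresentation

variable {k : Type v} [Field k] {A : Type u} [Ring A] [Algebra k A] {V E : Type*} [Fintype V]
  (q : QuiverPresentation k A V E)

theorem dimVec_eq_zero_iff {M : Type*} [AddCommGroup M] [Module A M] [Module k M]
    [IsScalarTower k A M] [Module.Finite k M] {i : V} :
    q.dimVec M i = 0 ↔ ∀ m : M, q.e i • m = 0 := by
  rw [dimVec, Submodule.finrank_eq_zero, LinearMap.range_eq_bot, LinearMap.ext_iff]
  rfl

theorem dimVec_quot_add (X : FDMod k A) (Y : Submodule A X) :
    q.dimVec X = q.dimVec (FDMod.quot Y) + q.dimVec (FDMod.ofSub Y) :=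
  q.dimVec_eq_add (M := FDMod.quot Y) (N := FDMod.ofSub Y) (ι := Y.subtype) (π := Y.mkQ)
    Subtype.val_injective (LinearMap.exact_subtype_mkQ Y) Y.mkQ_surjective

theorem dimVec_prod (M N : FDMod k A) :
    q.dimVec (M.prod N) = q.dimVec M + q.dimVec N :=
  q.dimVec_eq_add (X := M × N) (ι := LinearMap.inr A M N) (π := LinearMap.fst A M N)
    LinearMap.inr_injective .inr_fst LinearMap.fst_surjective

theorem subsingleton_iff_dimVec (M : FDMod k A) : Subsingleton M ↔ q.dimVec M = 0 := by
  rw [← Module.finrank_zero_iff (R := k), ← q.sum_dimVec, funext_iff]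
  simp

theorem finite_isoClass_dimVec [Finite k] [Module.Finite k A] (d : V → ℕ) :
    {x : IsoClass k A | q.dimVec (Quotient.out x : FDMod k A) = d}.Finite := by
  refine (IsoClass.finite_card_eq (k := k) (A := A) (Nat.card k ^ ∑ i, d i)).subset fun x hx => ?_
  have hx : q.dimVec (Quotient.out x : FDMod k A) = d := hx
  change Nat.card (Quotient.out x : FDMod k A) = _
  rw [Module.natCard_eq_pow_finrank (K := k), ← q.sum_dimVec, hx]

/-- The sum of the classes of all modules with dimension vector `d` and property `p`. -/
noncomputable def classSum [Finite k] [Module.Finite k A] (d : V → ℕ) (p : FDMod k A → Prop) :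
    HallAlgebra k A :=
  ∑ x ∈ ((q.finite_isoClass_dimVec d).subset (Set.sep_subset
    {x : IsoClass k A | q.dimVec (Quotient.out x : FDMod k A) = d}
    fun x => p (Quotient.out x))).toFinset, HallAlgebra.cls (Quotient.out x)

end QuiverPresentation

namespace HallAlgebra

variable {k : Type v} [Field k] {A : Type u} [Ring A] [Algebra k A]

theorem cls_congr {M N : FDMod k A} (e : M ≃ₗ[A] N) : cls M = cls N := by
  rw [cls, cls, IsoClass.mk_eq_mk.mpr ⟨e⟩]

theorem mk_out_eq_iff {M : FDMod k A} {x : IsoClass k A} :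
    Nonempty (M ≃ₗ[A] (Quotient.out x : FDMod k A)) ↔ IsoClass.mk M = x := by
  rw [← IsoClass.mk_eq_mk]
  constructor
  · intro h
    rw [h]
    exact Quotient.out_eq x
  · rintro rfl
    exact (Quotient.out_eq _).symm

variable [Finite k] [Module.Finite k A]

theorem one_eq_cls {M : FDMod k A} (h : Subsingleton M) : cls M = 1 := by
  have : Subsingleton (FDMod.zero k A) := inferInstanceAs (Subsingleton PUnit)
  exact cls_congr (0 : M ≃ₗ[A] FDMod.zero k A)

open Classical in
theorem coeff_mul_sum_cls (Z : FDMod k A) (y : HallAlgebra k A) (s : Finset (IsoClass k A))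
    [Fintype (Submodule A Z)] :
    coeff Z (y * ∑ x ∈ s, cls (Quotient.out x)) =
      ∑ Y : Submodule A Z, if IsoClass.mk (FDMod.ofSub Y) ∈ s then coeff (FDMod.quot Y) y
        else 0 := by
  have h : ∀ x : IsoClass k A, coeff Z (y * cls (Quotient.out x)) =
      ∑ Y : Submodule A Z, if IsoClass.mk (FDMod.ofSub Y) = x then coeff (FDMod.quot Y) y
        else 0 := fun x => by
    rw [coeff_mul_cls, finsum_eq_sum_of_fintype, ← Finset.sum_filter]
    refine Finset.sum_subtype (p := fun Y : Submodule A Z =>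
      Nonempty (Y ≃ₗ[A] (Quotient.out x : FDMod k A))) _ (fun Y => ?_)
      (fun Y => coeff (FDMod.quot Y) y) |>.symm
    rw [Finset.mem_filter, ← mk_out_eq_iff (M := FDMod.ofSub Y)]
    exact ⟨fun h => h.2, fun h => ⟨Finset.mem_univ _, h⟩⟩
  rw [Finset.mul_sum, map_sum]
  simp only [h]
  rw [Finset.sum_comm]
  refine Finset.sum_congr rfl fun Y _ => ?_
  rw [Finset.sum_ite_eq]

end HallAlgebra

namespace QuiverPresentation

open HallAlgebra

variable {k : Type v} [Field k] {A : Type u} [Ring A] [Algebra k A] {V E : Type*} [Fintype V]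
  (q : QuiverPresentation k A V E) [Finite k] [Module.Finite k A]

/-- A property of modules that only depends on the isomorphism class. -/
def IsoInvariant (p : FDMod k A → Prop) : Prop :=
  ∀ M N : FDMod k A, (M ≃ₗ[A] N) → p M → p N

theorem IsoInvariant.iff {p : FDMod k A → Prop} (hp : IsoInvariant p) {M N : FDMod k A}
    (e : M ≃ₗ[A] N) : p M ↔ p N := ⟨hp M N e, hp N M e.symm⟩

theorem mem_classSum_iff {d : V → ℕ} {p : FDMod k A → Prop} (hp : IsoInvariant p)
    (X : FDMod k A) :
    IsoClass.mk X ∈ ((q.finite_isoClass_dimVec d).subset (Set.sep_subset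
      {x : IsoClass k A | q.dimVec (Quotient.out x : FDMod k A) = d}
      fun x => p (Quotient.out x))).toFinset ↔ q.dimVec X = d ∧ p X := by
  obtain ⟨e⟩ := IsoClass.nonempty_out_mk X
  rw [Set.Finite.mem_toFinset]
  change q.dimVec (Quotient.out (IsoClass.mk X) : FDMod k A) = d ∧
    p (Quotient.out (IsoClass.mk X)) ↔ _
  rw [q.dimVec_congr e, hp.iff e]

open Classical in
theorem coeff_classSum (d : V → ℕ) {p : FDMod k A → Prop} (hp : IsoInvariant p)
    (X : FDMod k A) :
    coeff X (q.classSum d p) = if q.dimVec X = d ∧ p X then 1 else 0 := by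
  rw [classSum, map_sum]
  simp only [coeff_cls, mk_out_eq_iff]
  rw [Finset.sum_ite_eq]
  simp only [q.mem_classSum_iff hp]

theorem coeff_classSum_mul (d d' : V → ℕ) {p p' : FDMod k A → Prop} (hp : IsoInvariant p)
    (hp' : IsoInvariant p') (Z : FDMod k A) :
    coeff Z (q.classSum d p * q.classSum d' p') =
      Nat.card {Y : Submodule A Z // (q.dimVec (FDMod.quot Y) = d ∧ p (FDMod.quot Y)) ∧
        q.dimVec (FDMod.ofSub Y) = d' ∧ p' (FDMod.ofSub Y)} := by
  classical
  have := finite_submodule Z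
  have := Fintype.ofFinite (Submodule A Z)
  conv_lhs => rw [classSum.eq_def q d' p']
  rw [coeff_mul_sum_cls]
  simp only [q.mem_classSum_iff hp', q.coeff_classSum d hp]
  rw [Nat.card_eq_fintype_card, Fintype.card_subtype, Finset.card_filter, Nat.cast_sum]
  refine Finset.sum_congr rfl fun Y _ => ?_
  by_cases h1 : q.dimVec (FDMod.ofSub Y) = d' ∧ p' (FDMod.ofSub Y) <;>
    by_cases h2 : q.dimVec (FDMod.quot Y) = d ∧ p (FDMod.quot Y) <;> simp [h1, h2]

theorem classSum_mem {C : Subalgebra ℚ (HallAlgebra k A)} (d : V → ℕ) {p : FDMod k A → Prop}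
    (h : ∀ X, p X → q.dimVec X = d → cls X ∈ C) : q.classSum d p ∈ C := by
  refine Subalgebra.sum_mem _ fun x hx => ?_
  rw [Set.Finite.mem_toFinset] at hx
  exact h _ hx.2 hx.1

theorem classSum_eq_cls (d : V → ℕ) {p : FDMod k A → Prop} (hp : IsoInvariant p) (P : FDMod k A)
    (hd : q.dimVec P = d) (hP : p P)
    (h : ∀ X : FDMod k A, q.dimVec X = d → p X → Nonempty (X ≃ₗ[A] P)) :
    q.classSum d p = cls P := by
  classical
  refine ext_coeff fun X => ?_
  rw [q.coeff_classSum d hp, coeff_cls]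
  congr 1
  exact propext ⟨fun ⟨h1, h2⟩ => h X h1 h2,
    fun ⟨e⟩ => ⟨(q.dimVec_congr e).trans hd, hp P X e.symm hP⟩⟩

theorem isoInvariant_true : IsoInvariant (fun _ : FDMod k A => True) := fun _ _ _ h => h

theorem classSum_zero {p : FDMod k A → Prop} (hp : IsoInvariant p) (h : p (FDMod.zero k A)) :
    q.classSum 0 p = 1 := by
  have hs : Subsingleton (FDMod.zero k A) := inferInstanceAs (Subsingleton PUnit)
  refine q.classSum_eq_cls 0 hp (FDMod.zero k A) ((q.subsingleton_iff_dimVec _).mp hs) h ?_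
  intro X hX _
  have := (q.subsingleton_iff_dimVec X).mpr hX
  exact ⟨0⟩

section Semisimple

variable [DecidableEq V] {i : V} {m : ℕ}

theorem e_smul_eq_zero_of_single {X : FDMod k A} (hX : q.dimVec X = Pi.single i m) {j : V}
    (hj : j ≠ i) (y : X) : q.e j • y = 0 :=
  q.dimVec_eq_zero_iff.mp (by rw [hX, Pi.single_eq_of_ne hj]) y

theorem e_smul_eq_self_of_single {X : FDMod k A} (hX : q.dimVec X = Pi.single i m) (y : X) :
    q.e i • y = y := by
  conv_rhs => rw [← q.sum_e_smul y]
  rw [Finset.sum_eq_single i (fun j _ hj => q.e_smul_eq_zero_of_single hX hj y) (by simp)]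

theorem x_smul_eq_zero_of_single {X : FDMod k A} (hX : q.dimVec X = Pi.single i m) (a : E)
    (y : X) : q.x a • y = 0 := by
  by_cases hs : q.s a = i
  · have ht : q.t a ≠ i := fun ht => by
      have := q.rank_lt a
      rw [hs, ht] at this
      exact this.false
    rw [← q.e_tgt_smul, q.e_smul_eq_zero_of_single hX ht]
  · rw [← q.x_smul_src, q.e_smul_eq_zero_of_single hX hs, smul_zero]

theorem finrank_of_single {X : FDMod k A} (hX : q.dimVec X = Pi.single i m) :
    Module.finrank k X = m := by
  rw [← q.sum_dimVec, hX, Finset.sum_pi_single']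
  simp

theorem nonempty_equiv_of_single {X X' : FDMod k A} (hX : q.dimVec X = Pi.single i m)
    (hX' : q.dimVec X' = Pi.single i m) : Nonempty (X ≃ₗ[A] X') := by
  let f := LinearEquiv.ofFinrankEq (R := k) X X'
    ((q.finrank_of_single hX).trans (q.finrank_of_single hX').symm)
  refine ⟨LinearEquiv.ofBijective (q.toLinearMap f.toLinearMap (fun j y => ?_) fun a y => ?_)
    f.bijective⟩
  · by_cases hj : j = i
    · subst hj
      rw [q.e_smul_eq_self_of_single hX, q.e_smul_eq_self_of_single hX']
    · rw [q.e_smul_eq_zero_of_single hX hj, q.e_smul_eq_zero_of_single hX' hj, map_zero]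
  · rw [q.x_smul_eq_zero_of_single hX, q.x_smul_eq_zero_of_single hX', map_zero]

theorem exists_smul_eq_of_single {X : FDMod k A} (hX : q.dimVec X = Pi.single i m) (a : A) :
    ∃ c : k, ∀ y : X, a • y = c • y := by
  have ha : a ∈ Algebra.adjoin k (Set.range q.e ∪ Set.range q.x) := by
    rw [q.adjoin_eq_top]; trivial
  induction ha using Algebra.adjoin_induction with
  | mem y hy =>
    rcases hy with ⟨j, rfl⟩ | ⟨a, rfl⟩
    · by_cases hj : j = i
      · subst hj
        exact ⟨1, fun y => by rw [q.e_smul_eq_self_of_single hX, one_smul]⟩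
      · exact ⟨0, fun y => by rw [q.e_smul_eq_zero_of_single hX hj, zero_smul]⟩
    · exact ⟨0, fun y => by rw [q.x_smul_eq_zero_of_single hX, zero_smul]⟩
  | algebraMap r => exact ⟨r, fun y => algebraMap_smul A r y⟩
  | add y z _ _ hy hz =>
    obtain ⟨c, hc⟩ := hy
    obtain ⟨c', hc'⟩ := hz
    exact ⟨c + c', fun y => by rw [add_smul, add_smul, hc, hc']⟩
  | mul y z _ _ hy hz =>
    obtain ⟨c, hc⟩ := hy
    obtain ⟨c', hc'⟩ := hz
    exact ⟨c * c', fun y => by rw [mul_smul, mul_smul, hc, hc']⟩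

theorem isSimpleModule_of_single {X : FDMod k A} (hX : q.dimVec X = Pi.single i 1) :
    IsSimpleModule A X := by
  have h1 := q.finrank_of_single hX
  have : Nontrivial X := Module.nontrivial_of_finrank_pos (R := k) (by omega)
  refine (isSimpleModule_iff A X).mpr { eq_bot_or_eq_top := fun Y => ?_ }
  by_cases hY : Y = ⊥
  · exact Or.inl hY
  · right
    obtain ⟨y, hy, hy0⟩ := (Submodule.ne_bot_iff Y).mp hY
    rw [eq_top_iff]
    intro z _
    obtain ⟨c, rfl⟩ := (finrank_eq_one_iff_of_nonzero' y hy0).mp h1 z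
    rw [← algebraMap_smul A c y]
    exact Y.smul_mem _ hy

theorem classSum_single_mem (i : V) (m : ℕ) :
    q.classSum (Pi.single i m) (fun _ => True) ∈ compositionAlgebra k A := by
  have hsimple : ∀ X : FDMod k A, q.dimVec X = Pi.single i 1 → cls X ∈ compositionAlgebra k A :=
    fun X hX => Algebra.subset_adjoin ⟨X, q.isSimpleModule_of_single hX, rfl⟩
  induction m with
  | zero =>
    rw [Pi.single_zero, q.classSum_zero isoInvariant_true trivial]
    exact one_mem _
  | succ m ih =>
    refine q.classSum_mem _ fun X _ hX => ?_
    have hmul := Subalgebra.mul_mem _ ih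
      (q.classSum_mem (Pi.single i 1) (p := fun _ => True) fun X _ hX => hsimple X hX)
    have hd : (Pi.single i m + Pi.single i 1 : V → ℕ) = Pi.single i (m + 1) := by
      rw [← Pi.single_add]
    let c : ℚ := coeff X (q.classSum (Pi.single i m) (fun _ => True) *
      q.classSum (Pi.single i 1) (fun _ => True))
    have hprod : q.classSum (Pi.single i m) (fun _ => True) *
        q.classSum (Pi.single i 1) (fun _ => True) = c • cls X := by
      classical
      refine ext_coeff fun Z => ?_
      rw [map_smul, coeff_cls]
      split_ifs with h
      · have : IsoClass.mk Z = IsoClass.mk X := IsoClass.mk_eq_mk.mpr h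
        simp only [c, coeff, this, smul_eq_mul, mul_one]
      · rw [q.coeff_classSum_mul _ _ isoInvariant_true isoInvariant_true, smul_zero,
          Nat.cast_eq_zero, Nat.card_eq_zero]
        refine Or.inl ⟨fun Y => h (q.nonempty_equiv_of_single (i := i) (m := m + 1) ?_ hX)⟩
        rw [q.dimVec_quot_add Z Y.1, Y.2.1.1, Y.2.2.1, hd]
    have hc : c ≠ 0 := by
      simp only [c]
      rw [q.coeff_classSum_mul _ _ isoInvariant_true isoInvariant_true]
      have := finite_submodule X
      refine Nat.cast_ne_zero.mpr (Nat.card_ne_zero.mpr ⟨?_, inferInstance⟩)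
      have : Nontrivial X := Module.nontrivial_of_finrank_pos (R := k) (by
        rw [q.finrank_of_single hX]; omega)
      obtain ⟨y, hy⟩ := exists_ne (0 : X)
      let Y : Submodule A X :=
        { Submodule.span k {y} with
          smul_mem' := fun a z hz => by
            obtain ⟨c, hc⟩ := q.exists_smul_eq_of_single hX a
            rw [hc]
            exact (Submodule.span k {y}).smul_mem c hz }
      have h1 : Module.finrank k (FDMod.ofSub Y) = 1 := finrank_span_singleton (K := k) hy
      have h2 : q.dimVec (FDMod.ofSub Y) = Pi.single i 1 := by
        have h3 : ∀ j, j ≠ i → q.dimVec (FDMod.ofSub Y) j = 0 := fun j hj =>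
          q.dimVec_eq_zero_iff.mpr fun z =>
            Subtype.ext (q.e_smul_eq_zero_of_single hX hj (z : Y).1)
        rw [← q.sum_dimVec, Finset.sum_eq_single i (fun j _ => h3 j) (by simp)] at h1
        funext j
        by_cases hj : j = i
        · subst hj
          rw [h1, Pi.single_eq_same]
        · rw [h3 j hj, Pi.single_eq_of_ne hj]
      refine ⟨⟨Y, ⟨?_, trivial⟩, h2, trivial⟩⟩
      have h4 := q.dimVec_quot_add X Y
      rw [hX, h2, ← hd] at h4
      exact (add_right_cancel h4).symm
    rw [hprod] at hmul
    have := Subalgebra.smul_mem _ hmul c⁻¹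
    rwa [smul_smul, inv_mul_cancel₀ hc, one_smul] at this

end Semisimple

/-- The submodule of the elements killed by `e i`, if no arrow with target `i` acts on `Z`. -/
def kerVertex (Z : FDMod k A) (i : V) (h : ∀ a, q.t a = i → ∀ z : Z, q.x a • z = 0) :
    Submodule A Z where
  carrier := {z | q.e i • z = 0}
  add_mem' := fun {y z} hy hz => by
    change q.e i • (y + z) = 0
    rw [smul_add, hy, hz, add_zero]
  zero_mem' := smul_zero _
  smul_mem' := fun a z hz => by
    have ha : a ∈ Algebra.adjoin k (Set.range q.e ∪ Set.range q.x) := by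
      rw [q.adjoin_eq_top]; trivial
    change q.e i • a • z = 0
    have hz : q.e i • z = 0 := hz
    induction ha using Algebra.adjoin_induction generalizing z with
    | mem y hy =>
      rcases hy with ⟨j, rfl⟩ | ⟨a, rfl⟩
      · by_cases hj : i = j
        · subst hj
          rw [hz, smul_zero]
        · exact q.e_smul_of_ne hj z
      · by_cases ht : q.t a = i
        · rw [h a ht, smul_zero]
        · rw [← q.e_tgt_smul, q.e_smul_of_ne (Ne.symm ht)]
    | algebraMap r => rw [algebraMap_smul, smul_comm, hz, smul_zero]
    | add y y' _ _ hy hy' => rw [add_smul, smul_add, hy z hz hz, hy' z hz hz, add_zero]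
    | mul y y' _ _ hy hy' =>
      rw [mul_smul]
      exact hy _ (hy' z hz hz) (hy' z hz hz)

/-- The sum of all classes of a given dimension vector lies in the composition algebra. -/
theorem classSum_true_mem (d : V → ℕ) :
    q.classSum d (fun _ => True) ∈ compositionAlgebra k A := by
  classical
  induction hn : ∑ i, d i using Nat.strong_induction_on generalizing d with
  | _ n ih =>
    subst hn
    by_cases hd : d = 0
    · subst hd
      rw [q.classSum_zero isoInvariant_true trivial]
      exact one_mem _
    obtain ⟨i₀, hi₀⟩ := Function.ne_iff.mp hd
    obtain ⟨i, hi, hmin⟩ := (Finset.univ.filter fun i => d i ≠ 0).exists_min_image q.rank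
      ⟨i₀, by simpa using hi₀⟩
    have hi : d i ≠ 0 := by simpa using hi
    have hmin : ∀ j, q.rank j < q.rank i → d j = 0 := fun j hj => by
      by_contra h
      exact absurd (hmin j (by simpa using h)) (not_le.mpr hj)
    let d' := Function.update d i 0
    have hdd : Pi.single i (d i) + d' = d := by
      funext j
      by_cases hj : j = i
      · subst hj; simp [d']
      · simp [d', hj]
    have hlt : ∑ j, d' j < ∑ j, d j := by
      conv_rhs => rw [← hdd]
      simp only [Pi.add_apply, Finset.sum_add_distrib, Finset.sum_pi_single', Finset.mem_univ,
        if_true]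
      omega
    have key : q.classSum (Pi.single i (d i)) (fun _ => True) * q.classSum d' (fun _ => True) =
        q.classSum d (fun _ => True) := by
      refine ext_coeff fun Z => ?_
      rw [q.coeff_classSum_mul _ _ isoInvariant_true isoInvariant_true,
        q.coeff_classSum _ isoInvariant_true]
      split_ifs with hZ
      · have hZ := hZ.1
        have hx : ∀ a, q.t a = i → ∀ z : Z, q.x a • z = 0 := fun a ha z => by
          have h0 : q.dimVec Z (q.s a) = 0 := by
            rw [hZ]
            exact hmin _ (ha ▸ q.rank_lt a)
          rw [← q.x_smul_src, q.dimVec_eq_zero_iff.mp h0, smul_zero]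
        let Y := q.kerVertex Z i hx
        have h1 : q.dimVec (FDMod.ofSub Y) i = 0 :=
          q.dimVec_eq_zero_iff.mpr fun z => Subtype.ext (z : Y).2
        have h2 : ∀ j, j ≠ i → q.dimVec (FDMod.quot Y) j = 0 := fun j hj => by
          refine q.dimVec_eq_zero_iff.mpr fun z => ?_
          obtain ⟨z, rfl⟩ := Y.mkQ_surjective z
          exact (Submodule.Quotient.mk_eq_zero Y).mpr (q.e_smul_of_ne hj.symm z)
        have h3 := q.dimVec_quot_add Z Y
        have hq : q.dimVec (FDMod.quot Y) = Pi.single i (d i) := by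
          funext j
          by_cases hj : j = i
          · subst hj
            have := congrFun h3 j
            rw [Pi.add_apply, h1, hZ, add_zero] at this
            rw [← this, Pi.single_eq_same]
          · rw [h2 j hj, Pi.single_eq_of_ne hj]
        have hs : q.dimVec (FDMod.ofSub Y) = d' := by
          rw [hZ, hq] at h3
          exact (add_left_cancel (hdd.trans h3)).symm
        rw [Nat.cast_eq_one, Nat.card_eq_one_iff_unique]
        refine ⟨⟨fun Y₁ Y₂ => ?_⟩, ⟨⟨Y, ⟨hq, trivial⟩, hs, trivial⟩⟩⟩
        have huniq : ∀ Y' : Submodule A Z, q.dimVec (FDMod.ofSub Y') = d' → Y' = Y := by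
          intro Y' hY'
          have hle : Y' ≤ Y := fun z hz => by
            have h0 : q.dimVec (FDMod.ofSub Y') i = 0 := by
              rw [hY']
              exact Function.update_self ..
            exact congrArg Subtype.val (q.dimVec_eq_zero_iff.mp h0 (⟨z, hz⟩ : Y'))
          have hfin : Module.finrank k (FDMod.ofSub Y') = Module.finrank k (FDMod.ofSub Y) := by
            rw [← q.sum_dimVec, ← q.sum_dimVec, hY', hs]
          have := Submodule.eq_of_le_of_finrank_eq
            (S₁ := Y'.restrictScalars k) (S₂ := Y.restrictScalars k) hle hfin
          exact Submodule.restrictScalars_injective k A Z this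
        exact Subtype.ext ((huniq _ Y₁.2.2.1).trans (huniq _ Y₂.2.2.1).symm)
      · rw [Nat.cast_eq_zero, Nat.card_eq_zero]
        refine Or.inl ⟨fun Y => hZ ⟨?_, trivial⟩⟩
        rw [q.dimVec_quot_add Z Y.1, Y.2.1.1, Y.2.2.1, hdd]
    rw [← key]
    exact Subalgebra.mul_mem _ (q.classSum_single_mem i _) (ih _ hlt _ rfl)

/-! ### Preprojective modules in the composition algebra -/

theorem cls_prod_mem {C : Subalgebra ℚ (HallAlgebra k A)} {P M : FDMod k A}
    (h : q.ExtVanish P M) (hP : cls P ∈ C) (hM : cls M ∈ C) : cls (P.prod M) ∈ C := by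
  classical
  let c : ℚ := FDMod.hallNumber P M (P.prod M)
  have hprod : cls P * cls M = c • cls (P.prod M) := by
    refine ext_coeff fun X => ?_
    rw [coeff_cls_mul_cls, map_smul, coeff_cls]
    split_ifs with hX
    · rw [smul_eq_mul, mul_one, FDMod.hallNumber_congr ⟨LinearEquiv.refl A P⟩
        ⟨LinearEquiv.refl A M⟩ hX]
    · rw [smul_zero, Nat.cast_eq_zero, FDMod.hallNumber, Nat.card_eq_zero]
      refine Or.inl ⟨fun ⟨Y, ⟨e₁⟩, ⟨e₂⟩⟩ => hX ?_⟩
      have hι : Function.Injective (Y.subtype ∘ₗ e₂.symm.toLinearMap) :=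
        Subtype.val_injective.comp e₂.symm.injective
      have hπ : Function.Surjective (e₁.toLinearMap ∘ₗ Y.mkQ) :=
        e₁.surjective.comp Y.mkQ_surjective
      have hex : Function.Exact (Y.subtype ∘ₗ e₂.symm.toLinearMap) (e₁.toLinearMap ∘ₗ Y.mkQ) := by
        intro x
        simp only [LinearMap.comp_apply, LinearEquiv.coe_coe, LinearEquiv.map_eq_zero_iff,
          Submodule.mkQ_apply, Submodule.Quotient.mk_eq_zero]
        exact ⟨fun hx => ⟨e₂ ⟨x, hx⟩, by simp⟩, by rintro ⟨m, rfl⟩; exact (e₂.symm m).2⟩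
      obtain ⟨σ, hσ⟩ := h.exists_section hι hex hπ
      have hσ' : ∀ y, e₁ (Y.mkQ (σ y)) = y := fun y => LinearMap.congr_fun hσ y
      let F : P × M →ₗ[A] X := σ.coprod (Y.subtype ∘ₗ e₂.symm.toLinearMap)
      refine ⟨(LinearEquiv.ofBijective F ⟨?_, ?_⟩).symm⟩
      · rw [injective_iff_map_eq_zero]
        rintro ⟨y, m⟩ hym
        have h0 : σ y + (Y.subtype ∘ₗ e₂.symm.toLinearMap) m = 0 := by simpa [F] using hym
        have h1 := congrArg (e₁.toLinearMap ∘ₗ Y.mkQ) h0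
        rw [map_add, (hex _).mpr ⟨m, rfl⟩, map_zero, add_zero] at h1
        have hy : y = 0 := (hσ' y).symm.trans h1
        rw [hy, map_zero, zero_add] at h0
        rw [hy, hι (h0.trans (map_zero _).symm)]
        rfl
      · intro x
        obtain ⟨m, hm⟩ := (hex (x - σ (e₁ (Y.mkQ x)))).mp (by
          simp only [map_sub, LinearMap.comp_apply, LinearEquiv.coe_coe, hσ', sub_self])
        exact ⟨(e₁ (Y.mkQ x), m), by simp [F, hm]⟩
  have hc : c ≠ 0 := by
    have := finite_submodule (P.prod M)
    refine Nat.cast_ne_zero.mpr (Nat.card_ne_zero.mpr ⟨?_, inferInstance⟩)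
    let f : P × M →ₗ[A] P := LinearMap.fst A P M
    refine ⟨⟨LinearMap.ker f, ⟨f.quotKerEquivOfSurjective LinearMap.fst_surjective⟩, ⟨?_⟩⟩⟩
    exact (LinearEquiv.ofEq _ _ (LinearMap.range_inr A P M).symm).trans
      (LinearEquiv.ofInjective (LinearMap.inr A P M) LinearMap.inr_injective).symm
  have := Subalgebra.smul_mem _ (Subalgebra.mul_mem _ hP hM) c⁻¹
  rwa [hprod, smul_smul, inv_mul_cancel₀ hc, one_smul] at this

theorem cls_sumOf_mem (q : QuiverPresentation k A V E) {C : Subalgebra ℚ (HallAlgebra k A)}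
    {p : FDMod k A → Prop}
    (hp : ∀ P, p P → ∃ κ, FDMod.IsMinKey κ P) (hC : ∀ P, p P → cls P ∈ C) {F : FDMod k A}
    (hF : FDMod.SumOf p F) : cls F ∈ C := by
  induction hd : Module.finrank k F using Nat.strong_induction_on generalizing F with
  | _ d ih =>
    subst hd
    rcases subsingleton_or_nontrivial F with hs | hs
    · rw [one_eq_cls hs]
      exact one_mem _
    obtain ⟨P, F', κ, hP, hκ, hF', hfree, ⟨e⟩⟩ := hF.exists_min hp hs
    have := hκ.1.isIndecomposable.1
    have hlt : Module.finrank k F' < Module.finrank k F := by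
      have h1 : 0 < Module.finrank k P := Module.finrank_pos
      rw [(e.restrictScalars k).finrank_eq, Module.finrank_prod]
      omega
    rw [cls_congr (N := P.prod F') e]
    exact q.cls_prod_mem (hκ.1.extVanish q hfree) (hC P hP) (ih _ hlt hF' rfl)

theorem hom_eq_zero_of_keyFree {κ : ℕ ×ₗ ℕ} {T F : FDMod k A} (hT : FDMod.KeyFree κ T)
    (hF : FDMod.SumOf (fun P => ∃ κ' < κ, FDMod.IsMinKey κ' P) F) (f : T →ₗ[A] F) : f = 0 := by
  induction hF with
  | zero M h => exact LinearMap.ext fun x => Subsingleton.elim _ _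
  | cons P M X hP hM e ih =>
    obtain ⟨κ', hκ', hP⟩ := hP
    have h1 := hT κ' hκ' P hP.1 (LinearMap.fst A P M ∘ₗ e.toLinearMap ∘ₗ f)
    have h2 := ih (LinearMap.snd A P M ∘ₗ e.toLinearMap ∘ₗ f)
    refine LinearMap.ext fun x => e.injective ?_
    rw [LinearMap.zero_apply, map_zero]
    exact Prod.ext (LinearMap.congr_fun h1 x) (LinearMap.congr_fun h2 x)

/-- The identity in the Hall algebra expressing that every module has a unique torsion submodule. -/
theorem sum_classSum_mul_classSum [DecidableEq V] (κ : ℕ ×ₗ ℕ) (d : V → ℕ) :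
    ∑ d' ∈ Finset.Iic d, q.classSum d' (FDMod.SumOf fun P => ∃ κ' < κ, FDMod.IsMinKey κ' P) *
      q.classSum (d - d') (FDMod.KeyFree κ) = q.classSum d (fun _ => True) := by
  classical
  have hpF : IsoInvariant (FDMod.SumOf fun P : FDMod k A => ∃ κ' < κ, FDMod.IsMinKey κ' P) :=
    fun M N e h => h.congr e.symm
  have hpT : IsoInvariant (FDMod.KeyFree (k := k) (A := A) κ) := fun M N e h => h.congr e
  refine ext_coeff fun Z => ?_
  obtain ⟨F, T, hF, hT, ⟨e⟩⟩ := FDMod.exists_sumOf_prod_keyFree q κ Z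
  obtain ⟨Y, hYF, hYT⟩ : ∃ Y : Submodule A Z, FDMod.SumOf (fun P => ∃ κ' < κ, FDMod.IsMinKey κ' P)
      (FDMod.quot Y) ∧ FDMod.KeyFree κ (FDMod.ofSub Y) := by
    let f : Z →ₗ[A] F := LinearMap.fst A F T ∘ₗ e.toLinearMap
    have hf : Function.Surjective f :=
      (LinearMap.fst_surjective (R := A)).comp e.surjective
    let g : T →ₗ[A] Z := e.symm.toLinearMap ∘ₗ LinearMap.inr A F T
    have hg : Function.Injective g :=
      e.symm.injective.comp (LinearMap.inr_injective (R := A))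
    have hr : LinearMap.range g = LinearMap.ker f := by
      ext z
      constructor
      · rintro ⟨t, rfl⟩
        simp [f, g]
      · intro hz
        refine ⟨(e z).2, e.injective ?_⟩
        have hz : (e z).1 = 0 := hz
        simp only [g, LinearMap.comp_apply, LinearEquiv.coe_coe, LinearEquiv.apply_symm_apply]
        exact Prod.ext hz.symm rfl
    refine ⟨LinearMap.ker f, hF.congr (f.quotKerEquivOfSurjective hf),
      hpT T _ ((LinearEquiv.ofInjective g hg).trans (LinearEquiv.ofEq _ _ hr)) hT⟩
  have huniq : ∀ Y' : Submodule A Z, FDMod.SumOf (fun P => ∃ κ' < κ, FDMod.IsMinKey κ' P)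
      (FDMod.quot Y') → FDMod.KeyFree κ (FDMod.ofSub Y') → Y' = Y := by
    have hle : ∀ Y₁ Y₂ : Submodule A Z, FDMod.SumOf (fun P => ∃ κ' < κ, FDMod.IsMinKey κ' P)
        (FDMod.quot Y₁) → FDMod.KeyFree κ (FDMod.ofSub Y₂) → Y₂ ≤ Y₁ := by
      intro Y₁ Y₂ h1 h2 z hz
      have h3 := hom_eq_zero_of_keyFree h2 h1 (Y₁.mkQ ∘ₗ Y₂.subtype)
      exact (Submodule.Quotient.mk_eq_zero Y₁).mp (LinearMap.congr_fun h3 ⟨z, hz⟩)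
    exact fun Y' h1 h2 => le_antisymm (hle Y Y' hYF h2) (hle Y' Y h1 hYT)
  have hterm : ∀ d' d'' : V → ℕ, coeff Z
      (q.classSum d' (FDMod.SumOf fun P => ∃ κ' < κ, FDMod.IsMinKey κ' P) *
        q.classSum d'' (FDMod.KeyFree κ)) =
      if q.dimVec (FDMod.quot Y) = d' ∧ q.dimVec (FDMod.ofSub Y) = d'' then 1 else 0 := by
    intro d' d''
    rw [q.coeff_classSum_mul _ _ hpF hpT]
    split_ifs with h
    · rw [Nat.cast_eq_one, Nat.card_eq_one_iff_unique]
      exact ⟨⟨fun Y₁ Y₂ => Subtype.ext ((huniq _ Y₁.2.1.2 Y₁.2.2.2).trans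
        (huniq _ Y₂.2.1.2 Y₂.2.2.2).symm)⟩, ⟨⟨Y, ⟨h.1, hYF⟩, h.2, hYT⟩⟩⟩
    · rw [Nat.cast_eq_zero, Nat.card_eq_zero]
      refine Or.inl ⟨fun Y' => h ?_⟩
      obtain rfl := huniq _ Y'.2.1.2 Y'.2.2.2
      exact ⟨Y'.2.1.1, Y'.2.2.1⟩
  have hZ := q.dimVec_quot_add Z Y
  rw [map_sum, q.coeff_classSum _ isoInvariant_true]
  simp only [hterm, and_true]
  split_ifs with h
  · rw [Finset.sum_eq_single (q.dimVec (FDMod.quot Y)), if_pos]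
    · refine ⟨rfl, ?_⟩
      rw [← h, hZ, add_tsub_cancel_left]
    · exact fun d' _ hd' => if_neg fun h' => hd' h'.1.symm
    · refine fun hn => absurd (Finset.mem_Iic.mpr ?_) hn
      rw [← h, hZ]
      exact le_self_add
  · refine Finset.sum_eq_zero fun d' hd' => if_neg fun h' => h ?_
    rw [hZ, h'.1, h'.2]
    exact add_tsub_cancel_of_le (Finset.mem_Iic.mp hd')

theorem classSum_keyFree_mem (κ : ℕ ×ₗ ℕ)
    (h : ∀ κ' < κ, ∀ P : FDMod k A, FDMod.HasKey κ' P → cls P ∈ compositionAlgebra k A)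
    (d : V → ℕ) : q.classSum d (FDMod.KeyFree κ) ∈ compositionAlgebra k A := by
  classical
  have hF : ∀ d, q.classSum d (FDMod.SumOf fun P => ∃ κ' < κ, FDMod.IsMinKey κ' P) ∈
      compositionAlgebra k A := fun d => q.classSum_mem d fun X hX _ =>
    q.cls_sumOf_mem (fun P ⟨κ', _, hP⟩ => ⟨κ', hP⟩) (fun P ⟨κ', hκ', hP⟩ => h κ' hκ' P hP.1) hX
  induction hn : ∑ i, d i using Nat.strong_induction_on generalizing d with
  | _ n ih =>
    subst hn
    have h1 := q.sum_classSum_mul_classSum κ d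
    rw [← Finset.add_sum_erase _ _ (Finset.mem_Iic.mpr zero_le), q.classSum_zero
      (fun M N e h => h.congr e.symm) (.zero _ (inferInstanceAs (Subsingleton PUnit))), one_mul,
      tsub_zero] at h1
    rw [eq_sub_of_add_eq h1]
    refine Subalgebra.sub_mem _ (q.classSum_true_mem d) (Subalgebra.sum_mem _ fun d' hd' => ?_)
    obtain ⟨h0, hle⟩ := Finset.mem_erase.mp hd'
    refine Subalgebra.mul_mem _ (hF d') (ih _ ?_ _ rfl)
    have hle := Finset.mem_Iic.mp hle
    obtain ⟨i, hi⟩ := Function.ne_iff.mp h0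
    refine Finset.sum_lt_sum (fun j _ => Nat.sub_le _ _) ⟨i, Finset.mem_univ _, ?_⟩
    have hi' : d' i ≠ 0 := hi
    have hle' : d' i ≤ d i := hle i
    change d i - d' i < d i
    omega

theorem cls_hasKey_mem [Finite E] (q : QuiverPresentation k A V E) {κ : ℕ ×ₗ ℕ} {P : FDMod k A}
    (hP : FDMod.HasKey κ P) : cls P ∈ compositionAlgebra k A := by
  induction κ using WellFoundedLT.induction generalizing P with
  | _ κ ih =>
    by_cases hlow : ∃ κ' < κ, FDMod.HasKey κ' P
    · obtain ⟨κ', hκ', h⟩ := hlow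
      exact ih κ' hκ' h
    push Not at hlow
    have hfree : FDMod.KeyFree κ P := hP.isIndecomposable.keyFree q hlow
    rw [← q.classSum_eq_cls (q.dimVec P) (fun M N e h => FDMod.KeyFree.congr h e) P rfl hfree]
    · exact q.classSum_keyFree_mem κ (fun κ' h P hP => ih κ' h hP) _
    intro X hd hX
    have := Fintype.ofFinite E
    have := hP.isIndecomposable.1
    have hne : ∃ f : X →ₗ[A] P, f ≠ 0 := by
      by_contra h0
      push Not at h0
      have h1 := q.euler_nonpos h0
      rw [hd] at h1
      exact absurd (q.euler_pos (hP.extVanish q hfree)) (not_lt.mpr h1)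
    obtain ⟨Y, Z, hY, ⟨f, hf⟩, ⟨e⟩⟩ := FDMod.exists_summand_of_hom_ne_zero hne
    rcases hP.of_hom_ne_zero q hY hf with ⟨κ', hκ', hYκ⟩ | hb
    · have h0 := hX κ' hκ' Y hYκ (LinearMap.fst A Y Z ∘ₗ e.toLinearMap)
      have := hY.1
      obtain ⟨y, hy⟩ := exists_ne (0 : Y)
      refine absurd ?_ hy
      simpa using LinearMap.congr_fun h0 (e.symm (y, 0))
    · let e' := LinearEquiv.ofBijective f hb
      have h1 := q.dimVec_congr (N := Y.prod Z) e
      rw [hd, q.dimVec_prod, ← q.dimVec_congr e'.symm] at h1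
      have hZ : Subsingleton Z := (q.subsingleton_iff_dimVec Z).mpr
        (by simpa using h1)
      exact ⟨(e.trans ((LinearEquiv.prodComm A Y Z).trans (FDMod.prodSubsingleton Z Y))).trans e'⟩

theorem cls_preprojective_mem [Finite E] (q : QuiverPresentation k A V E) {M : FDMod k A}
    (hM : M.IsPreprojective) : cls M ∈ compositionAlgebra k A := by
  obtain ⟨n, N, hN, ⟨e⟩⟩ := hM
  have h : ∀ i, ∃ κ, FDMod.IsMinKey κ (N i) := fun i => by
    obtain ⟨κ, hκ⟩ := (hN i).exists_hasKey
    obtain ⟨κ', _, h⟩ := hκ.exists_isMinKey q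
    exact ⟨κ', h⟩
  exact q.cls_sumOf_mem (p := fun P => ∃ κ, FDMod.IsMinKey κ P) (fun P h => h)
    (fun P ⟨κ, h⟩ => q.cls_hasKey_mem h.1) (FDMod.sumOf_of_equiv_pi h e)

theorem preprojectiveSubalgebra_le [Finite E] (q : QuiverPresentation k A V E) :
    preprojectiveSubalgebra k A ≤ compositionAlgebra k A := by
  refine Algebra.adjoin_le ?_
  rintro _ ⟨M, hM, rfl⟩
  exact q.cls_preprojective_mem hM

end QuiverPresentation

/-! ### Duality and submodules -/

namespace DualPair

variable {k : Type*} [Field k] {A B : Type*} [Ring A] [Algebra k A] [Ring B] [Algebra k B]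
  {σ : A ≃ B}
  {M N : Type*} [AddCommGroup M] [Module A M] [Module k M] [IsScalarTower k A M]
  [AddCommGroup N] [Module B N] [Module k N] [IsScalarTower k B N]
  {M' N' : Type*} [AddCommGroup M'] [Module A M'] [Module k M'] [IsScalarTower k A M']
  [AddCommGroup N'] [Module B N'] [Module k N'] [IsScalarTower k B N']

theorem nonempty_equiv (D : DualPair k σ M N) (D' : DualPair k σ M' N')
    (h : Nonempty (M ≃ₗ[A] M')) : Nonempty (N ≃ₗ[B] N') := by
  obtain ⟨e⟩ := h
  refine ⟨LinearEquiv.ofLinearMap (D'.transpose D e.symm.toLinearMap) (D.transpose D' e.toLinearMap)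
    ?_ ?_⟩
  · rw [← transpose_comp, ← D'.transpose_id]
    exact congrArg _ (LinearMap.ext fun x => e.apply_symm_apply x)
  · rw [← transpose_comp, ← D.transpose_id]
    exact congrArg _ (LinearMap.ext fun x => e.symm_apply_apply x)

theorem nonempty_equiv_iff (D : DualPair k σ M N) (D₁ : DualPair k σ M' N') :
    Nonempty (M ≃ₗ[A] M') ↔ Nonempty (N ≃ₗ[B] N') :=
  ⟨D.nonempty_equiv D₁, D.symm.nonempty_equiv D₁.symm⟩

/-- The annihilator of a submodule. -/
def ann (D : DualPair k σ M N) (Y : Submodule A M) : Submodule B N where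
  carrier := {n | ∀ y ∈ Y, D.pair y n = 0}
  add_mem' := fun {n n'} hn hn' y hy => by rw [map_add, hn y hy, hn' y hy, add_zero]
  zero_mem' := fun y _ => map_zero _
  smul_mem' := fun b n hn y hy => by
    obtain ⟨a, rfl⟩ := σ.surjective b
    rw [← D.smul]
    exact hn _ (Y.smul_mem a hy)

theorem ann_ann (D : DualPair k σ M N) (Y : Submodule A M) : D.symm.ann (D.ann Y) = Y := by
  refine le_antisymm (fun m hm => ?_) fun m hm n hn => hn m hm
  by_contra hmY
  obtain ⟨g, hg, hgY⟩ := Submodule.exists_le_ker_of_notMem (p := Y.restrictScalars k) (v := m) hmY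
  obtain ⟨n, hn⟩ := D.exists_right g
  refine hg ?_
  rw [← hn]
  exact hm n fun y hy => (hn y).trans (hgY hy)

/-- Passage to the annihilator, as a bijection. -/
def annEquiv (D : DualPair k σ M N) : Submodule A M ≃ Submodule B N where
  toFun := D.ann
  invFun := D.symm.ann
  left_inv := D.ann_ann
  right_inv := D.symm.ann_ann

theorem ann_bot (D : DualPair k σ M N) : D.ann ⊥ = ⊤ :=
  eq_top_iff.mpr fun n _ y hy => by
    rw [(Submodule.mem_bot A).mp hy, map_zero, LinearMap.zero_apply]

theorem ann_top (D : DualPair k σ M N) : D.ann ⊤ = ⊥ :=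
  eq_bot_iff.mpr fun n hn => (Submodule.mem_bot B).mpr (D.ext_right fun m => by
    rw [map_zero]
    exact hn m trivial)

theorem isSimpleModule (D : DualPair k σ M N) [IsSimpleModule A M] : IsSimpleModule B N := by
  have : Nontrivial M := IsSimpleModule.nontrivial A M
  have := D.nontrivial_right
  refine (isSimpleModule_iff B N).mpr { eq_bot_or_eq_top := fun W => ?_ }
  rw [← D.symm.ann_ann W]
  rcases eq_bot_or_eq_top (D.symm.ann W) with h | h
  · exact Or.inr ((congrArg D.ann h).trans D.ann_bot)
  · exact Or.inl ((congrArg D.ann h).trans D.ann_top)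

/-- Replace the left module of a dual pair by an isomorphic one. -/
def congrLeft (D : DualPair k σ M N) (e : M' ≃ₗ[A] M) : DualPair k σ M' N where
  pair := D.pair ∘ₗ (e.restrictScalars k).toLinearMap
  perf := by
    have := D.perf
    exact LinearMap.IsPerfPair.compl₁₂ D.pair (e.restrictScalars k) (LinearEquiv.refl k N)
  smul a m n := by
    change D.pair (e (a • m)) n = D.pair (e m) (σ a • n)
    rw [map_smul e, D.smul]

/-- A quotient is dual to the annihilator. -/
def quotient [Module.Finite k M] (D : DualPair k σ M N) (Y : Submodule A M) :
    DualPair k σ (M ⧸ Y) (D.ann Y) where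
  pair := ((Y.restrictScalars k).liftQ
      ((((D.ann Y).restrictScalars k).subtype).lcomp k k ∘ₗ D.pair) fun y hy =>
        LinearMap.ext fun n => n.2 y hy) ∘ₗ
    (Submodule.Quotient.restrictScalarsEquiv k Y).symm.toLinearMap
  perf := by
    have : Module.Finite k (M ⧸ Y) := Module.Finite.of_surjective
      (Y.mkQ.restrictScalars k) Y.mkQ_surjective
    refine LinearMap.IsPerfPair.of_injective ?_ ?_
    · rw [injective_iff_map_eq_zero]
      intro z hz
      obtain ⟨m, rfl⟩ := Y.mkQ_surjective z
      refine (Submodule.Quotient.mk_eq_zero Y).mpr ?_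
      rw [← D.ann_ann Y]
      exact fun n hn => LinearMap.congr_fun hz ⟨n, hn⟩
    · rw [injective_iff_map_eq_zero]
      intro n hn
      refine Subtype.ext (D.ext_right fun m => ?_)
      rw [ZeroMemClass.coe_zero, map_zero]
      exact LinearMap.congr_fun hn (Y.mkQ m)
  smul a z n := by
    obtain ⟨m, rfl⟩ := Y.mkQ_surjective z
    exact D.smul a m n

/-- A submodule is dual to the quotient by its annihilator. -/
def sub [Module.Finite k N] (D : DualPair k σ M N) (Y : Submodule A M) :
    DualPair k σ Y (N ⧸ D.ann Y) :=
  (D.symm.quotient (D.ann Y)).symm.congrLeft (LinearEquiv.ofEq _ _ (D.ann_ann Y).symm)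

end DualPair

namespace FDMod

variable {k : Type v} [Field k] {A : Type u} [Ring A] [Algebra k A]

/-- Every finite-dimensional left module is the dual of a right module. -/
theorem exists_dualPair_op (M : FDMod k A) :
    ∃ N : FDMod k Aᵐᵒᵖ, Nonempty (DualPair k (opEquiv (α := A)) M N) := by
  let F : Aᵐᵒᵖ →ₐ[k] Module.End k (Module.Dual k M) :=
    { toFun := fun a => (Algebra.lsmul k k M (unop a)).dualMap
      map_one' := by ext; simp
      map_mul' := fun a b => by ext; simp
      map_zero' := by ext; simp
      map_add' := fun a b => by ext; simp
      commutes' := fun c => by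
        ext g n
        simp }
  obtain ⟨N, c, hc⟩ := FDMod.exists_of_algHom F
    (LinearEquiv.ofFinrankEq M (Module.Dual k M) (Subspace.dual_finrank_eq).symm)
  refine ⟨N, ⟨c.toLinearMap.flip, LinearMap.IsPerfPair.flip inferInstance, fun a m n => ?_⟩⟩
  rw [LinearMap.flip_apply, LinearMap.flip_apply, LinearEquiv.coe_coe, hc]
  rfl

theorem IsIndecomposable.dual {M : FDMod k A} {N : FDMod k Aᵐᵒᵖ} (hM : M.IsIndecomposable)
    (D : DualPair k (opEquiv (α := A)) M N) : N.IsIndecomposable := by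
  have := hM.1
  have := D.nontrivial_right
  refine isIndecomposable_of_idempotent fun f hf => ?_
  have hg : D.symm.transpose D.symm f ∘ₗ D.symm.transpose D.symm f =
      D.symm.transpose D.symm f := by
    rw [← DualPair.transpose_comp, hf]
  rcases hM.idempotent hg with h | h
  · refine Or.inl (D.symm.transpose_injective D.symm ?_)
    rw [DualPair.transpose_zero]
    exact h
  · refine Or.inr (D.symm.transpose_injective D.symm ?_)
    rw [DualPair.transpose_id]
    exact h

theorem hallNumber_dual {M₁ M₂ X : FDMod k A} {N₁ N₂ Z : FDMod k Aᵐᵒᵖ}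
    (D₁ : DualPair k (opEquiv (α := A)) M₁ N₁) (D₂ : DualPair k (opEquiv (α := A)) M₂ N₂)
    (D : DualPair k (opEquiv (α := A)) X Z) :
    hallNumber N₂ N₁ Z = hallNumber M₁ M₂ X := by
  refine (Nat.card_congr (Equiv.subtypeEquiv D.annEquiv fun Y => ?_)).symm
  have h1 := (D.quotient Y).nonempty_equiv_iff D₁
  have h2 := (D.sub Y).nonempty_equiv_iff D₂
  exact (and_congr h1 h2).trans and_comm

/-! ### Duality and the Auslander-Reiten translate -/

/-- The dual of a finite-dimensional injective module is projective. -/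
theorem projective_dual [Module.Finite k A] {M : FDMod k A} {N : FDMod k Aᵐᵒᵖ}
    [Module.Injective A M]
    (D : DualPair k (opEquiv (α := A)) M N) : Module.Projective Aᵐᵒᵖ N := by
  have := Module.Finite.of_restrictScalars_finite k Aᵐᵒᵖ N
  have : Module.Finite k Aᵐᵒᵖ := Module.Finite.equiv (opLinearEquiv k)
  obtain ⟨n, f, hf⟩ := Module.Finite.exists_fin' Aᵐᵒᵖ N
  obtain ⟨X, ⟨D'⟩⟩ := FDMod.exists_dualPair (k := k) (A := A) (Fin n → Aᵐᵒᵖ)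
  let ι : M →ₗ[A] X := D'.symm.transpose D.symm f
  have hι : Function.Injective ι := fun m m' h => D.ext_left fun y => by
    obtain ⟨x, rfl⟩ := hf y
    have h1 := fun m => D'.symm.pair_transpose D.symm f x m
    exact (h1 m).symm.trans ((congrArg (fun z => D'.symm.pair x z) h).trans (h1 m'))
  obtain ⟨r, hr⟩ := Module.Injective.out ι hι LinearMap.id
  refine Module.Projective.of_split (D'.transpose D r) f ?_
  have hf' : D.transpose D' ι = f := D'.symm.transpose_symm_transpose D.symm f
  rw [← hf', ← DualPair.transpose_comp, ← D.transpose_id]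
  exact congrArg _ (LinearMap.ext hr)

section Transpose

variable [Module.Finite k A]

/-- The right module `Hom_A(P, A)`. -/
def homMod (P : FDMod k A) : FDMod k Aᵐᵒᵖ where
  carrier := P →ₗ[A] A

theorem projective_homMod (P : FDMod k A) [Module.Projective A P] :
    Module.Projective Aᵐᵒᵖ (homMod P) := by
  have := Module.Finite.of_restrictScalars_finite k A P
  obtain ⟨n, r, g, hg⟩ := Module.Projective.exists_dualBasis A P
  let i : (P →ₗ[A] A) →ₗ[Aᵐᵒᵖ] (Fin n → Aᵐᵒᵖ) :=
    { toFun := fun h j => op (h (r j))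
      map_add' := fun _ _ => rfl
      map_smul' := fun _ _ => rfl }
  let s : (Fin n → Aᵐᵒᵖ) →ₗ[Aᵐᵒᵖ] (P →ₗ[A] A) := Fintype.linearCombination Aᵐᵒᵖ g
  refine Module.Projective.of_split (M := Fin n → Aᵐᵒᵖ) i s
    (LinearMap.ext fun h : P →ₗ[A] A => ?_)
  refine LinearMap.ext fun x => ?_
  change s (i h) x = h x
  conv_rhs => rw [← hg x]
  simp [s, i, Fintype.linearCombination_apply]

/-- The evaluation map from a module to its bidual. -/
def evalHom (P : FDMod k A) : P →ₗ[k] (homMod P →ₗ[Aᵐᵒᵖ] Aᵐᵒᵖ) where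
  toFun x :=
    { toFun := fun g : P →ₗ[A] A => op (g x)
      map_add' := fun _ _ => rfl
      map_smul' := fun _ _ => rfl }
  map_add' x y := LinearMap.ext fun g : P →ₗ[A] A => congrArg op (g.map_add x y)
  map_smul' c x := LinearMap.ext fun g : P →ₗ[A] A =>
    congrArg op (g.map_algebra_smul c x)

theorem evalHom_smul (P : FDMod k A) (a : A) (x : P) :
    evalHom P (a • x) = op (op a) • evalHom P x :=
  LinearMap.ext fun g : P →ₗ[A] A => congrArg op (g.map_smul a x)

theorem evalHom_bijective (P : FDMod k A) [Module.Projective A P] :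
    Function.Bijective (evalHom P) := by
  have := Module.Finite.of_restrictScalars_finite k A P
  obtain ⟨n, r, g, hg⟩ := Module.Projective.exists_dualBasis A P
  constructor
  · rw [injective_iff_map_eq_zero]
    intro x hx
    rw [← hg x]
    refine Finset.sum_eq_zero fun i _ => ?_
    have : op (g i x) = 0 := LinearMap.congr_fun hx (g i)
    rw [op_eq_zero_iff _ |>.mp this, zero_smul]
  · intro θ
    let θ' : (P →ₗ[A] A) →ₗ[Aᵐᵒᵖ] Aᵐᵒᵖ := θ
    refine ⟨∑ i, unop (θ' (g i)) • r i, ?_⟩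
    refine LinearMap.ext fun h => ?_
    let h' : P →ₗ[A] A := h
    change op (h' (∑ i, unop (θ' (g i)) • r i)) = θ' h'
    have h1 : h' = ∑ i, op (h' (r i)) • g i := LinearMap.ext fun x => by
      conv_lhs => rw [← hg x]
      simp
    conv_rhs => rw [h1]
    simp

/-- If `L = τ M` then, for the dual modules over the opposite algebra, `D M = τ (D L)`. -/
theorem isARTranslate_dual {L M : FDMod k A} {N N' : FDMod k Aᵐᵒᵖ} (R : M.Resolution)
    (hM : ∀ f : M →ₗ[A] A, f = 0) (D : DualPair k (opEquiv (α := A)) L (ExtOne R.f))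
    (DL : DualPair k (opEquiv (α := A)) L N) (DM : DualPair k (opEquiv (α := A)) M N') :
    IsARTranslate N' N := by
  obtain ⟨e⟩ := D.nonempty_equiv DL ⟨LinearEquiv.refl A L⟩
  let f' : homMod R.P₀ →ₗ[Aᵐᵒᵖ] homMod R.P₁ := homDual R.f
  have hinj : Function.Injective f' := by
    rw [injective_iff_map_eq_zero]
    intro g hg
    let g' : R.P₀ →ₗ[A] A := g
    obtain ⟨l, hl⟩ := R.exists_desc g' fun x => LinearMap.congr_fun hg x
    refine LinearMap.ext fun x => ?_
    change g' x = 0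
    rw [← hl, hM l, LinearMap.zero_apply]
  let ev₀ := LinearEquiv.ofBijective (evalHom R.P₀) (evalHom_bijective R.P₀)
  let ev₁ := LinearEquiv.ofBijective (evalHom R.P₁) (evalHom_bijective R.P₁)
  have hev : ∀ x : R.P₁, homDual f' (evalHom R.P₁ x) = evalHom R.P₀ (R.f x) := fun x => rfl
  let θ₀ : (homMod R.P₀ →ₗ[Aᵐᵒᵖ] Aᵐᵒᵖ) →ₗ[k] M :=
    R.p.restrictScalars k ∘ₗ ev₀.symm.toLinearMap
  have hθ₀ : ∀ x, θ₀ (evalHom R.P₀ x) = R.p x := fun x =>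
    congrArg R.p (ev₀.symm_apply_apply x)
  have hsurj : Function.Surjective θ₀ := R.surj.comp ev₀.symm.surjective
  have hker : LinearMap.ker θ₀ = (LinearMap.range (homDual f')).restrictScalars k := by
    ext ω
    obtain ⟨x, rfl⟩ := ev₀.surjective ω
    rw [LinearMap.mem_ker, Submodule.restrictScalars_mem]
    change θ₀ (evalHom R.P₀ x) = 0 ↔ evalHom R.P₀ x ∈ _
    rw [hθ₀]
    constructor
    · intro hx
      obtain ⟨y, rfl⟩ := (R.exact x).mp hx
      exact ⟨evalHom R.P₁ y, hev y⟩
    · rintro ⟨ψ, hψ⟩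
      obtain ⟨y, rfl⟩ := ev₁.surjective ψ
      have h1 : evalHom R.P₀ (R.f y) = evalHom R.P₀ x := (hev y).symm.trans hψ
      rw [← (evalHom_bijective R.P₀).1 h1, R.p_f]
  let θ : ExtOne f' ≃ₗ[k] M :=
    (Submodule.Quotient.restrictScalarsEquiv k (LinearMap.range (homDual f'))).symm.trans
      ((Submodule.quotEquivOfEq _ _ hker.symm).trans (θ₀.quotKerEquivOfSurjective hsurj))
  have hθ : ∀ x, θ (Submodule.Quotient.mk (evalHom R.P₀ x)) = R.p x := hθ₀
  have hθs : ∀ (a : A) (z : ExtOne f'), θ (op (op a) • z) = a • θ z := by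
    intro a z
    obtain ⟨ω, rfl⟩ := Submodule.mkQ_surjective _ z
    obtain ⟨x, rfl⟩ := ev₀.surjective ω
    have h1 := hθ (a • x)
    rw [evalHom_smul, map_smul, ← hθ] at h1
    exact h1
  have := DM.perf
  refine ⟨homMod R.P₀, homMod R.P₁, f', e.toLinearMap ∘ₗ R.extMk, projective_homMod _,
    projective_homMod _, hinj, fun g => ?_, e.surjective.comp R.extMk_surjective,
    DM.pair.flip.toPerfPair.trans θ.dualMap, fun a n z => ?_⟩
  · exact (LinearEquiv.map_eq_zero_iff e (x := R.extMk g)).trans R.extMk_eq_zero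
  · change DM.pair (θ z) (a • n) = DM.pair (θ (op a • z)) n
    obtain ⟨a, rfl⟩ := op_surjective a
    rw [hθs, DM.smul]
    rfl

end Transpose

variable [Module.Finite k A] {V E : Type*} [Fintype V]

theorem IsIndecPreinjective.isIndecomposable {M : FDMod k A} (h : IsIndecPreinjective M) :
    M.IsIndecomposable := by
  cases h <;> assumption

theorem IsIndecPreinjective.dual (q : QuiverPresentation k A V E) {M : FDMod k A}
    (hM : IsIndecPreinjective M) {N : FDMod k Aᵐᵒᵖ}
    (D : DualPair k (opEquiv (α := A)) M N) : IsIndecPreprojective N := by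
  induction hM generalizing N with
  | injective I hI hinj => exact .projective N (hI.dual D) (projective_dual D)
  | translate L M hM hL h ih =>
    obtain ⟨N₁, ⟨D₁⟩⟩ := M.exists_dualPair_op
    obtain ⟨R, ⟨DR⟩⟩ := isARTranslate_iff.mp h
    have := hL.1
    have hMp := not_projective_of_translate R DR
    let AA : FDMod k A := { carrier := A }
    have : Module.Projective A AA := inferInstanceAs (Module.Projective A A)
    exact .translate N₁ N (ih D₁) (hL.dual D) (isARTranslate_dual R
      (fun f => hM.isIndecomposable.hom_projective_eq_zero q (P := AA) hMp f) DR D D₁)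

/-- The direct sum of dual pairs. -/
theorem _root_.DualPair.nonempty_pi {n : ℕ} {M : Fin n → FDMod k A} {N : Fin n → FDMod k Aᵐᵒᵖ}
    (D : ∀ i, DualPair k (opEquiv (α := A)) (M i) (N i)) :
    Nonempty (DualPair k (opEquiv (α := A)) (∀ i, M i) (∀ i, N i)) := by
  let β : (∀ i, M i) →ₗ[k] (∀ i, N i) →ₗ[k] k :=
    ∑ i, (D i).pair.compl₁₂ (LinearMap.proj i) (LinearMap.proj i)
  have hβ : ∀ m n, β m n = ∑ i, (D i).pair (m i) (n i) := fun m n => by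
    simp [β]
  refine ⟨⟨β, LinearMap.IsPerfPair.of_injective ?_ ?_, fun a m n => ?_⟩⟩
  · rw [injective_iff_map_eq_zero]
    intro m hm
    funext i
    refine (D i).ext_left fun n => ?_
    have := LinearMap.congr_fun hm (Pi.single i n)
    rw [hβ, Finset.sum_eq_single i] at this
    · simpa using this
    · intro j _ hj
      rw [Pi.single_eq_of_ne hj, map_zero]
    · simp
  · rw [injective_iff_map_eq_zero]
    intro n hn
    funext i
    refine (D i).ext_right fun m => ?_
    have := LinearMap.congr_fun hn (Pi.single i m)
    rw [LinearMap.flip_apply, hβ, Finset.sum_eq_single i] at this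
    · simpa using this
    · intro j _ hj
      rw [Pi.single_eq_of_ne hj, map_zero, LinearMap.zero_apply]
    · simp
  · rw [hβ, hβ]
    exact Finset.sum_congr rfl fun i _ => (D i).smul a _ _

theorem IsPreinjective.dual (q : QuiverPresentation k A V E) {M : FDMod k A}
    (hM : M.IsPreinjective) {N : FDMod k Aᵐᵒᵖ}
    (D : DualPair k (opEquiv (α := A)) M N) : N.IsPreprojective := by
  obtain ⟨n, M', hM', ⟨e⟩⟩ := hM
  choose N' D' using fun i => (M' i).exists_dualPair_op
  obtain ⟨D''⟩ := DualPair.nonempty_pi fun i => (D' i).some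
  exact ⟨n, N', fun i => (hM' i).dual q (D' i).some, D.nonempty_equiv D'' ⟨e⟩⟩

end FDMod

/-! ### Duality of Hall algebras -/

namespace HallAlgebra

variable {k : Type v} [Field k] {A : Type u} [Ring A] [Algebra k A]

/-- The isomorphism class of the dual module. -/
noncomputable def dualClass (x : IsoClass k Aᵐᵒᵖ) : IsoClass k A :=
  IsoClass.mk (FDMod.exists_dualPair (k := k) (A := A) (Quotient.out x : FDMod k Aᵐᵒᵖ)).choose

theorem dualClass_mk {M : FDMod k A} {N : FDMod k Aᵐᵒᵖ}
    (D : DualPair k (opEquiv (α := A)) M N) : dualClass (IsoClass.mk N) = IsoClass.mk M := by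
  have D' := (FDMod.exists_dualPair (k := k) (A := A)
    (Quotient.out (IsoClass.mk N) : FDMod k Aᵐᵒᵖ)).choose_spec.some
  exact IsoClass.mk_eq_mk.mpr ((D'.nonempty_equiv_iff D).mpr (IsoClass.nonempty_out_mk N))

theorem dualClass_injective : Function.Injective (dualClass (k := k) (A := A)) := by
  intro x y h
  have D := (FDMod.exists_dualPair (k := k) (A := A)
    (Quotient.out x : FDMod k Aᵐᵒᵖ)).choose_spec.some
  have D' := (FDMod.exists_dualPair (k := k) (A := A)
    (Quotient.out y : FDMod k Aᵐᵒᵖ)).choose_spec.some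
  obtain ⟨e⟩ := (D.nonempty_equiv_iff D').mp (IsoClass.mk_eq_mk.mp h)
  rw [← Quotient.out_eq x, ← Quotient.out_eq y]
  exact Quotient.sound ⟨e⟩

/-- The linear map between the Hall algebras of `Aᵐᵒᵖ` and `A` given by duality. -/
noncomputable def dualMap : HallAlgebra k Aᵐᵒᵖ →ₗ[ℚ] HallAlgebra k A :=
  repr.symm.toLinearMap ∘ₗ Finsupp.lmapDomain ℚ ℚ dualClass ∘ₗ repr.toLinearMap

theorem dualMap_cls {M : FDMod k A} {N : FDMod k Aᵐᵒᵖ}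
    (D : DualPair k (opEquiv (α := A)) M N) : dualMap (cls N) = cls M := by
  simp only [dualMap, cls, LinearMap.comp_apply, LinearEquiv.coe_coe,
    LinearEquiv.apply_symm_apply, Finsupp.lmapDomain_apply, Finsupp.mapDomain_single,
    dualClass_mk D]

theorem coeff_dualMap {M : FDMod k A} {N : FDMod k Aᵐᵒᵖ}
    (D : DualPair k (opEquiv (α := A)) M N) (h : HallAlgebra k Aᵐᵒᵖ) :
    coeff M (dualMap h) = coeff N h := by
  simp only [dualMap, coeff, LinearMap.comp_apply, LinearEquiv.coe_coe,
    LinearEquiv.apply_symm_apply, Finsupp.lmapDomain_apply, Finsupp.lapply_apply,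
    ← dualClass_mk D]
  exact Finsupp.mapDomain_apply dualClass_injective _ _

variable [Finite k] [Module.Finite k A] [Module.Finite k Aᵐᵒᵖ]

theorem dualMap_mul (x y : HallAlgebra k Aᵐᵒᵖ) : dualMap (x * y) = dualMap y * dualMap x := by
  induction x using induction_cls with
  | zero => simp
  | add f g hf hg => rw [add_mul, map_add, hf, hg, map_add, mul_add]
  | smul a N₁ =>
    induction y using induction_cls with
    | zero => simp
    | add f g hf hg => rw [mul_add, map_add, hf, hg, map_add, add_mul]
    | smul b N₂ =>
      rw [smul_mul_smul_comm, map_smul, map_smul, map_smul, smul_mul_smul_comm, mul_comm b a]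
      congr 1
      obtain ⟨M₁, ⟨D₁⟩⟩ := FDMod.exists_dualPair (k := k) (A := A) N₁
      obtain ⟨M₂, ⟨D₂⟩⟩ := FDMod.exists_dualPair (k := k) (A := A) N₂
      rw [dualMap_cls D₁, dualMap_cls D₂]
      refine ext_coeff fun X => ?_
      obtain ⟨Z, ⟨D⟩⟩ := X.exists_dualPair_op
      rw [coeff_dualMap D, coeff_cls_mul_cls, coeff_cls_mul_cls, FDMod.hallNumber_dual D₂ D₁ D]

theorem dualMap_one : dualMap (1 : HallAlgebra k Aᵐᵒᵖ) = 1 := by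
  obtain ⟨M, ⟨D⟩⟩ := FDMod.exists_dualPair (k := k) (A := A) (FDMod.zero k Aᵐᵒᵖ)
  have : Subsingleton (FDMod.zero k Aᵐᵒᵖ) := inferInstanceAs (Subsingleton PUnit)
  rw [← one_eq_cls D.symm.subsingleton_right]
  exact dualMap_cls D

theorem dualMap_mem_compositionAlgebra {x : HallAlgebra k Aᵐᵒᵖ}
    (hx : x ∈ compositionAlgebra k Aᵐᵒᵖ) : dualMap x ∈ compositionAlgebra k A := by
  induction hx using Algebra.adjoin_induction with
  | mem x hx =>
    obtain ⟨S, hS, rfl⟩ := hx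
    obtain ⟨M, ⟨D⟩⟩ := FDMod.exists_dualPair (k := k) (A := A) S
    rw [dualMap_cls D]
    exact Algebra.subset_adjoin ⟨M, D.symm.isSimpleModule, rfl⟩
  | algebraMap r =>
    rw [Algebra.algebraMap_eq_smul_one, map_smul, dualMap_one]
    exact Subalgebra.smul_mem _ (one_mem _) r
  | add x y _ _ hx hy =>
    rw [map_add]
    exact Subalgebra.add_mem _ hx hy
  | mul x y _ _ hx hy =>
    rw [dualMap_mul]
    exact Subalgebra.mul_mem _ hy hx

end HallAlgebra

namespace QuiverPresentation

variable {k : Type v} [Field k] {A : Type u} [Ring A] [Algebra k A] {V E : Type*} [Fintype V]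

theorem _root_.QuiverRelations.op {B : Type*} [Ring B] {s t : E → V} {e : V → B} {x : E → B}
    (h : QuiverRelations s t e x) :
    QuiverRelations t s (fun i => op (e i)) (fun a => op (x a)) where
  idem i := by rw [← op_mul, h.idem]
  orth i j hij := by rw [← op_mul, h.orth j i hij.symm, op_zero]
  sum_eq_one := by rw [← Finset.op_sum, h.sum_eq_one, op_one]
  tgt_mul a := by rw [← op_mul, h.mul_src]
  mul_src a := by rw [← op_mul, h.tgt_mul]

/-- The opposite of a presented algebra is presented by the opposite quiver. -/
def op (q : QuiverPresentation k A V E) : QuiverPresentation k Aᵐᵒᵖ V E where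
  s := q.t
  t := q.s
  e i := MulOpposite.op (q.e i)
  x a := MulOpposite.op (q.x a)
  rel := q.rel.op
  adjoin_eq_top := by
    refine eq_top_iff.mpr fun y _ => ?_
    obtain ⟨a, rfl⟩ := op_surjective y
    have ha : a ∈ Algebra.adjoin k (Set.range q.e ∪ Set.range q.x) := by
      rw [q.adjoin_eq_top]; trivial
    induction ha using Algebra.adjoin_induction with
    | mem y hy =>
      refine Algebra.subset_adjoin ?_
      rcases hy with ⟨j, rfl⟩ | ⟨a, rfl⟩
      · exact Or.inl ⟨j, rfl⟩
      · exact Or.inr ⟨a, rfl⟩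
    | algebraMap r => exact Subalgebra.algebraMap_mem _ r
    | add y z _ _ hy hz => exact Subalgebra.add_mem _ (hy trivial) (hz trivial)
    | mul y z _ _ hy hz => exact Subalgebra.mul_mem _ (hz trivial) (hy trivial)
  exists_lift B _ _ ε b h := by
    obtain ⟨F, hFe, hFx⟩ := q.exists_lift Bᵐᵒᵖ _ _ h.op
    exact ⟨AlgHom.opComm F, fun i => congrArg unop (hFe i), fun a => congrArg unop (hFx a)⟩
  rank i := Finset.univ.sup q.rank - q.rank i
  rank_lt a := by
    have h1 := q.rank_lt a
    have h2 : q.rank (q.t a) ≤ Finset.univ.sup q.rank := Finset.le_sup (Finset.mem_univ _)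
    omega

theorem preinjectiveSubalgebra_le [Finite E] [Finite k] [Module.Finite k A]
    (q : QuiverPresentation k A V E) :
    preinjectiveSubalgebra k A ≤ compositionAlgebra k A := by
  have : Module.Finite k Aᵐᵒᵖ := Module.Finite.equiv (opLinearEquiv k)
  refine Algebra.adjoin_le ?_
  rintro _ ⟨M, hM, rfl⟩
  obtain ⟨N, ⟨D⟩⟩ := M.exists_dualPair_op
  rw [← HallAlgebra.dualMap_cls D]
  exact HallAlgebra.dualMap_mem_compositionAlgebra (q.op.cls_preprojective_mem (hM.dual q D))

end QuiverPresentation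

/-! ### The presentation of the path algebra -/

namespace PathAlgebra

variable {k : Type u} [Field k] {Q : Type v} [Quiver.{w} Q]

open Classical in
/-- A path, as an element of the path algebra. -/
noncomputable def ofPath {i j : Q} (p : Quiver.Path i j) : PathAlgebra k Q :=
  fun i' j' => if h : i = i' ∧ j = j' then Finsupp.single (p.cast h.1 h.2) 1 else 0

theorem ofPath_self {i j : Q} (p : Quiver.Path i j) :
    (ofPath p : PathAlgebra k Q) i j = Finsupp.single p 1 := by
  simp [ofPath]

theorem ofPath_of_ne {i j i' j' : Q} (p : Quiver.Path i j) (h : ¬ (i = i' ∧ j = j')) :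
    (ofPath p : PathAlgebra k Q) i' j' = 0 := by
  simp [ofPath, h]

variable [Fintype Q]

theorem sum_apply {ι : Type*} (s : Finset ι) (f : ι → PathAlgebra k Q) (i j : Q) :
    (∑ a ∈ s, f a) i j = ∑ a ∈ s, f a i j := by
  classical
  induction s using Finset.induction_on with
  | empty => rfl
  | insert a s ha ih => rw [Finset.sum_insert ha, Finset.sum_insert ha, add_apply, ih]

theorem ofPath_mul {i j l : Q} (p : Quiver.Path i j) (r : Quiver.Path j l) :
    (ofPath r * ofPath p : PathAlgebra k Q) = ofPath (p.comp r) := by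
  ext1 i' l'
  rw [mul_apply]
  by_cases h : i = i' ∧ l = l'
  · obtain ⟨rfl, rfl⟩ := h
    rw [Finset.sum_eq_single j, ofPath_self, ofPath_self, ofPath_self, pathConcat_single, one_mul]
    · intro j' _ hj
      rw [ofPath_of_ne p (fun h => hj h.2.symm), map_zero, LinearMap.zero_apply]
    · simp
  · rw [ofPath_of_ne _ h]
    refine Finset.sum_eq_zero fun j' _ => ?_
    by_cases hi : i = i'
    · rw [ofPath_of_ne r (fun h' => h ⟨hi, h'.2⟩), map_zero]
    · rw [ofPath_of_ne p (fun h' => hi h'.1), map_zero, LinearMap.zero_apply]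

theorem ofPath_mul_of_ne {i j j' l : Q} (h : j ≠ j') (p : Quiver.Path i j)
    (r : Quiver.Path j' l) : (ofPath r * ofPath p : PathAlgebra k Q) = 0 := by
  ext1 i' l'
  rw [mul_apply, zero_apply]
  refine Finset.sum_eq_zero fun m _ => ?_
  by_cases hm : j = m
  · rw [ofPath_of_ne r (fun h' => h (hm.trans h'.1.symm)), map_zero]
  · rw [ofPath_of_ne p (fun h' => hm h'.2), map_zero, LinearMap.zero_apply]

theorem sum_ofPath_nil : ∑ i : Q, (ofPath (Quiver.Path.nil : Quiver.Path i i)) =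
    (1 : PathAlgebra k Q) := by
  ext1 i j
  rw [sum_apply]
  by_cases h : i = j
  · subst h
    rw [one_apply_self, Finset.sum_eq_single i, ofPath_self]
    · exact fun l _ hl => ofPath_of_ne _ fun h => hl h.1
    · simp
  · rw [one_apply_ne h]
    exact Finset.sum_eq_zero fun l _ => ofPath_of_ne _ fun hl => h (hl.1.symm.trans hl.2)

/-- The arrows of the quiver. -/
abbrev Arrow (Q : Type v) [Quiver.{w} Q] : Type (max v w) := Σ i j : Q, (i ⟶ j)

theorem quiverRelations : QuiverRelations (fun a : Arrow Q => a.1) (fun a => a.2.1)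
    (fun i => (ofPath (Quiver.Path.nil : Quiver.Path i i) : PathAlgebra k Q))
    (fun a => ofPath a.2.2.toPath) where
  idem i := by rw [ofPath_mul]; rfl
  orth i j h := ofPath_mul_of_ne h.symm _ _
  sum_eq_one := sum_ofPath_nil
  tgt_mul a := by rw [ofPath_mul]; rfl
  mul_src a := by rw [ofPath_mul, Quiver.Path.nil_comp]

theorem sum_smul_ofPath (x : PathAlgebra k Q) :
    ∑ i : Q, ∑ j : Q, ∑ r ∈ (x i j).support, x i j r • (ofPath r : PathAlgebra k Q) = x := by
  ext1 i j
  rw [sum_apply, Finset.sum_eq_single i, sum_apply, Finset.sum_eq_single j, sum_apply]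
  · simp only [smul_apply, ofPath_self, Finsupp.smul_single, smul_eq_mul, mul_one]
    exact (x i j).sum_single
  · intro j' _ hj
    rw [sum_apply]
    refine Finset.sum_eq_zero fun r _ => ?_
    rw [smul_apply, ofPath_of_ne r (fun h => hj h.2), smul_zero]
  · simp
  · intro i' _ hi
    rw [sum_apply]
    refine Finset.sum_eq_zero fun j' _ => ?_
    rw [sum_apply]
    refine Finset.sum_eq_zero fun r _ => ?_
    rw [smul_apply, ofPath_of_ne r (fun h => hi h.1), smul_zero]
  · simp

/-- Induction principle: the paths span the path algebra. -/
theorem induction_ofPath {p : PathAlgebra k Q → Prop} (x : PathAlgebra k Q)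
    (zero : p 0) (add : ∀ x y, p x → p y → p (x + y))
    (smul : ∀ (c : k) (i j : Q) (r : Quiver.Path i j), p (c • ofPath r)) : p x := by
  rw [← sum_smul_ofPath x]
  exact Finset.sum_induction _ p add zero fun i _ =>
    Finset.sum_induction _ p add zero fun j _ =>
      Finset.sum_induction _ p add zero fun r _ => smul _ i j r

theorem adjoin_ofPath_eq_top : Algebra.adjoin k
    (Set.range (fun i => (ofPath (Quiver.Path.nil : Quiver.Path i i) : PathAlgebra k Q)) ∪
      Set.range (fun a : Arrow Q => ofPath a.2.2.toPath)) = ⊤ := by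
  refine eq_top_iff.mpr fun x _ => ?_
  induction x using induction_ofPath with
  | zero => exact Subalgebra.zero_mem _
  | add x y hx hy => exact Subalgebra.add_mem _ (hx trivial) (hy trivial)
  | smul c i j r =>
    refine Subalgebra.smul_mem _ ?_ c
    induction r with
    | nil => exact Algebra.subset_adjoin (Or.inl ⟨i, rfl⟩)
    | cons r a ih =>
      have h : (ofPath (r.cons a) : PathAlgebra k Q) = ofPath a.toPath * ofPath r := by
        rw [ofPath_mul]; rfl
      rw [h]
      exact Subalgebra.mul_mem _ (Algebra.subset_adjoin (Or.inr ⟨⟨_, _, a⟩, rfl⟩)) (ih trivial)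

section Lift

variable {B : Type*} [Ring B] [Algebra k B] (ε : Q → B) (b : Arrow Q → B)

/-- The element of `B` associated with a path. -/
def pathLift {i : Q} : ∀ {j : Q}, Quiver.Path i j → B
  | _, .nil => ε i
  | _, .cons r a => b ⟨_, _, a⟩ * pathLift r

/-- The linear map out of the path algebra given by elements for vertices and arrows. -/
noncomputable def linearLift : PathAlgebra k Q →ₗ[k] B :=
  ∑ i : Q, ∑ j : Q, (Finsupp.lsum k fun r : Quiver.Path i j =>
    LinearMap.toSpanSingleton k B (pathLift ε b r)) ∘ₗ
      ((LinearMap.proj j : (∀ j, Quiver.Path i j →₀ k) →ₗ[k] _) ∘ₗ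
        (LinearMap.proj i : (∀ i j, Quiver.Path i j →₀ k) →ₗ[k] _))

theorem linearLift_ofPath {i j : Q} (r : Quiver.Path i j) :
    linearLift ε b (ofPath r : PathAlgebra k Q) = pathLift ε b r := by
  have h : ∀ x : PathAlgebra k Q, linearLift ε b x = ∑ i : Q, ∑ j : Q,
      (Finsupp.lsum k fun r : Quiver.Path i j =>
        LinearMap.toSpanSingleton k B (pathLift ε b r)) (x i j) := fun x => by
    simp only [linearLift, LinearMap.sum_apply]
    rfl
  rw [h, Finset.sum_eq_single i, Finset.sum_eq_single j, ofPath_self]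
  · simp
  · intro j' _ hj
    rw [ofPath_of_ne r fun h => hj h.2.symm, map_zero]
  · simp
  · intro i' _ hi
    exact Finset.sum_eq_zero fun j' _ => by
      rw [ofPath_of_ne r fun h => hi h.1.symm, map_zero]
  · simp

variable {ε b}

theorem tgt_mul_pathLift
    (h : QuiverRelations (fun a : Arrow Q => a.1) (fun a => a.2.1) ε b)
    {i j : Q} (r : Quiver.Path i j) :
    ε j * pathLift ε b r = pathLift ε b r := by
  cases r with
  | nil => exact h.idem i
  | cons r a => rw [pathLift, ← mul_assoc, h.tgt_mul ⟨_, _, a⟩]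

theorem pathLift_mul_src
    (h : QuiverRelations (fun a : Arrow Q => a.1) (fun a => a.2.1) ε b)
    {i j : Q} (r : Quiver.Path i j) :
    pathLift ε b r * ε i = pathLift ε b r := by
  induction r with
  | nil => exact h.idem i
  | cons r a ih => rw [pathLift, mul_assoc, ih]

theorem pathLift_comp
    (h : QuiverRelations (fun a : Arrow Q => a.1) (fun a => a.2.1) ε b)
    {i j l : Q} (p : Quiver.Path i j) (r : Quiver.Path j l) :
    pathLift ε b (p.comp r) = pathLift ε b r * pathLift ε b p := by
  induction r with
  | nil => exact (tgt_mul_pathLift h p).symm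
  | cons r a ih => rw [Quiver.Path.comp_cons, pathLift, pathLift, ih, mul_assoc]

theorem pathLift_mul_of_ne
    (h : QuiverRelations (fun a : Arrow Q => a.1) (fun a => a.2.1) ε b)
    {i j j' l : Q} (hj : j ≠ j') (p : Quiver.Path i j)
    (r : Quiver.Path j' l) : pathLift ε b r * pathLift ε b p = 0 := by
  rw [← pathLift_mul_src h r, ← tgt_mul_pathLift h p, mul_assoc, ← mul_assoc (ε j'),
    h.orth j' j hj.symm, zero_mul, mul_zero]

theorem linearLift_mul
    (h : QuiverRelations (fun a : Arrow Q => a.1) (fun a => a.2.1) ε b)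
    (x y : PathAlgebra k Q) :
    linearLift ε b (x * y) = linearLift ε b x * linearLift ε b y := by
  induction x using induction_ofPath with
  | zero => simp
  | add x x' hx hx' => rw [add_mul, map_add, hx, hx', map_add, add_mul]
  | smul c j' l r =>
    induction y using induction_ofPath with
    | zero => simp
    | add y y' hy hy' => rw [mul_add, map_add, hy, hy', map_add, mul_add]
    | smul c' i j p =>
      rw [smul_mul_smul_comm, map_smul, map_smul, map_smul, smul_mul_smul_comm,
        linearLift_ofPath, linearLift_ofPath]
      congr 1
      by_cases hj : j = j'
      · subst hj
        rw [ofPath_mul, linearLift_ofPath, pathLift_comp h]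
      · rw [ofPath_mul_of_ne hj, map_zero, pathLift_mul_of_ne h hj]

theorem exists_lift
    (h : QuiverRelations (fun a : Arrow Q => a.1) (fun a => a.2.1) ε b)
    : ∃ F : PathAlgebra k Q →ₐ[k] B,
    (∀ i, F (ofPath (Quiver.Path.nil : Quiver.Path i i)) = ε i) ∧
      ∀ a : Arrow Q, F (ofPath a.2.2.toPath) = b a := by
  refine ⟨AlgHom.ofLinearMap (linearLift ε b) ?_ (linearLift_mul h), fun i => ?_, fun a => ?_⟩
  · rw [← sum_ofPath_nil, map_sum, ← h.sum_eq_one]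
    exact Finset.sum_congr rfl fun i _ => linearLift_ofPath ε b _
  · exact linearLift_ofPath ε b _
  · exact (linearLift_ofPath ε b _).trans (h.mul_src a)

end Lift

variable (Q) in
/-- In a finite quiver without oriented cycles, the vertices can be numbered so that the number
increases along each arrow. -/
theorem exists_rank [Quiver.NoOrientedCycles Q] :
    ∃ rank : Q → ℕ, ∀ a : Arrow Q, rank a.1 < rank a.2.1 := by
  classical
  refine ⟨fun j => (Finset.univ.filter fun i => ∃ p : Quiver.Path i j, p.length ≠ 0).card, ?_⟩
  rintro ⟨i, j, a⟩
  refine Finset.card_lt_card (Finset.ssubset_iff_of_subset ?_ |>.mpr ⟨i, ?_, ?_⟩)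
  · intro l hl
    obtain ⟨p, hp⟩ := (Finset.mem_filter.mp hl).2
    exact Finset.mem_filter.mpr ⟨Finset.mem_univ _, p.cons a, by simp⟩
  · exact Finset.mem_filter.mpr ⟨Finset.mem_univ _, a.toPath, by simp [Quiver.Hom.toPath]⟩
  · intro hi
    obtain ⟨p, hp⟩ := (Finset.mem_filter.mp hi).2
    rw [Quiver.NoOrientedCycles.eq_nil i p] at hp
    exact hp rfl

variable (k Q) in
/-- The path algebra of a finite quiver without oriented cycles is presented by the quiver. -/
noncomputable def presentation [Quiver.NoOrientedCycles Q] :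
    QuiverPresentation k (PathAlgebra k Q) Q (Arrow Q) where
  s a := a.1
  t a := a.2.1
  e i := ofPath (Quiver.Path.nil : Quiver.Path i i)
  x a := ofPath a.2.2.toPath
  rel := quiverRelations
  adjoin_eq_top := adjoin_ofPath_eq_top
  exists_lift _ _ _ _ _ h := exists_lift h
  rank := (exists_rank Q).choose
  rank_lt := (exists_rank Q).choose_spec

end PathAlgebra

theorem mainTheorem5 (k : Type u) [Field k] [Finite k] (Q : Type v) [Quiver.{w} Q] [Fintype Q]
    [∀ i j : Q, Finite (i ⟶ j)] [Quiver.NoOrientedCycles Q] :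
    preprojectiveSubalgebra k (PathAlgebra k Q) ≤ compositionAlgebra k (PathAlgebra k Q) ∧
      preinjectiveSubalgebra k (PathAlgebra k Q) ≤ compositionAlgebra k (PathAlgebra k Q) :=
  ⟨(PathAlgebra.presentation k Q).preprojectiveSubalgebra_le,
    (PathAlgebra.presentation k Q).preinjectiveSubalgebra_le⟩
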